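/- Let $Q\subset\mathbb R^2$ be a convex polygon including its (non-empty) interior, let $W\subseteq\mathbb R^2$ be any convex set, and let $\eta_1,\dots,\eta_n>0$ be cost parameters. For a deployment $P=(p_1,\dots,p_n)\in(\mathbb R^2)^n$ of $n$ sensors, the weighted Voronoi cell of sensor $i$ is $$V^H_i(P)=\{q\in Q:\ \eta_i\|q-p_i\|^2\le\eta_j\|q-p_j\|^2\ \text{ for all } j\}.$$ (It need not be star-shaped.) Let $a,b\in\mathbb R$, and let $\varphi_i:\mathbb R^2\times(a,b)^2\to\mathbb R$, $i=1,\dots,n$, be continuous functions such that for almost every $q$ the function $\varphi_i(q,\cdot)$ is continuously differentiable on $(a,b)^2$, and for every $x\in(a,b)^2$ the maps $q\mapsto\varphi_i(q,x)$ and $q\mapsto\frac{\partial\varphi_i}{\partial x}(q,x)$ are measurable and integrable on $\mathbb R^2$. Suppose also that $\frac{\partial\varphi_i}{\partial x}$ is locally dominated on $Q\cap W$: every $p\in(a,b)^2$ has a neighbourhood $N\subseteq(a,b)^2$ and an integrable function $g$ on $Q\cap W$ with $\|\frac{\partial\varphi_i}{\partial x}(q,x)\|\le g(q)$ for almost every $q\in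 Q\cap W$ and all $x\in N$ (this holds automatically if $\frac{\partial\varphi_i}{\partial x}$ is continuous on $\mathbb R^2\times(a,b)^2$). Fix $i$, and let $U_i$ be the set of the deployments $P$ of pairwise distinct sensors in $(a,b)^2$ such that the interfaces of the cell of sensor $i$ do not run along the boundary of $Q\cap W$, that is, such that the set of the points $q\in\partial(Q\cap W)$ with $\eta_i\|q-p_i\|^2\le\eta_k\|q-p_k\|^2$ for all $k$, and with equality for some $k\ne i$, has length (one-dimensional Hausdorff measure) zero. Let $$F_i(P)=\int_{V^H_i(P)\cap W}\varphi_i(q,p_i)\,dq .$$ Then $F_i$ is continuously differentiable on $U_i$: it is differentiable at every $P\in U_i$, and its derivative is continuous on $U_i$. Moreover, for every $P\in U_i$ and every $j$, $$\frac{\partial F_i}{\partial p_j}(P)=\int_{V^H_i(P)\cap W}\frac{\partial\varphi_i(q,p_i)}{\partial p_j}\,dq+\int_{\partial[V^H_i(P)\cap W]}\varphi_i(\gamma,p_i)\,n^t(\gamma)\,\frac{\partial\gamma}{\partial p_j}\,d\gamma ,$$ where the second integral is with respect to arc length and its integrand is integrable. Here $n(\gamma)$ is the unit outward normal of $V^H_i(P)\cap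 W$; it exists at almost every boundary point if $Q\cap W$ has non-empty interior (where there is none, $n(\gamma)=0$ by convention). And $\frac{\partial\gamma}{\partial p_j}$ is, at a boundary point $\gamma$, the derivative at $p_j$ of a map $p'\mapsto\gamma(p')$ that is differentiable at $p_j$, takes $p_j$ to $\gamma$, and takes every $p'$ close to $p_j$ to a boundary point of the set $V^H_i(P')\cap W$, where $P'$ is $P$ with $p_j$ replaced by $p'$. Such a derivative exists at almost every boundary point, and the formula holds for every choice of it. -/

import Mathlib

open MeasureTheory Set Filter Topology

noncomputable section

/-- The Euclidean plane. -/
abbrev Plane : Type := EuclideanSpace ℝ (Fin 2)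

/-- A convex polygon including its interior: the convex hull of finitely many points, with
non-empty interior. -/
def IsConvexPolygon (Q : Set Plane) : Prop :=
  (∃ S : Finset Plane, Q = convexHull ℝ (S : Set Plane)) ∧ (interior Q).Nonempty

/-- The open square `(a, b)²`. -/
def openSquare (a b : ℝ) : Set Plane := {x | ∀ k : Fin 2, x k ∈ Ioo a b}

/-- The weighted Voronoi cell of sensor `i` in the target region `Q`, for the deployment `P` and
the cost parameters `η`. -/
def weightedVoronoi {n : ℕ} (Q : Set Plane) (η : Fin n → ℝ) (P : Fin n → Plane) (i : Fin n) :
    Set Plane :=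
  {q | q ∈ Q ∧ ∀ j, η i * ‖q - P i‖ ^ 2 ≤ η j * ‖q - P j‖ ^ 2}

/-- The points where the sensor `i` has the least cost, and shares it with another sensor: these
are the points of the interfaces between the cell of `i` and the other cells. -/
def cellInterface {n : ℕ} (η : Fin n → ℝ) (P : Fin n → Plane) (i : Fin n) : Set Plane :=
  {q | (∀ j, η i * ‖q - P i‖ ^ 2 ≤ η j * ‖q - P j‖ ^ 2) ∧
    ∃ j, j ≠ i ∧ η i * ‖q - P i‖ ^ 2 = η j * ‖q - P j‖ ^ 2}

/-- The deployments of pairwise distinct sensors in `(a, b)²` for which the interfaces of the cell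
of sensor `i` overlap with the boundary of `Q ∩ W` in a set of length zero at most. -/
def regularDeployments {n : ℕ} (a b : ℝ) (Q W : Set Plane) (η : Fin n → ℝ) (i : Fin n) :
    Set (Fin n → Plane) :=
  {P | (∀ k, P k ∈ openSquare a b) ∧ Function.Injective P ∧
    μH[1] (cellInterface η P i ∩ frontier (Q ∩ W)) = 0}

/-- `ν` is a unit outward normal of `S` at `x`: for every `ε > 0`, close to `x`, the points whose
direction from `x` has inner product less than `-ε` with `ν` are in `S`, and those for which it is
greater than `ε` are outside. -/
def IsOutwardNormal (S : Set Plane) (x ν : Plane) : Prop :=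
  ‖ν‖ = 1 ∧ ∀ ε > 0, ∀ᶠ y in 𝓝 x,
    (inner ℝ (y - x) ν < -(ε * ‖y - x‖) → y ∈ S) ∧ (ε * ‖y - x‖ < inner ℝ (y - x) ν → y ∉ S)

/-- There is at most one unit outward normal. -/
theorem IsOutwardNormal.unique {S : Set Plane} {x ν μ : Plane} (hν : IsOutwardNormal S x ν)
    (hμ : IsOutwardNormal S x μ) : ν = μ := by
  by_contra hne
  have h1 : inner ℝ ν ν = (1 : ℝ) := by rw [real_inner_self_eq_norm_sq, hν.1]; norm_num
  have h2 : inner ℝ μ μ = (1 : ℝ) := by rw [real_inner_self_eq_norm_sq, hμ.1]; norm_num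
  have hlt : inner ℝ ν μ < (1 : ℝ) := inner_lt_one_iff_real_of_norm_eq_one hν.1 hμ.1 |>.2 hne
  set c : ℝ := 1 - inner ℝ ν μ with hc
  have hcpos : 0 < c := by linarith
  have hu : 0 < ‖μ - ν‖ := norm_pos_iff.2 (sub_ne_zero.2 (Ne.symm hne))
  set ε : ℝ := c / (2 * ‖μ - ν‖) with hε
  have hεpos : 0 < ε := by positivity
  have hεu : ε * ‖μ - ν‖ = c / 2 := by rw [hε]; field_simp
  have hev := (hν.2 ε hεpos).and (hμ.2 ε hεpos)
  have ht : Tendsto (fun t : ℝ => x + t • (μ - ν)) (𝓝[>] 0) (𝓝 x) := by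
    have : Tendsto (fun t : ℝ => x + t • (μ - ν)) (𝓝 0) (𝓝 (x + (0 : ℝ) • (μ - ν))) :=
      Continuous.tendsto (by fun_prop) 0
    rw [zero_smul, add_zero] at this
    exact this.mono_left nhdsWithin_le_nhds
  obtain ⟨t, ⟨hA, hB⟩, htpos⟩ := ((ht.eventually hev).and self_mem_nhdsWithin).exists
  have htpos : 0 < t := htpos
  have hsub : x + t • (μ - ν) - x = t • (μ - ν) := by abel
  have hn : ε * ‖x + t • (μ - ν) - x‖ = t * (c / 2) := by
    rw [hsub, norm_smul, Real.norm_of_nonneg htpos.le, ← hεu]; ring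
  have hc1 : inner ℝ (x + t • (μ - ν) - x) ν = t * (-c) := by
    rw [hsub, real_inner_smul_left, inner_sub_left, h1, real_inner_comm ν μ, hc]; ring
  have hc2 : inner ℝ (x + t • (μ - ν) - x) μ = t * c := by
    rw [hsub, real_inner_smul_left, inner_sub_left, h2, hc]
  rw [hn, hc1] at hA
  rw [hn, hc2] at hB
  exact hB.2 (by nlinarith) (hA.1 (by nlinarith))

open Classical in
/-- The unit outward normal of `S` at `x`; by convention it is `0` where there is none. -/
def outwardNormal (S : Set Plane) (x : Plane) : Plane :=
  if h : ∃ ν, IsOutwardNormal S x ν then h.choose else 0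

/-- `L` is a derivative `∂γ/∂p` at the parameter `p` of a boundary point `γ(p) = x` of the set
`S p` that moves with `p`: here `γ` is a map, differentiable at `p`, that takes every parameter
`p'` close to `p` to a boundary point of `S p'`. -/
def IsBoundaryVelocity (S : Plane → Set Plane) (p x : Plane) (L : Plane →L[ℝ] Plane) : Prop :=
  ∃ γ : Plane → Plane, γ p = x ∧ (∀ᶠ p' in 𝓝 p, γ p' ∈ frontier (S p')) ∧ HasFDerivAt γ L p

/-- The integral of `φ i (·, p_i)` over the part in `W` of the weighted Voronoi cell of sensor
`i`, as a function of the deployment. -/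
def cellIntegral {n : ℕ} (Q W : Set Plane) (η : Fin n → ℝ) (φ : Fin n → Plane → Plane → ℝ)
    (i : Fin n) (P : Fin n → Plane) : ℝ :=
  ∫ q in weightedVoronoi Q η P i ∩ W, φ i q (P i)

end

/-! ### Curves of constant speed and arc length -/

noncomputable section

/-! The cell is cut out of `Q ∩ W` by the inequalities `0 ≤ costDiff η i j P q`, one for each sensor
`j`. The zero set of each cost difference is a circle of Apollonius, or a perpendicular bisector if
the two cost parameters agree, and the gradient has constant norm `costSlope` along it
(`norm_costGrad`). Since the frontier of a convex set is null, the integral over the cell is the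
integral over `interior (Q ∩ W)` of the integrand times a product of the indicators `costInd`
(`setIntegral_cell`).

The increment of this integral splits in two. The change of the integrand is differentiated under
the integral sign, by the domination hypothesis, and gives `interiorTerm`. The change of the product
telescopes into a sum over `j`, where a single indicator changes and the other factors form a
weight. Each summand is an integral over the thin region between the old and the new interface with
`j`. In Cartesian or polar coordinates the old interface is `r = R` and the new one is a graph `r =
ρ P t`, so on each fibre it is an integral with one moving endpoint, and domination allows
differentiation across the fibres (`hasFDerivAt_integral_moving_graph`). The outcome is the integral
along the interface of the integrand times `costDeriv / costSlope` (`interfaceTerm`).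

This requires the weight to be continuous at almost every point of the interface, jointly in
deployment and point. It jumps only at other interfaces, which meet the given one in finitely many
points (by an inversion), and on the frontier of `Q ∩ W`. Where sensor `i` has least cost,
regularity of the deployment makes the overlap with that frontier negligible; elsewhere the weight
is locally zero. The same fact, with dominated convergence along the interfaces parametrised over a
fixed interval, makes the derivative continuous.

The sum of interface terms is then identified with the boundary integral. Almost every boundary
point of the cell is of one of two kinds. If it is on the frontier of `Q ∩ W` and all other sensors
are strictly more expensive, the cell is locally `Q ∩ W` for all nearby deployments, so a velocity
is orthogonal to the normal and contributes nothing. If it is on one interface only, inside `Q ∩ W`,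
differentiating `costDiff = 0` along the moving point determines the normal component of every
velocity as `costDeriv / costSlope`. Velocities exist by the implicit function theorem there and are
zero at points of the first kind; normals exist because a convex set has only countably many
corners. -/

/-- The curve `κ` is `s`-Lipschitz, and at small scales it is almost a similarity of ratio `s`. -/
def HasConstantSpeed (κ : ℝ → Plane) (s : ℝ) : Prop :=
  (∀ t t', dist (κ t) (κ t') ≤ s * |t - t'|) ∧
    ∀ C > 1, ∃ δ > 0, ∀ t t', |t - t'| ≤ δ → s * |t - t'| ≤ C * dist (κ t) (κ t')

theorem HasConstantSpeed.continuous {κ : ℝ → Plane} {s : ℝ} (h : HasConstantSpeed κ s)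
    (hs : 0 < s) : Continuous κ := by
  have : LipschitzWith ⟨s, hs.le⟩ κ := LipschitzWith.of_dist_le_mul fun t t' => by
    rw [Real.dist_eq]; exact h.1 t t'
  exact this.continuous

/-- The Lipschitz bound gives `≤`. For `≥`, `A` is cut into pieces of length at most `δ`, on each of
which the inverse of `κ` is `C / s`-Lipschitz; the pieces are summed and `C` tends to `1`. -/
theorem HasConstantSpeed.hausdorffMeasure_image {κ : ℝ → Plane} {s : ℝ}
    (h : HasConstantSpeed κ s) (hs : 0 < s) {A : Set ℝ} (hA : MeasurableSet A)
    (hinj : InjOn κ A) : μH[1] (κ '' A) = ENNReal.ofReal s * volume A := by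
  apply le_antisymm
  · have hl : LipschitzOnWith ⟨s, hs.le⟩ κ A := (LipschitzWith.of_dist_le_mul fun t t' => by
      rw [Real.dist_eq]; exact h.1 t t').lipschitzOnWith
    have := hl.hausdorffMeasure_image_le (d := 1) zero_le_one
    rw [hausdorffMeasure_real, ENNReal.rpow_one] at this
    refine this.trans (le_of_eq ?_)
    congr 1
    rw [ENNReal.ofReal, Real.toNNReal_of_nonneg hs.le]
    rfl
  · have key : ∀ C : ℝ, 1 < C →
        ENNReal.ofReal s * volume A ≤ ENNReal.ofReal C * μH[1] (κ '' A) := by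
      intro C hC
      obtain ⟨δ, hδ, hd⟩ := h.2 C hC
      set J : ℤ → Set ℝ := fun k => A ∩ Ico (k • δ) ((k + 1) • δ) with hJ
      have hJm : ∀ k, MeasurableSet (J k) := fun k => hA.inter measurableSet_Ico
      have hJA : ∀ k, J k ⊆ A := fun k => inter_subset_left
      have hU : A = ⋃ k, J k := by
        rw [hJ, ← inter_iUnion, iUnion_Ico_zsmul hδ, inter_univ]
      have hdis : Pairwise (Function.onFun Disjoint J) := fun k l hkl =>
        (pairwise_disjoint_Ico_zsmul δ hkl).mono inter_subset_right inter_subset_right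
      have hpiece : ∀ k, ENNReal.ofReal s * volume (J k) ≤
          ENNReal.ofReal C * μH[1] (κ '' J k) := by
        intro k
        have hC0 : 0 < C := by linarith
        have hl : LipschitzOnWith ⟨C / s, by positivity⟩ (Function.invFunOn κ (J k))
            (κ '' J k) := by
          refine LipschitzOnWith.of_dist_le_mul ?_
          rintro _ ⟨t, ht, rfl⟩ _ ⟨t', ht', rfl⟩
          rw [(hinj.mono (hJA k)).leftInvOn_invFunOn ht,
            (hinj.mono (hJA k)).leftInvOn_invFunOn ht', Real.dist_eq]
          have hclose : |t - t'| ≤ δ := by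
            have h1 := ht.2
            have h2 := ht'.2
            rw [add_smul, one_smul] at h1 h2
            rw [abs_le]; constructor <;> linarith [h1.1, h1.2, h2.1, h2.2]
          have := hd t t' hclose
          change |t - t'| ≤ C / s * _
          rw [div_mul_eq_mul_div, le_div_iff₀ hs]; linarith
        have := hl.hausdorffMeasure_image_le (d := 1) zero_le_one
        rw [(hinj.mono (hJA k)).leftInvOn_invFunOn.image_image, hausdorffMeasure_real,
          ENNReal.rpow_one] at this
        calc ENNReal.ofReal s * volume (J k)
            ≤ ENNReal.ofReal s * (ENNReal.ofReal (C / s) * μH[1] (κ '' J k)) := by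
              refine mul_le_mul_right (this.trans (le_of_eq ?_)) _
              congr 1
              rw [ENNReal.ofReal, Real.toNNReal_of_nonneg (by positivity)]
              rfl
          _ = _ := by
              rw [← mul_assoc, ← ENNReal.ofReal_mul hs.le]
              congr 2; field_simp
      have hsum : μH[1] (κ '' A) = ∑' k, μH[1] (κ '' J k) := by
        conv_lhs => rw [hU, image_iUnion]
        refine measure_iUnion (fun k l hkl => ?_) (fun k => ?_)
        · exact (disjoint_image_image fun a ha b hb hab =>
            (disjoint_left.1 (hdis hkl) ha) (hinj (hJA k ha) (hJA l hb) hab ▸ hb))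
        · exact (hJm k).image_of_continuousOn_injOn (h.continuous hs).continuousOn
            (hinj.mono (hJA k))
      have hvol : volume A = ∑' k, volume (J k) := by
        conv_lhs => rw [hU]
        exact measure_iUnion hdis hJm
      rw [hsum, hvol, ← ENNReal.tsum_mul_left, ← ENNReal.tsum_mul_left]
      exact ENNReal.tsum_le_tsum hpiece
    have ht : Tendsto (fun C : ℝ => ENNReal.ofReal C * μH[1] (κ '' A)) (𝓝[>] 1)
        (𝓝 (ENNReal.ofReal 1 * μH[1] (κ '' A))) :=
      ENNReal.Tendsto.mul_const
        ((ENNReal.continuous_ofReal.tendsto 1).mono_left nhdsWithin_le_nhds) (Or.inl (by simp))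
    rw [ENNReal.ofReal_one, one_mul] at ht
    exact ge_of_tendsto ht (eventually_mem_nhdsWithin.mono fun C hC => key C hC)

theorem HasConstantSpeed.restrict_image_eq_map {κ : ℝ → Plane} {s : ℝ}
    (h : HasConstantSpeed κ s) (hs : 0 < s) {I : Set ℝ} (hI : MeasurableSet I)
    (hinj : InjOn κ I) :
    (μH[1] : Measure Plane).restrict (κ '' I) =
      (ENNReal.ofReal s • volume.restrict I).map κ := by
  ext B hB
  have hm := (h.continuous hs).measurable
  rw [Measure.restrict_apply hB, Measure.map_apply hm hB, Measure.smul_apply,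
    Measure.restrict_apply (hm hB), smul_eq_mul, inter_comm, ← image_inter_preimage, inter_comm,
    h.hausdorffMeasure_image hs ((hm hB).inter hI) (hinj.mono inter_subset_right)]

/-- The unit vector of the plane in the direction `t`. -/
def dirVec (t : ℝ) : Plane := !₂[Real.cos t, Real.sin t]

theorem inner_dirVec (t t' : ℝ) : inner ℝ (dirVec t) (dirVec t') = Real.cos (t - t') := by
  simp [dirVec, PiLp.inner_apply, Fin.sum_univ_two, Real.cos_sub]; ring

theorem norm_dirVec (t : ℝ) : ‖dirVec t‖ = 1 := by
  have : ‖dirVec t‖ ^ 2 = 1 := by rw [← real_inner_self_eq_norm_sq, inner_dirVec]; simp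
  nlinarith [norm_nonneg (dirVec t)]

theorem continuous_dirVec : Continuous dirVec := by
  unfold dirVec
  refine (PiLp.continuous_toLp 2 _).comp (continuous_pi fun k => ?_)
  fin_cases k
  · exact Real.continuous_cos
  · exact Real.continuous_sin

theorem norm_dirVec_sub (t t' : ℝ) : ‖dirVec t - dirVec t'‖ = 2 * |Real.sin ((t - t') / 2)| := by
  have : ‖dirVec t - dirVec t'‖ ^ 2 = (2 * |Real.sin ((t - t') / 2)|) ^ 2 := by
    rw [norm_sub_sq_real, norm_dirVec, norm_dirVec, inner_dirVec, mul_pow, sq_abs,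
      Real.sin_sq_eq_half_sub, mul_div_cancel₀ _ (two_ne_zero)]
    ring
  exact (sq_eq_sq₀ (norm_nonneg _) (by positivity)).1 this

theorem injOn_dirVec : InjOn dirVec (Ioc (-Real.pi) Real.pi) := by
  intro t ht t' ht' h
  have h0 : ‖dirVec t - dirVec t'‖ = 0 := by rw [h, sub_self, norm_zero]
  rw [norm_dirVec_sub] at h0
  have h1 : Real.sin ((t - t') / 2) = 0 := by simpa using h0
  have := (Real.sin_eq_zero_iff_of_lt_of_lt (x := (t - t') / 2) (by linarith [ht.1, ht'.2])
    (by linarith [ht.2, ht'.1])).1 h1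
  linarith

theorem exists_eq_dirVec {v : Plane} (hv : ‖v‖ = 1) :
    ∃ t ∈ Ioc (-Real.pi) Real.pi, dirVec t = v := by
  have hz : ‖(⟨v 0, v 1⟩ : ℂ)‖ = 1 := by
    rw [← hv, EuclideanSpace.norm_eq, Fin.sum_univ_two, Complex.norm_eq_sqrt_sq_add_sq]
    simp
  have hz0 : (⟨v 0, v 1⟩ : ℂ) ≠ 0 := by
    intro h; rw [h, norm_zero] at hz; exact zero_ne_one hz
  refine ⟨Complex.arg ⟨v 0, v 1⟩, Complex.arg_mem_Ioc _, ?_⟩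
  ext k
  fin_cases k
  · simp [dirVec, Complex.cos_arg hz0, hz]
  · simp [dirVec, Complex.sin_arg, hz]

/-- The circle of centre `c` and radius `R`. -/
def circleCurve (c : Plane) (R t : ℝ) : Plane := c + R • dirVec t

theorem hasConstantSpeed_circleCurve (c : Plane) {R : ℝ} (hR : 0 < R) :
    HasConstantSpeed (circleCurve c R) R := by
  have hd : ∀ t t', dist (circleCurve c R t) (circleCurve c R t') =
      R * (2 * |Real.sin ((t - t') / 2)|) := fun t t' => by
    rw [circleCurve, circleCurve, dist_add_left, dist_eq_norm, ← smul_sub, norm_smul,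
      norm_dirVec_sub, Real.norm_of_nonneg hR.le]
  refine ⟨fun t t' => ?_, fun C hC => ?_⟩
  · rw [hd]
    have : |Real.sin ((t - t') / 2)| ≤ |(t - t') / 2| := Real.abs_sin_le_abs
    rw [abs_div, abs_of_pos (zero_lt_two' ℝ)] at this
    exact mul_le_mul_of_nonneg_left (by linarith) hR.le
  -- A chord is `2 R |sin x|` for an arc `2 R |x|`. As `sin` has slope `1` at `0`, the relative
  -- error is at most `1 - 1 / C` for small `x`, which is `|x| ≤ C |sin x|`.
  · have h := (Real.hasDerivAt_sin 0).isLittleO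
    have hc : 0 < 1 - 1 / C := by
      rw [sub_pos, div_lt_one (by linarith)]; exact hC
    obtain ⟨δ, hδ, hδ'⟩ := Metric.eventually_nhds_iff.1 (h.def hc)
    refine ⟨δ, hδ, fun t t' htt => ?_⟩
    have hlt : dist ((t - t') / 2) 0 < δ := by
      rw [Real.dist_eq, sub_zero, abs_div, abs_of_pos (zero_lt_two' ℝ)]; linarith
    have := hδ' hlt
    simp only [Real.sin_zero, sub_zero, Real.cos_zero, smul_eq_mul, mul_one, Real.norm_eq_abs]
      at this
    rw [hd]
    set x := (t - t') / 2 with hx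
    have hxt : |t - t'| = 2 * |x| := by
      rw [hx, abs_div, abs_of_pos (zero_lt_two' ℝ)]; ring
    have h3 : |x| - |Real.sin x| ≤ (1 - 1 / C) * |x| :=
      (abs_sub_abs_le_abs_sub _ _).trans ((abs_sub_comm _ _).le.trans this)
    have h4 : |x| ≤ C * |Real.sin x| := by
      have : |x| / C ≤ |Real.sin x| := by
        have : (1 - 1 / C) * |x| = |x| - |x| / C := by ring
        linarith
      rwa [div_le_iff₀ (by linarith), mul_comm] at this
    rw [hxt]
    nlinarith

theorem injOn_circleCurve (c : Plane) {R : ℝ} (hR : 0 < R) :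
    InjOn (circleCurve c R) (Ioc (-Real.pi) Real.pi) := fun _ ht _ ht' h =>
  injOn_dirVec ht ht' (smul_right_injective _ hR.ne' (add_left_cancel h))

theorem circleCurve_image (c : Plane) {R : ℝ} (hR : 0 < R) :
    circleCurve c R '' Ioc (-Real.pi) Real.pi = Metric.sphere c R := by
  ext x
  rw [mem_sphere_iff_norm]
  constructor
  · rintro ⟨t, -, rfl⟩
    rw [circleCurve, add_sub_cancel_left, norm_smul, norm_dirVec, Real.norm_of_nonneg hR.le,
      mul_one]
  · intro hx
    obtain ⟨t, ht, h⟩ := exists_eq_dirVec (v := R⁻¹ • (x - c)) (by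
      rw [norm_smul, hx, Real.norm_of_nonneg (by positivity), inv_mul_cancel₀ hR.ne'])
    refine ⟨t, ht, ?_⟩
    rw [circleCurve, h, smul_smul, mul_inv_cancel₀ hR.ne', one_smul]; abel

/-- The line through `m` with direction `e`. -/
def lineCurve (m e : Plane) (t : ℝ) : Plane := m + t • e

theorem dist_lineCurve (m : Plane) {e : Plane} (he : ‖e‖ = 1) (t t' : ℝ) :
    dist (lineCurve m e t) (lineCurve m e t') = |t - t'| := by
  rw [lineCurve, lineCurve, dist_add_left, dist_eq_norm, ← sub_smul, norm_smul, he, mul_one,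
    Real.norm_eq_abs]

theorem hasConstantSpeed_lineCurve (m : Plane) {e : Plane} (he : ‖e‖ = 1) :
    HasConstantSpeed (lineCurve m e) 1 := by
  refine ⟨fun _ _ => ?_, fun C hC => ⟨1, one_pos, fun _ _ _ => ?_⟩⟩
  · rw [dist_lineCurve m he, one_mul]
  · rw [dist_lineCurve m he]
    exact mul_le_mul_of_nonneg_right hC.le (abs_nonneg _)

theorem injective_lineCurve (m : Plane) {e : Plane} (he : ‖e‖ = 1) :
    Function.Injective (lineCurve m e) := fun t t' h => by
  have := dist_lineCurve m he t t'
  rw [h, dist_self] at this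
  exact sub_eq_zero.1 (abs_eq_zero.1 this.symm)

end

/-! ### Integrals over regions bounded by a moving graph -/

noncomputable section

/-- The difference of indicators carries the orientation, so no case distinction is needed later on
whether the interface has moved inwards or outwards. -/
theorem intervalIntegral_eq_integral_indicator_sub (f : ℝ → ℝ) (a b : ℝ) :
    ∫ r in a..b, f r =
      ∫ r, ((Iic b).indicator 1 r - (Iic a).indicator (1 : ℝ → ℝ) r) * f r := by
  have key : ∀ a b : ℝ, a ≤ b → ∫ r in a..b, f r =
      ∫ r, ((Iic b).indicator 1 r - (Iic a).indicator (1 : ℝ → ℝ) r) * f r := by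
    intro a b hab
    rw [intervalIntegral.integral_of_le hab, ← integral_indicator measurableSet_Ioc]
    congr 1; ext r
    by_cases h1 : r ≤ a
    · simp [indicator, h1, h1.trans hab, not_lt.2 h1]
    · by_cases h2 : r ≤ b <;> simp [indicator, h1, h2, not_le.1 h1]
  rcases le_total a b with h | h
  · exact key a b h
  · rw [intervalIntegral.integral_symm, key b a h, ← integral_neg]
    congr 1; ext r; ring

/-- Write `f = (f - b) + b`. The constant part gives `b * (ρ P - ρ P₀)`, and the rest is `o(ρ P - ρ
P₀)`, hence `o(P - P₀)`. Only the limit of `f` at the one point `(P₀, ρ P₀)` matters, so `f` may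
jump elsewhere. -/
theorem hasFDerivAt_integral_moving_endpoint {E : Type*} [NormedAddCommGroup E]
    [NormedSpace ℝ E] {f : E → ℝ → ℝ} {ρ : E → ℝ} {P₀ : E} {ℓ : E →L[ℝ] ℝ} {b : ℝ}
    (hρ : HasFDerivAt ρ ℓ P₀)
    (hf : Tendsto (fun z : E × ℝ => f z.1 z.2) (𝓝 (P₀, ρ P₀)) (𝓝 b))
    (hint : ∀ᶠ P in 𝓝 P₀, IntervalIntegrable (f P) volume (ρ P₀) (ρ P)) :
    HasFDerivAt (fun P => ∫ r in ρ P₀..ρ P, f P r) (b • ℓ) P₀ := by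
  rw [hasFDerivAt_iff_isLittleO]
  have h1 : (fun P => ∫ r in ρ P₀..ρ P, (f P r - b)) =o[𝓝 P₀] fun P => P - P₀ := by
    refine Asymptotics.IsLittleO.trans_isBigO (g := fun P => ρ P - ρ P₀) ?_ hρ.isBigO_sub
    refine Asymptotics.isLittleO_iff.2 fun ε hε => ?_
    have hev := hf (Metric.closedBall_mem_nhds b hε)
    obtain ⟨δ, hδ, hball⟩ := Metric.eventually_nhds_iff.1 (mem_map.1 hev)
    filter_upwards [Metric.ball_mem_nhds P₀ hδ,
      hρ.continuousAt (Metric.ball_mem_nhds (ρ P₀) hδ)] with P hP hρP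
    refine intervalIntegral.norm_integral_le_of_norm_le_const fun r hr => ?_
    have hd : dist (P, r) (P₀, ρ P₀) < δ := by
      rw [Prod.dist_eq]
      refine max_lt hP ?_
      have h2 : |r - ρ P₀| ≤ |ρ P - ρ P₀| := abs_sub_left_of_mem_uIcc (uIoc_subset_uIcc hr)
      have h3 : |ρ P - ρ P₀| < δ := hρP
      exact h2.trans_lt h3
    have := hball hd
    rwa [mem_closedBall_iff_norm] at this
  have h2 : (fun P => b * (ρ P - ρ P₀ - ℓ (P - P₀))) =o[𝓝 P₀] fun P => P - P₀ :=
    (hρ.isLittleO).const_mul_left b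
  refine (h1.add h2).congr' ?_ EventuallyEq.rfl
  filter_upwards [hint] with P hP
  rw [intervalIntegral.integral_sub hP intervalIntegrable_const,
    intervalIntegral.integral_const, intervalIntegral.integral_same]
  simp only [smul_eq_mul, smul_apply]
  ring

/-- The derivative of an integral over a moving region, in coordinates `(t, r)` in which the
boundary of the region is the graph of a function `ρ` of `t`, constant for the parameter `P₀`. -/
theorem hasFDerivAt_integral_moving_graph {E : Type*} [NormedAddCommGroup E] [NormedSpace ℝ E]
    {P₀ : E} {I : Set ℝ} (hI : MeasurableSet I) (hIfin : volume I ≠ ⊤)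
    {Ψ : ℝ → ℝ → Plane} (hΨ : Continuous (Function.uncurry Ψ)) {J : ℝ → ℝ} (hJ : Continuous J)
    {C : ℝ} {a B : E → Plane → ℝ} (ham : ∀ P, Measurable (a P))
    (hBm : ∀ᶠ P in 𝓝 P₀, Measurable (B P)) (hBC : ∀ᶠ P in 𝓝 P₀, ∀ q, |B P q| ≤ C)
    (hchart : ∀ᶠ P in 𝓝 P₀, ∫ q, (a P q - a P₀ q) * B P q =
      ∫ t in I, ∫ r, J r * ((a P (Ψ t r) - a P₀ (Ψ t r)) * B P (Ψ t r)))
    {σ R : ℝ} {ρ : E → ℝ → ℝ} {ℓ : ℝ → E →L[ℝ] ℝ} (hρ₀ : ∀ t, ρ P₀ t = R)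
    (ha : ∀ᶠ P in 𝓝 P₀, ∀ t ∈ I, ∀ᵐ r, J r ≠ 0 → a P (Ψ t r) - a P₀ (Ψ t r) =
      σ * ((Iic (ρ P t)).indicator 1 r - (Iic R).indicator (1 : ℝ → ℝ) r))
    {L : ℝ} (hL : ∀ᶠ P in 𝓝 P₀, ∀ t ∈ I, |ρ P t - R| ≤ L * ‖P - P₀‖)
    (hρ : ∀ t ∈ I, HasFDerivAt (fun P => ρ P t) (ℓ t) P₀) (hℓ : Continuous ℓ)
    (hlim : ∀ᵐ t ∂(volume.restrict I),
      Tendsto (fun z : E × Plane => B z.1 z.2) (𝓝 (P₀, Ψ t R)) (𝓝 (B P₀ (Ψ t R)))) :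
    HasFDerivAt (fun P => ∫ q, (a P q - a P₀ q) * B P q)
      (∫ t in I, (σ * (J R * B P₀ (Ψ t R))) • ℓ t) P₀ := by
  obtain ⟨CJ, hCJ⟩ := (isCompact_Icc (a := R - 1) (b := R + 1)).exists_bound_of_continuousOn
    hJ.continuousOn
  have hCJ0 : 0 ≤ CJ := (norm_nonneg _).trans (hCJ R ⟨by linarith, by linarith⟩)
  have hC0 : 0 ≤ C := (abs_nonneg _).trans (hBC.self_of_nhds 0)
  have hsmall : ∀ᶠ P in 𝓝 P₀, L * ‖P - P₀‖ ≤ 1 := by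
    have : Tendsto (fun P => L * ‖P - P₀‖) (𝓝 P₀) (𝓝 (L * ‖P₀ - P₀‖)) :=
      Continuous.tendsto (by fun_prop) P₀
    rw [sub_self, norm_zero, mul_zero] at this
    exact this.eventually_le_const one_pos
  have hΨt : ∀ t, Continuous (Ψ t) := fun t => hΨ.comp (by fun_prop : Continuous fun r => (t, r))
  set F : E → ℝ → ℝ := fun P t =>
    ∫ r, J r * ((a P (Ψ t r) - a P₀ (Ψ t r)) * B P (Ψ t r)) with hF
  have hFeq : ∀ᶠ P in 𝓝 P₀, ∀ t ∈ I,
      F P t = σ * ∫ r in R..ρ P t, J r * B P (Ψ t r) := by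
    filter_upwards [ha] with P hP t ht
    rw [intervalIntegral_eq_integral_indicator_sub, ← integral_const_mul]
    refine integral_congr_ae ?_
    filter_upwards [hP t ht] with r hr
    by_cases h0 : J r = 0
    · simp [h0]
    · rw [hr h0]; ring
  have hInt : ∀ᶠ P in 𝓝 P₀, ∀ t ∈ I,
      IntervalIntegrable (fun r => J r * B P (Ψ t r)) volume R (ρ P t) := by
    filter_upwards [hBm, hBC] with P hm hb t _
    have h := hJ.intervalIntegrable (μ := volume) R (ρ P t)
    have hm' := hm.comp (hΨt t).measurable
    exact ⟨h.1.mul_bdd (c := C) hm'.aestronglyMeasurable (ae_of_all _ fun r => hb _),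
      h.2.mul_bdd (c := C) hm'.aestronglyMeasurable (ae_of_all _ fun r => hb _)⟩
  -- Differentiation under the integral over `t` of the fibre integrals `F P t`. These vanish at
  -- `P₀` and range over an interval of length at most `L * ‖P - P₀‖ ≤ 1`, where the Jacobian is at
  -- most `CJ` and the weight at most `C`: hence the constant Lipschitz bound.
  have hmain := hasFDerivAt_integral_of_dominated_loc_of_lip' (𝕜 := ℝ)
    (μ := volume.restrict I) (F := F) (x₀ := P₀)
    (F' := fun t => (σ * (J R * B P₀ (Ψ t R))) • ℓ t)
    (bound := fun _ => |σ| * (CJ * C) * L)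
    (s := {P | Measurable (B P) ∧ (∀ q, |B P q| ≤ C) ∧ L * ‖P - P₀‖ ≤ 1 ∧
      (∀ t ∈ I, |ρ P t - R| ≤ L * ‖P - P₀‖) ∧
      ∀ t ∈ I, F P t = σ * ∫ r in R..ρ P t, J r * B P (Ψ t r)})
    (by filter_upwards [hBm, hBC, hsmall, hL, hFeq] with P h1 h2 h3 h4 h5
        exact ⟨h1, h2, h3, h4, h5⟩)
    ?_ ?_ ?_ ?_ ?_ ?_
  · exact hmain.2.congr_of_eventuallyEq hchart
  · rintro P ⟨hm, -⟩
    have hsm : StronglyMeasurable (fun z : ℝ × ℝ => J z.2 *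
        ((a P (Ψ z.1 z.2) - a P₀ (Ψ z.1 z.2)) * B P (Ψ z.1 z.2))) := by
      have hΨm : Measurable (fun z : ℝ × ℝ => Ψ z.1 z.2) := hΨ.measurable
      exact ((hJ.measurable.comp measurable_snd).mul
        ((((ham P).comp hΨm).sub ((ham P₀).comp hΨm)).mul (hm.comp hΨm))).stronglyMeasurable
    exact hsm.integral_prod_right'.aestronglyMeasurable
  · have : F P₀ = fun _ => 0 := by
      ext t; simp [hF]
    rw [this]; exact integrable_zero _ _ _
  · have hm := hBm.self_of_nhds
    have hc : Continuous fun t => Ψ t R := hΨ.comp (by fun_prop : Continuous fun t => (t, R))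
    exact ((((hm.comp hc.measurable).const_mul (J R)).const_mul σ).aestronglyMeasurable).smul
      hℓ.aestronglyMeasurable
  · refine (ae_restrict_iff' hI).2 (ae_of_all _ fun t ht P hP => ?_)
    obtain ⟨-, hb, h1, h2, h3⟩ := hP
    have h0 : F P₀ t = 0 := by simp [hF]
    rw [h0, sub_zero, h3 t ht, norm_mul, Real.norm_eq_abs]
    have : ‖∫ r in R..ρ P t, J r * B P (Ψ t r)‖ ≤ CJ * C * |ρ P t - R| := by
      refine intervalIntegral.norm_integral_le_of_norm_le_const fun r hr => ?_
      have h4 : |r - R| ≤ |ρ P t - R| := abs_sub_left_of_mem_uIcc (uIoc_subset_uIcc hr)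
      have h5 := abs_le.1 ((h4.trans (h2 t ht)).trans h1)
      rw [norm_mul]
      exact mul_le_mul (hCJ r ⟨by linarith, by linarith⟩) (hb _) (norm_nonneg _) hCJ0
    calc |σ| * ‖∫ r in R..ρ P t, J r * B P (Ψ t r)‖
        ≤ |σ| * (CJ * C * (L * ‖P - P₀‖)) := by
          refine mul_le_mul_of_nonneg_left (this.trans ?_) (abs_nonneg _)
          exact mul_le_mul_of_nonneg_left (h2 t ht) (by positivity)
      _ = _ := by ring
  · exact integrable_const_iff.2 (Or.inr ⟨by
      rw [Measure.restrict_apply_univ]; exact lt_of_le_of_ne le_top hIfin⟩)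
  · filter_upwards [hlim, ae_restrict_mem hI] with t hlim ht
    have hρt := hρ t ht
    have hc : Tendsto (fun z : E × ℝ => J z.2 * B z.1 (Ψ t z.2)) (𝓝 (P₀, ρ P₀ t))
        (𝓝 (J R * B P₀ (Ψ t R))) := by
      rw [hρ₀ t]
      refine Tendsto.mul ((hJ.comp continuous_snd).tendsto (P₀, R)) ?_
      exact hlim.comp (Continuous.tendsto (f := fun z : E × ℝ => (z.1, Ψ t z.2))
        (continuous_fst.prodMk ((hΨt t).comp continuous_snd)) (P₀, R))
    have hd := hasFDerivAt_integral_moving_endpoint (f := fun P r => J r * B P (Ψ t r)) hρt hc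
      (by filter_upwards [hInt] with P hP; rw [hρ₀ t]; exact hP t ht)
    have := (hd.const_mul σ).congr_of_eventuallyEq (f₁ := fun P => F P t) (by
      filter_upwards [hFeq] with P hP
      rw [hP t ht, hρ₀ t])
    rwa [smul_smul] at this

/-- The points of the plane from their coordinates. -/
theorem measurePreserving_toPlane :
    MeasurePreserving (fun z : ℝ × ℝ => (!₂[z.1, z.2] : Plane)) volume volume := by
  have h1 := (EuclideanSpace.volume_preserving_symm_measurableEquiv_toLp (Fin 2)).symm
  have h2 := (volume_preserving_finTwoArrow ℝ).symm
  exact h1.comp h2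

theorem measurableEmbedding_toPlane :
    MeasurableEmbedding (fun z : ℝ × ℝ => (!₂[z.1, z.2] : Plane)) :=
  (MeasurableEquiv.toLp 2 (Fin 2 → ℝ)).measurableEmbedding.comp
    MeasurableEquiv.finTwoArrow.symm.measurableEmbedding

/-- The Jacobian is written `max r 0` with `r` over the whole line: it is continuous and removes the
negative radii, so that polar and Cartesian coordinates fit the same chart lemma. -/
theorem integral_eq_integral_polar (c : Plane) {f : Plane → ℝ} (hfm : Measurable f)
    (hf : Integrable f) : ∫ q, f q =
      ∫ t in Ioc (-Real.pi) Real.pi, ∫ r, max r 0 * f (c + r • dirVec t) := by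
  set g : ℝ × ℝ → ℝ := fun z => f (c + !₂[z.1, z.2]) with hg
  have hgm : Measurable g :=
    hfm.comp (measurable_const.add measurePreserving_toPlane.measurable)
  have hgi : Integrable g :=
    (measurePreserving_toPlane.integrable_comp_emb measurableEmbedding_toPlane).2
      (hf.comp_add_left c)
  have h1 : ∫ q, f q = ∫ z, g z := by
    rw [← integral_add_left_eq_self f c]
    exact (measurePreserving_toPlane.integral_comp measurableEmbedding_toPlane
      (fun q => f (c + q))).symm
  have hps : ∀ z : ℝ × ℝ, g (polarCoord.symm z) = f (c + z.1 • dirVec z.2) := by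
    intro z
    simp only [hg, polarCoord_symm_apply]
    congr 2
    ext k; fin_cases k <;> simp [dirVec]
  have hpm : Measurable (fun z => g (polarCoord.symm z)) :=
    hgm.comp continuous_polarCoord_symm.measurable
  have hpi : IntegrableOn (fun z : ℝ × ℝ => z.1 * g (polarCoord.symm z)) polarCoord.target := by
    refine ⟨(measurable_fst.mul hpm).aestronglyMeasurable, ?_⟩
    have := lintegral_comp_polarCoord_symm (fun z => ‖g z‖ₑ)
    rw [HasFiniteIntegral]
    calc ∫⁻ z in polarCoord.target, ‖z.1 * g (polarCoord.symm z)‖ₑ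
        = ∫⁻ z in polarCoord.target, ENNReal.ofReal z.1 • ‖g (polarCoord.symm z)‖ₑ := by
          refine setLIntegral_congr_fun polarCoord.open_target.measurableSet fun z hz => ?_
          have hz1 : 0 < z.1 := hz.1
          rw [enorm_mul, Real.enorm_of_nonneg hz1.le, smul_eq_mul]
      _ = ∫⁻ z, ‖g z‖ₑ := this
      _ < ⊤ := hgi.2
  have h2 := integral_comp_polarCoord_symm g
  rw [h1, ← h2]
  have hprod : (volume : Measure (ℝ × ℝ)).restrict polarCoord.target =
      (volume.restrict (Ioi 0)).prod (volume.restrict (Ioo (-Real.pi) Real.pi)) := by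
    rw [polarCoord_target, Measure.volume_eq_prod, Measure.prod_restrict]
  simp only [smul_eq_mul]
  rw [IntegrableOn, hprod] at hpi
  rw [hprod, integral_prod_symm _ hpi, integral_Ioc_eq_integral_Ioo]
  refine setIntegral_congr_fun measurableSet_Ioo fun t _ => ?_
  simp only
  rw [← integral_indicator measurableSet_Ioi]
  congr 1; ext r
  rw [indicator]
  split_ifs with hr
  · rw [hps, max_eq_left (le_of_lt hr)]
  · rw [max_eq_right (not_lt.1 hr), zero_mul]

/-- As `f` vanishes off a ball of radius `T`, the coordinate `t` along the line may be confined to a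
bounded interval, as the chart lemma requires. -/
theorem integral_eq_integral_cartesian (m : Plane) {e w : Plane} (he : ‖e‖ = 1) (hw : ‖w‖ = 1)
    (hew : inner ℝ e w = (0 : ℝ)) {f : Plane → ℝ} (hf : Integrable f)
    {T : ℝ} (hT : ∀ q, f q ≠ 0 → ‖q - m‖ < T) : ∫ q, f q =
      ∫ t in Ioc (-T) T, ∫ r : ℝ, f (m + t • e + r • w) := by
  have hon : Orthonormal ℝ ![e, w] := by
    rw [orthonormal_vecCons_iff]
    refine ⟨he, fun i => by fin_cases i; exact hew, ?_⟩
    rw [orthonormal_vecCons_iff]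
    exact ⟨hw, fun i => i.elim0, ⟨fun i => i.elim0, fun i => i.elim0⟩⟩
  let b := OrthonormalBasis.mk hon (by
    rw [hon.linearIndependent.span_eq_top_of_card_eq_finrank (by simp)])
  have hb : ∀ z : ℝ × ℝ, b.repr.symm !₂[z.1, z.2] = z.1 • e + z.2 • w := by
    intro z
    rw [← OrthonormalBasis.sum_repr_symm]
    simp [b, Fin.sum_univ_two]
  have hmp : MeasurePreserving (fun z : ℝ × ℝ => z.1 • e + z.2 • w) volume volume := by
    have := (b.measurePreserving_repr_symm).comp measurePreserving_toPlane
    exact (funext hb : _ = _) ▸ this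
  have hme : MeasurableEmbedding (fun z : ℝ × ℝ => z.1 • e + z.2 • w) := by
    have := (b.repr.symm.toHomeomorph.measurableEmbedding).comp measurableEmbedding_toPlane
    exact (funext hb : _ = _) ▸ this
  have hi : Integrable (fun z : ℝ × ℝ => f (m + (z.1 • e + z.2 • w))) :=
    (hmp.integrable_comp_emb hme).2 (hf.comp_add_left m)
  rw [← integral_add_left_eq_self f m, ← hmp.integral_comp hme (fun q => f (m + q)),
    Measure.volume_eq_prod, integral_prod _ (by rwa [← Measure.volume_eq_prod]),
    ← integral_indicator measurableSet_Ioc]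
  congr 1; ext t
  rw [indicator]
  split_ifs with ht
  · simp only [add_assoc]
  · rw [← integral_zero ℝ ℝ]
    congr 1; ext r
    by_contra hne
    have h1 := hT _ hne
    rw [add_sub_cancel_left] at h1
    have h2 : ‖t • e + r • w‖ ^ 2 = t ^ 2 + r ^ 2 := by
      rw [norm_add_sq_real, norm_smul, norm_smul, he, hw, real_inner_smul_left,
        real_inner_smul_right, hew]
      simp
    have h3 : |t| < T := by
      refine lt_of_le_of_lt ?_ h1
      exact abs_le_of_sq_le_sq (by rw [h2]; nlinarith [sq_nonneg r]) (norm_nonneg _)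
    exact ht ⟨(abs_lt.1 h3).1, (abs_lt.1 h3).2.le⟩

end

/-! ### Cost differences and the shape of the interfaces -/

noncomputable section

/-- The excess at `q` of the cost of sensor `j` over the cost of sensor `i`. -/
def costDiff {n : ℕ} (η : Fin n → ℝ) (i j : Fin n) (P : Fin n → Plane) (q : Plane) : ℝ :=
  η j * ‖q - P j‖ ^ 2 - η i * ‖q - P i‖ ^ 2

/-- The gradient of `costDiff` with respect to the point. -/
def costGrad {n : ℕ} (η : Fin n → ℝ) (i j : Fin n) (P : Fin n → Plane) (q : Plane) : Plane :=
  (2 * η j) • (q - P j) - (2 * η i) • (q - P i)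

/-- The derivative of `costDiff` with respect to the deployment. -/
def costDeriv {n : ℕ} (η : Fin n → ℝ) (i j : Fin n) (P : Fin n → Plane) (q : Plane) :
    (Fin n → Plane) →L[ℝ] ℝ :=
  (2 * η i) • (innerSL ℝ (q - P i)).comp (ContinuousLinearMap.proj i) -
    (2 * η j) • (innerSL ℝ (q - P j)).comp (ContinuousLinearMap.proj j)

/-- The norm of the gradient of `costDiff` on its zero set. -/
def costSlope {n : ℕ} (η : Fin n → ℝ) (i j : Fin n) (P : Fin n → Plane) : ℝ :=
  2 * (√(η i * η j) * ‖P i - P j‖)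

/-- The indicator of the region where sensor `i` is at least as good as sensor `j`. -/
def costInd {n : ℕ} (η : Fin n → ℝ) (i j : Fin n) (P : Fin n → Plane) (q : Plane) : ℝ :=
  {q | 0 ≤ costDiff η i j P q}.indicator 1 q

variable {n : ℕ} {η : Fin n → ℝ} {i j : Fin n}

theorem continuous_costDiff :
    Continuous fun z : (Fin n → Plane) × Plane => costDiff η i j z.1 z.2 := by
  unfold costDiff; fun_prop

theorem continuous_costDiff_right (P : Fin n → Plane) : Continuous (costDiff η i j P) := by
  unfold costDiff; fun_prop

theorem continuous_costDeriv :
    Continuous fun z : (Fin n → Plane) × Plane => costDeriv η i j z.1 z.2 := by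
  have h : ∀ k : Fin n, Continuous fun z : (Fin n → Plane) × Plane =>
      (innerSL ℝ (z.2 - z.1 k)).comp
        (ContinuousLinearMap.proj k : (Fin n → Plane) →L[ℝ] Plane) := fun k =>
    ((innerSL ℝ).continuous.comp (by fun_prop :
      Continuous fun z : (Fin n → Plane) × Plane => z.2 - z.1 k)).clm_comp continuous_const
  exact ((h i).const_smul (2 * η i)).sub ((h j).const_smul (2 * η j))

theorem continuous_costSlope : Continuous (costSlope η i j) := by
  unfold costSlope; fun_prop

theorem measurable_costInd (P : Fin n → Plane) : Measurable (costInd η i j P) :=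
  measurable_one.indicator (measurableSet_le measurable_const
    (continuous_costDiff_right P).measurable)

theorem costInd_of_nonneg {P : Fin n → Plane} {q : Plane} (h : 0 ≤ costDiff η i j P q) :
    costInd η i j P q = 1 := indicator_of_mem (s := {q | 0 ≤ costDiff η i j P q}) h _

theorem costInd_of_neg {P : Fin n → Plane} {q : Plane} (h : costDiff η i j P q < 0) :
    costInd η i j P q = 0 :=
  indicator_of_notMem (s := {q | 0 ≤ costDiff η i j P q}) (not_le.2 h) _

theorem costInd_mem_Icc (P : Fin n → Plane) (q : Plane) : costInd η i j P q ∈ Icc (0 : ℝ) 1 := by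
  rcases lt_or_ge (costDiff η i j P q) 0 with h | h
  · rw [costInd_of_neg h]; simp
  · rw [costInd_of_nonneg h]; simp

theorem eventually_costInd_eq {P₀ : Fin n → Plane} {x : Plane} (h : costDiff η i j P₀ x ≠ 0) :
    ∀ᶠ z : (Fin n → Plane) × Plane in 𝓝 (P₀, x), costInd η i j z.1 z.2 = costInd η i j P₀ x := by
  have hc := (continuous_costDiff (η := η) (i := i) (j := j)).tendsto (P₀, x)
  rcases lt_or_gt_of_ne h with h | h
  · filter_upwards [hc.eventually_lt_const h] with z hz
    rw [costInd_of_neg hz, costInd_of_neg h]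
  · filter_upwards [hc.eventually_const_lt h] with z hz
    rw [costInd_of_nonneg hz.le, costInd_of_nonneg h.le]

theorem hasStrictFDerivAt_costDiff (P : Fin n → Plane) (q : Plane) :
    HasStrictFDerivAt (fun z : (Fin n → Plane) × Plane => costDiff η i j z.1 z.2)
      ((costDeriv η i j P q).comp (ContinuousLinearMap.fst ℝ _ _) +
        (innerSL ℝ (costGrad η i j P q)).comp (ContinuousLinearMap.snd ℝ _ _)) (P, q) := by
  have h : ∀ k : Fin n, HasStrictFDerivAt
      (fun z : (Fin n → Plane) × Plane => ‖z.2 - z.1 k‖ ^ 2)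
      (2 • (innerSL ℝ (q - P k)).comp (ContinuousLinearMap.snd ℝ (Fin n → Plane) Plane -
        (ContinuousLinearMap.proj k).comp (ContinuousLinearMap.fst ℝ _ _))) (P, q) := by
    intro k
    have h1 : HasStrictFDerivAt (fun z : (Fin n → Plane) × Plane => z.2 - z.1 k)
        (ContinuousLinearMap.snd ℝ (Fin n → Plane) Plane -
        (ContinuousLinearMap.proj k).comp (ContinuousLinearMap.fst ℝ _ _)) (P, q) :=
      (ContinuousLinearMap.snd ℝ (Fin n → Plane) Plane -
        (ContinuousLinearMap.proj k).comp
          (ContinuousLinearMap.fst ℝ (Fin n → Plane) Plane)).hasStrictFDerivAt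
    have h2 := (hasStrictFDerivAt_norm_sq (q - P k))
    exact h2.comp (P, q) h1
  refine (((h j).const_mul (η j)).sub ((h i).const_mul (η i))).congr_fderiv ?_
  ext v
  · simp [costDeriv, costGrad]; ring
  · simp [costDeriv, costGrad]; ring

theorem hasFDerivAt_costDiff_left (P : Fin n → Plane) (q : Plane) :
    HasFDerivAt (fun P => costDiff η i j P q) (costDeriv η i j P q) P := by
  have h := (hasStrictFDerivAt_costDiff (η := η) (i := i) (j := j) P q).hasFDerivAt.comp P
    (hasFDerivAt_prodMk_left (𝕜 := ℝ) P q)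
  refine h.congr_fderiv ?_
  ext v; simp

theorem hasFDerivAt_costDiff_right (P : Fin n → Plane) (q : Plane) :
    HasFDerivAt (costDiff η i j P) (innerSL ℝ (costGrad η i j P q)) q := by
  have h := (hasStrictFDerivAt_costDiff (η := η) (i := i) (j := j) P q).hasFDerivAt.comp q
    (hasFDerivAt_prodMk_right (𝕜 := ℝ) P q)
  refine h.congr_fderiv ?_
  ext v; simp

theorem costSlope_pos (hη : ∀ k, 0 < η k) {P : Fin n → Plane} (hP : P i ≠ P j) :
    0 < costSlope η i j P := by
  have h1 := hη i
  have h2 := hη j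
  have h3 : 0 < ‖P i - P j‖ := norm_pos_iff.2 (sub_ne_zero.2 hP)
  unfold costSlope; positivity

/-- With `u = q - P j` and `v = q - P i`, `‖2 η_j u - 2 η_i v‖² = 4 η_i η_j ‖u - v‖² + 4 (η_j - η_i)
(η_j ‖u‖² - η_i ‖v‖²)`, and the last bracket is the cost difference. -/
theorem norm_costGrad (hη : ∀ k, 0 < η k) {P : Fin n → Plane} {q : Plane}
    (hq : costDiff η i j P q = 0) : ‖costGrad η i j P q‖ = costSlope η i j P := by
  have h1 := hη i
  have h2 := hη j
  have hij : P i - P j = (q - P j) - (q - P i) := by abel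
  have h : ‖costGrad η i j P q‖ ^ 2 = costSlope η i j P ^ 2 := by
    rw [costSlope, mul_pow, mul_pow, Real.sq_sqrt (by positivity), hij, costGrad,
      norm_sub_sq_real, norm_sub_sq_real, norm_smul, norm_smul, real_inner_smul_left,
      real_inner_smul_right, Real.norm_of_nonneg (by positivity),
      Real.norm_of_nonneg (by positivity)]
    unfold costDiff at hq
    linear_combination (4 * η j - 4 * η i) * hq
  exact (sq_eq_sq₀ (norm_nonneg _) (by unfold costSlope; positivity)).1 h

theorem isClosed_costDiff_eq_zero (P : Fin n → Plane) :
    IsClosed {q | costDiff η i j P q = 0} :=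
  isClosed_eq (continuous_costDiff_right P) continuous_const

theorem integrable_of_bounded {f : Plane → ℝ} (hm : Measurable f) {C M : ℝ}
    (hC : ∀ q, |f q| ≤ C) (hM : ∀ q, f q ≠ 0 → ‖q‖ ≤ M) : Integrable f := by
  have : IntegrableOn f (Metric.closedBall 0 M) :=
    Measure.integrableOn_of_bounded (M := C) (measure_closedBall_lt_top.ne)
      hm.aestronglyMeasurable (ae_of_all _ hC)
  refine (integrableOn_iff_integrable_of_support_subset fun q hq => ?_).1 this
  rw [mem_closedBall_zero_iff]; exact hM q hq

section Parametrised

variable {κ : ℝ → Plane} {s : ℝ} {I : Set ℝ} {Z : Set Plane}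

theorem HasConstantSpeed.ae_comp (h : HasConstantSpeed κ s) (hs : 0 < s) (hI : MeasurableSet I)
    (hinj : InjOn κ I) (hZ : κ '' I ⊆ Z) {p : Plane → Prop}
    (hp : ∀ᵐ x ∂(μH[1].restrict Z), p x) : ∀ᵐ t ∂(volume.restrict I), p (κ t) := by
  have h1 : ∀ᵐ x ∂(μH[1].restrict (κ '' I)), p x := ae_restrict_of_ae_restrict_of_subset hZ hp
  rw [h.restrict_image_eq_map hs hI hinj] at h1
  have h2 := ae_of_ae_map (h.continuous hs).measurable.aemeasurable h1
  rwa [ae_iff, Measure.smul_apply, smul_eq_mul, mul_eq_zero, or_iff_right, ← ae_iff] at h2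
  simpa using hs

/-- The curve need only cover the part of `Z` in the ball where `G` lives; this lets a segment stand
for an unbounded line. -/
theorem HasConstantSpeed.setIntegral_eq {V : Type*} [NormedAddCommGroup V] [NormedSpace ℝ V]
    (h : HasConstantSpeed κ s) (hs : 0 < s) (hI : MeasurableSet I)
    (hinj : InjOn κ I) (hZ : κ '' I ⊆ Z) (hZm : MeasurableSet Z) {M : ℝ}
    (hM : Z ∩ Metric.closedBall 0 M ⊆ κ '' I)
    {G : Plane → V} (hG : StronglyMeasurable G) (hGM : ∀ x, G x ≠ 0 → ‖x‖ ≤ M) :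
    ∫ x in Z, G x ∂μH[1] = s • ∫ t in I, G (κ t) := by
  have hm := hI.image_of_continuousOn_injOn (h.continuous hs).continuousOn hinj
  have h1 : ∫ x in Z, G x ∂μH[1] = ∫ x in κ '' I, G x ∂μH[1] := by
    rw [← integral_indicator hZm, ← integral_indicator hm]
    congr 1; ext x
    by_cases hx : x ∈ κ '' I
    · rw [indicator_of_mem hx, indicator_of_mem (hZ hx)]
    · rw [indicator_of_notMem hx]
      by_cases hxZ : x ∈ Z
      · rw [indicator_of_mem hxZ]
        by_contra hne
        exact hx (hM ⟨hxZ, mem_closedBall_zero_iff.2 (hGM x hne)⟩)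
      · rw [indicator_of_notMem hxZ]
  rw [h1, h.restrict_image_eq_map hs hI hinj, integral_map (h.continuous hs).aemeasurable
    hG.aestronglyMeasurable, integral_smul_measure, ENNReal.toReal_ofReal hs.le]

end Parametrised

section Circle

variable (η i j)

/-- The centre of the circle on which the sensors `i` and `j` have the same cost. -/
def interfaceCenter : (Fin n → Plane) →L[ℝ] Plane :=
  (η j - η i)⁻¹ • (η j • ContinuousLinearMap.proj j - η i • ContinuousLinearMap.proj i)

/-- The radius of the circle on which the sensors `i` and `j` have the same cost. -/
def interfaceRadius (P : Fin n → Plane) : ℝ := √(η i * η j) * ‖P i - P j‖ / |η j - η i|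

variable {η i j}

theorem continuous_interfaceRadius : Continuous (interfaceRadius η i j) := by
  unfold interfaceRadius; fun_prop

theorem interfaceRadius_pos (hη : ∀ k, 0 < η k) (hne : η i ≠ η j) {P : Fin n → Plane}
    (hP : P i ≠ P j) : 0 < interfaceRadius η i j P := by
  have h1 := hη i
  have h2 := hη j
  have h3 : 0 < ‖P i - P j‖ := norm_pos_iff.2 (sub_ne_zero.2 hP)
  have h4 : 0 < |η j - η i| := abs_pos.2 (sub_ne_zero.2 hne.symm)
  unfold interfaceRadius; positivity

theorem costSlope_eq_radius (hne : η i ≠ η j) (P : Fin n → Plane) :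
    costSlope η i j P = 2 * (|η j - η i| * interfaceRadius η i j P) := by
  have h4 : |η j - η i| ≠ 0 := (abs_pos.2 (sub_ne_zero.2 hne.symm)).ne'
  unfold interfaceRadius costSlope
  field_simp

/-- Completing the square: the zero set is the circle of Apollonius of the two sensors. -/
theorem costDiff_eq_circle (hη : ∀ k, 0 < η k) (hne : η i ≠ η j) (P : Fin n → Plane)
    (q : Plane) : costDiff η i j P q = (η j - η i) *
      (‖q - interfaceCenter η i j P‖ ^ 2 - interfaceRadius η i j P ^ 2) := by
  have h0 : η j - η i ≠ 0 := sub_ne_zero.2 hne.symm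
  have h1 := hη i
  have h2 := hη j
  have hc : q - interfaceCenter η i j P =
      (η j - η i)⁻¹ • (η j • (q - P j) - η i • (q - P i)) := by
    rw [eq_inv_smul_iff₀ h0, smul_sub]
    simp only [interfaceCenter, smul_apply, sub_apply, ContinuousLinearMap.proj_apply,
      smul_smul, mul_inv_cancel₀ h0, one_smul]
    module
  have hij : P i - P j = (q - P j) - (q - P i) := by abel
  rw [hc, interfaceRadius, div_pow, mul_pow, Real.sq_sqrt (by positivity), sq_abs, hij,
    norm_smul, mul_pow, norm_sub_sq_real, norm_sub_sq_real, norm_smul, norm_smul,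
    real_inner_smul_left, real_inner_smul_right, Real.norm_of_nonneg h1.le,
    Real.norm_of_nonneg h2.le, norm_inv, inv_pow, Real.norm_eq_abs, sq_abs, costDiff]
  field_simp
  ring

theorem costDiff_eq_zero_iff_sphere (hη : ∀ k, 0 < η k) (hne : η i ≠ η j) {P : Fin n → Plane}
    (hP : P i ≠ P j) :
    {q | costDiff η i j P q = 0} =
      Metric.sphere (interfaceCenter η i j P) (interfaceRadius η i j P) := by
  ext q
  have h0 : η j - η i ≠ 0 := sub_ne_zero.2 hne.symm
  rw [mem_ofPred_eq, costDiff_eq_circle hη hne, mul_eq_zero, or_iff_right h0, sub_eq_zero,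
    sq_eq_sq₀ (norm_nonneg _) (interfaceRadius_pos hη hne hP).le, mem_sphere_iff_norm]

end Circle

section Line

/-- The vector turned by a right angle. -/
def quarterTurn (v : Plane) : Plane := !₂[-v 1, v 0]

theorem continuous_quarterTurn : Continuous quarterTurn := by
  unfold quarterTurn
  refine (PiLp.continuous_toLp 2 _).comp (continuous_pi fun k => ?_)
  fin_cases k
  · exact (PiLp.continuous_apply 2 _ 1).neg
  · exact PiLp.continuous_apply 2 _ 0

theorem norm_quarterTurn (v : Plane) : ‖quarterTurn v‖ = ‖v‖ := by
  simp [quarterTurn, EuclideanSpace.norm_eq, Fin.sum_univ_two, add_comm]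

theorem inner_quarterTurn (v : Plane) : inner ℝ (quarterTurn v) v = (0 : ℝ) := by
  simp [quarterTurn, PiLp.inner_apply, Fin.sum_univ_two]; ring

theorem exists_eq_add_of_norm_eq_one {w : Plane} (hw : ‖w‖ = 1) (v : Plane) :
    v = inner ℝ (quarterTurn w) v • quarterTurn w + inner ℝ w v • w := by
  have h : w 0 ^ 2 + w 1 ^ 2 = 1 := by
    have := EuclideanSpace.norm_sq_eq w
    rw [hw] at this
    simp [Fin.sum_univ_two] at this
    linarith
  ext k
  fin_cases k
  · simp [quarterTurn, PiLp.inner_apply, Fin.sum_univ_two]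
    linear_combination (-v 0) * h
  · simp [quarterTurn, PiLp.inner_apply, Fin.sum_univ_two]
    linear_combination (-v 1) * h

/-- With equal cost parameters the quadratic terms cancel, which leaves a multiple of the signed
distance to the perpendicular bisector. -/
theorem costDiff_eq_line (he : η i = η j) (P : Fin n → Plane) (q : Plane) :
    costDiff η i j P q = 2 * η i * inner ℝ (q - (2⁻¹ : ℝ) • (P i + P j)) (P i - P j) := by
  have h1 : q - (2⁻¹ : ℝ) • (P i + P j) = (2⁻¹ : ℝ) • ((q - P j) + (q - P i)) := by module
  have h2 : P i - P j = (q - P j) - (q - P i) := by abel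
  rw [costDiff, h1, h2, ← he, real_inner_smul_left]
  generalize q - P j = u
  generalize q - P i = v
  rw [inner_add_left, inner_sub_right, inner_sub_right, real_inner_self_eq_norm_sq,
    real_inner_self_eq_norm_sq, real_inner_comm u v]
  ring

end Line
end

/-! ### The derivative when a single interface moves -/

noncomputable section

variable {n : ℕ} {η : Fin n → ℝ} {i j : Fin n}

/-- Where `f` vanishes, the product rule needs only continuity of `g`. It is applied to a cost
difference divided by its slope factor `k`, which is known only to be continuous in the deployment.
-/
theorem hasFDerivAt_mul_of_eq_zero {E : Type*} [NormedAddCommGroup E] [NormedSpace ℝ E]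
    {f g : E → ℝ} {f' : E →L[ℝ] ℝ} {x : E} (hf : HasFDerivAt f f' x) (h0 : f x = 0)
    (hg : ContinuousAt g x) : HasFDerivAt (fun y => f y * g y) (g x • f') x := by
  have h1 : HasFDerivAt (fun y => f y * g x) (g x • f') x := hf.mul_const (g x)
  have h2 : HasFDerivAt (fun y => f y * (g y - g x)) (0 : E →L[ℝ] ℝ) x := by
    rw [hasFDerivAt_iff_isLittleO]
    have hO : f =O[𝓝 x] fun y => y - x := by
      simpa [h0] using hf.isBigO_sub
    have ho : (fun y => g y - g x) =o[𝓝 x] fun _ => (1 : ℝ) := by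
      rw [Asymptotics.isLittleO_one_iff, ← sub_self (g x)]
      exact hg.sub tendsto_const_nhds
    have := hO.norm_right.mul_isLittleO ho
    simpa [h0] using this
  have h3 := h1.add h2
  rw [add_zero] at h3
  refine h3.congr_of_eventuallyEq (Eventually.of_forall fun y => ?_)
  simp only [Pi.add_apply]; ring

/-- The sign `ε` records the side: for `ε = 1` the indicator is that of `r ≥ ρ`, for `ε = -1` that
of `r ≤ ρ`. The point `r = ρ` is excluded because the two cases treat it differently; it is null on
each fibre. -/
theorem costInd_eq_of_sign {P : Fin n → Plane} {q : Plane} {ε k r ρ : ℝ} (hε : ε = 1 ∨ ε = -1)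
    (hk : 0 < k) (h : costDiff η i j P q = ε * (k * (r - ρ))) (hr : r ≠ ρ) :
    costInd η i j P q = (1 + ε) / 2 - ε * (Iic ρ).indicator (1 : ℝ → ℝ) r := by
  rcases lt_or_gt_of_ne hr with hr | hr
  · have hneg : k * (r - ρ) < 0 := mul_neg_of_pos_of_neg hk (by linarith)
    rw [indicator_of_mem (by exact hr.le)]
    rcases hε with rfl | rfl
    · rw [costInd_of_neg (by rw [h]; linarith)]; simp
    · rw [costInd_of_nonneg (by rw [h]; linarith)]; simp
  · have hpos : 0 < k * (r - ρ) := mul_pos hk (by linarith)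
    rw [indicator_of_notMem (by exact not_le.2 hr)]
    rcases hε with rfl | rfl
    · rw [costInd_of_nonneg (by rw [h]; linarith)]; simp
    · rw [costInd_of_neg (by rw [h]; linarith)]; simp

theorem abs_costDiff_sub_le (hη : ∀ k, 0 < η k) {P P₀ : Fin n → Plane} {q : Plane} {D : ℝ}
    (hD : ∀ k, ‖q - P k‖ ≤ D) (hD₀ : ∀ k, ‖q - P₀ k‖ ≤ D) :
    |costDiff η i j P q - costDiff η i j P₀ q| ≤ 2 * D * (η i + η j) * ‖P - P₀‖ := by
  have h : ∀ k, |‖q - P k‖ ^ 2 - ‖q - P₀ k‖ ^ 2| ≤ 2 * D * ‖P - P₀‖ := by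
    intro k
    have h1 : |‖q - P k‖ - ‖q - P₀ k‖| ≤ ‖P - P₀‖ := by
      refine (abs_norm_sub_norm_le _ _).trans ?_
      rw [sub_sub_sub_cancel_left, norm_sub_rev, ← Pi.sub_apply]
      exact norm_le_pi_norm (P - P₀) k
    rw [sq_sub_sq, abs_mul, abs_of_nonneg (by positivity)]
    exact mul_le_mul (by linarith [hD k, hD₀ k]) h1 (abs_nonneg _)
      (by linarith [norm_nonneg (q - P k), hD k])
  have e : costDiff η i j P q - costDiff η i j P₀ q =
      η j * (‖q - P j‖ ^ 2 - ‖q - P₀ j‖ ^ 2) - η i * (‖q - P i‖ ^ 2 - ‖q - P₀ i‖ ^ 2) := by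
    unfold costDiff; ring
  rw [e]
  refine (abs_sub _ _).trans ?_
  rw [abs_mul, abs_mul, abs_of_pos (hη i), abs_of_pos (hη j)]
  have := mul_le_mul_of_nonneg_left (h i) (hη i).le
  have := mul_le_mul_of_nonneg_left (h j) (hη j).le
  linarith

/-- The derivative of an integral over the moving region where sensor `i` is at least as good as
sensor `j`, given coordinates in which the boundary of the region is a graph. -/
theorem hasFDerivAt_integral_costInd_of_chart (hη : ∀ k, 0 < η k) {P₀ : Fin n → Plane}
    (hP₀ : P₀ i ≠ P₀ j) {I : Set ℝ} (hI : MeasurableSet I) (hIb : Bornology.IsBounded I)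
    {Ψ : ℝ → ℝ → Plane} (hΨ : Continuous (Function.uncurry Ψ)) {J : ℝ → ℝ} (hJ : Continuous J)
    {R s : ℝ} (hs : 0 < s) (hJR : J R = s) (hκ : HasConstantSpeed (fun t => Ψ t R) s)
    (hinj : InjOn (fun t => Ψ t R) I) {C M : ℝ}
    (hZ : (fun t => Ψ t R) '' I ⊆ {q | costDiff η i j P₀ q = 0})
    (hM : {q | costDiff η i j P₀ q = 0} ∩ Metric.closedBall 0 M ⊆ (fun t => Ψ t R) '' I)
    {B : (Fin n → Plane) → Plane → ℝ}
    (hBm : ∀ᶠ P in 𝓝 P₀, Measurable (B P)) (hBC : ∀ᶠ P in 𝓝 P₀, ∀ q, |B P q| ≤ C)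
    (hBM : ∀ᶠ P in 𝓝 P₀, ∀ q, B P q ≠ 0 → ‖q‖ ≤ M)
    (hchart : ∀ᶠ P in 𝓝 P₀, ∫ q, (costInd η i j P q - costInd η i j P₀ q) * B P q =
      ∫ t in I, ∫ r,
        J r * ((costInd η i j P (Ψ t r) - costInd η i j P₀ (Ψ t r)) * B P (Ψ t r)))
    {ε : ℝ} (hε : ε = 1 ∨ ε = -1) {ρ : (Fin n → Plane) → ℝ → ℝ} (hρ₀ : ∀ t, ρ P₀ t = R)
    {k : (Fin n → Plane) → ℝ → ℝ → ℝ}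
    (hk : ∀ᶠ P in 𝓝 P₀, ∀ t ∈ I, ∀ r, J r ≠ 0 →
      0 < k P t r ∧ costDiff η i j P (Ψ t r) = ε * (k P t r * (r - ρ P t)))
    (hk' : ∀ᶠ P in 𝓝 P₀, ∀ t ∈ I, costSlope η i j P₀ / 2 ≤ k P t R)
    (hkc : ∀ t ∈ I, ContinuousAt (fun P => k P t R) P₀)
    (hk₀ : ∀ t ∈ I, k P₀ t R = costSlope η i j P₀)
    (hlim : ∀ᵐ x ∂(μH[1].restrict {q | costDiff η i j P₀ q = 0}),
      Tendsto (fun z : (Fin n → Plane) × Plane => B z.1 z.2) (𝓝 (P₀, x)) (𝓝 (B P₀ x))) :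
    HasFDerivAt (fun P => ∫ q, (costInd η i j P q - costInd η i j P₀ q) * B P q)
      ((costSlope η i j P₀)⁻¹ • ∫ x in {q | costDiff η i j P₀ q = 0},
        B P₀ x • costDeriv η i j P₀ x ∂μH[1]) P₀ := by
  have hslope := costSlope_pos hη hP₀
  have hε2 : ε * ε = 1 := by rcases hε with rfl | rfl <;> norm_num
  have hcont : Continuous fun t => Ψ t R := hκ.continuous hs
  have hzero : ∀ t ∈ I, costDiff η i j P₀ (Ψ t R) = 0 := fun t ht => hZ ⟨t, ht, rfl⟩
  have hJR0 : J R ≠ 0 := by rw [hJR]; exact hs.ne'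
  obtain ⟨D, hD⟩ := (hIb.isCompact_closure).exists_bound_of_continuousOn hcont.continuousOn
  -- At `r = R` the chart gives `|costDiff| = k * |ρ - R|` with `k` at least half the slope, while
  -- `costDiff` vanishes at `P₀` and is Lipschitz in `P`. The quantity `D + ‖P₀‖ + 1` bounds the
  -- distances from the interface points to the sensors for `P` within `1` of `P₀`.
  have hL : ∀ᶠ P in 𝓝 P₀, ∀ t ∈ I, |ρ P t - R| ≤
      (2 * (D + ‖P₀‖ + 1) * (η i + η j) * (2 / costSlope η i j P₀)) * ‖P - P₀‖ := by
    filter_upwards [hk, hk', Metric.ball_mem_nhds P₀ one_pos] with P h1 h2 h3 t ht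
    obtain ⟨hpos, heq⟩ := h1 t ht R hJR0
    have h4 : |costDiff η i j P (Ψ t R)| = k P t R * |ρ P t - R| := by
      have : |ε| = 1 := by rcases hε with rfl | rfl <;> norm_num
      rw [heq, abs_mul, abs_mul, this, one_mul, abs_of_pos hpos, abs_sub_comm]
    have hn : ∀ Q : Fin n → Plane, dist Q P₀ < 1 → ∀ l, ‖Ψ t R - Q l‖ ≤ D + ‖P₀‖ + 1 := by
      intro Q hQ l
      have a1 := norm_sub_le (Ψ t R) (Q l)
      have a2 := hD t (subset_closure ht)
      have a3 := norm_le_pi_norm Q l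
      have a4 : ‖Q‖ ≤ ‖P₀‖ + ‖Q - P₀‖ := norm_le_insert' Q P₀
      rw [dist_eq_norm] at hQ
      linarith
    have h5 := abs_costDiff_sub_le (i := i) (j := j) hη (hn P h3)
      (hn P₀ (by rw [dist_self]; exact one_pos))
    rw [hzero t ht, sub_zero, h4] at h5
    have h6 : costSlope η i j P₀ / 2 * |ρ P t - R| ≤ k P t R * |ρ P t - R| :=
      mul_le_mul_of_nonneg_right (h2 t ht) (abs_nonneg _)
    have h7 := h6.trans h5
    rw [div_mul_eq_mul_div, div_le_iff₀ two_pos] at h7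
    rw [mul_div_assoc', div_mul_eq_mul_div, le_div_iff₀ hslope]
    linarith
  -- Since `ε² = 1`, the chart equation at `r = R` reads `ρ P t = R - ε k⁻¹ costDiff`, and the cost
  -- difference is zero at `P₀`.
  have hρ : ∀ t ∈ I, HasFDerivAt (fun P => ρ P t)
      ((-ε * (costSlope η i j P₀)⁻¹) • costDeriv η i j P₀ (Ψ t R)) P₀ := by
    intro t ht
    have h1 := hasFDerivAt_mul_of_eq_zero
      (hasFDerivAt_costDiff_left (η := η) (i := i) (j := j) P₀ (Ψ t R)) (hzero t ht)
      (((hkc t ht).inv₀ (by rw [hk₀ t ht]; exact hslope.ne')).const_mul (-ε))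
    have h2 := h1.const_add R
    simp only [Pi.inv_apply, hk₀ t ht] at h2
    refine h2.congr_of_eventuallyEq ?_
    filter_upwards [hk] with P hP
    obtain ⟨hpos, heq⟩ := hP t ht R hJR0
    rw [heq]
    field_simp
    linear_combination (R - ρ P t) * hε2
  have hℓ : Continuous fun t =>
      (-ε * (costSlope η i j P₀)⁻¹) • costDeriv η i j P₀ (Ψ t R) :=
    (continuous_costDeriv.comp ((continuous_const (y := P₀)).prodMk hcont)).const_smul
      (-ε * (costSlope η i j P₀)⁻¹)
  have ha : ∀ᶠ P in 𝓝 P₀, ∀ t ∈ I, ∀ᵐ r, J r ≠ 0 →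
      costInd η i j P (Ψ t r) - costInd η i j P₀ (Ψ t r) =
      (-ε) * ((Iic (ρ P t)).indicator 1 r - (Iic R).indicator (1 : ℝ → ℝ) r) := by
    filter_upwards [hk] with P hP t ht
    have hne : ∀ x : ℝ, ∀ᵐ r, r ≠ x := fun x => by
      simp [ae_iff]
    filter_upwards [hne (ρ P t), hne R] with r hr hr' hJr
    obtain ⟨h1, h2⟩ := hP t ht r hJr
    obtain ⟨h3, h4⟩ := hk.self_of_nhds t ht r hJr
    rw [hρ₀ t] at h4
    rw [costInd_eq_of_sign hε h1 h2 hr, costInd_eq_of_sign hε h3 h4 hr']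
    ring
  have hmain := hasFDerivAt_integral_moving_graph hI hIb.measure_lt_top.ne hΨ hJ
    measurable_costInd hBm hBC hchart hρ₀ ha hL hρ hℓ (hκ.ae_comp hs hI hinj hZ hlim)
  refine hmain.congr_fderiv ?_
  have hG : StronglyMeasurable fun x => B P₀ x • costDeriv η i j P₀ x :=
    hBm.self_of_nhds.stronglyMeasurable.smul
      (continuous_costDeriv.comp ((continuous_const (y := P₀)).prodMk
        continuous_id)).stronglyMeasurable
  have hGM : ∀ x, B P₀ x • costDeriv η i j P₀ x ≠ 0 → ‖x‖ ≤ M := fun x hx =>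
    hBM.self_of_nhds x fun h => hx (by rw [h, zero_smul])
  rw [hκ.setIntegral_eq hs hI hinj hZ (isClosed_costDiff_eq_zero P₀).measurableSet hM hG hGM,
    smul_smul, ← integral_smul]
  congr 1; ext1 t
  rw [smul_smul, smul_smul, hJR]
  congr 1
  linear_combination (s * B P₀ (Ψ t R) * (costSlope η i j P₀)⁻¹) * hε2

theorem integrable_costInd_sub_mul {P P₀ : Fin n → Plane} {B : Plane → ℝ} (hm : Measurable B)
    {C M : ℝ} (hC : ∀ q, |B q| ≤ C) (hM : ∀ q, B q ≠ 0 → ‖q‖ ≤ M) :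
    Measurable (fun q => (costInd η i j P q - costInd η i j P₀ q) * B q) ∧
      Integrable (fun q => (costInd η i j P q - costInd η i j P₀ q) * B q) := by
  have h1 := ((measurable_costInd (η := η) (i := i) (j := j) P).sub
    (measurable_costInd (η := η) (i := i) (j := j) P₀)).mul hm
  refine ⟨h1, integrable_of_bounded h1 (C := C) (M := M) (fun q => ?_) fun q hq => ?_⟩
  · have ha := costInd_mem_Icc (η := η) (i := i) (j := j) P q
    have hb := costInd_mem_Icc (η := η) (i := i) (j := j) P₀ q
    change |(costInd η i j P q - costInd η i j P₀ q) * B q| ≤ C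
    rw [abs_mul, ← one_mul C]
    exact mul_le_mul (abs_le.2 ⟨by linarith [ha.1, hb.2], by linarith [ha.2, hb.1]⟩) (hC q)
      (abs_nonneg _) zero_le_one
  · exact hM q fun h => hq (by simp [h])

/-- The derivative, with respect to the deployment, of an integral over the moving region where
sensor `i` is at least as good as sensor `j`. -/
theorem hasFDerivAt_integral_costInd (hη : ∀ k, 0 < η k) {P₀ : Fin n → Plane}
    (hP₀ : P₀ i ≠ P₀ j) {C M : ℝ} {B : (Fin n → Plane) → Plane → ℝ}
    (hBm : ∀ᶠ P in 𝓝 P₀, Measurable (B P)) (hBC : ∀ᶠ P in 𝓝 P₀, ∀ q, |B P q| ≤ C)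
    (hBM : ∀ᶠ P in 𝓝 P₀, ∀ q, B P q ≠ 0 → ‖q‖ ≤ M)
    (hlim : ∀ᵐ x ∂(μH[1].restrict {q | costDiff η i j P₀ q = 0}),
      Tendsto (fun z : (Fin n → Plane) × Plane => B z.1 z.2) (𝓝 (P₀, x)) (𝓝 (B P₀ x))) :
    HasFDerivAt (fun P => ∫ q, (costInd η i j P q - costInd η i j P₀ q) * B P q)
      ((costSlope η i j P₀)⁻¹ • ∫ x in {q | costDiff η i j P₀ q = 0},
        B P₀ x • costDeriv η i j P₀ x ∂μH[1]) P₀ := by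
  by_cases hne : η i = η j
  · set m : (Fin n → Plane) → Plane := fun P => (2⁻¹ : ℝ) • (P i + P j) with hm
    set w₀ : Plane := P₀ i - P₀ j with hw₀
    have hw₀0 : ‖w₀‖ ≠ 0 := norm_ne_zero_iff.2 (sub_ne_zero.2 hP₀)
    set w : Plane := ‖w₀‖⁻¹ • w₀ with hw
    have hw1 : ‖w‖ = 1 := by rw [hw, norm_smul, norm_inv, norm_norm, inv_mul_cancel₀ hw₀0]
    set e : Plane := quarterTurn w with he
    have he1 : ‖e‖ = 1 := by rw [he, norm_quarterTurn, hw1]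
    have hew : inner ℝ e w = (0 : ℝ) := inner_quarterTurn w
    have hew₀ : inner ℝ e w₀ = (0 : ℝ) := by
      have : w₀ = ‖w₀‖ • w := by rw [hw, smul_smul, mul_inv_cancel₀ hw₀0, one_smul]
      rw [this, real_inner_smul_right, hew, mul_zero]
    have hww₀ : inner ℝ w w₀ = ‖w₀‖ := by
      rw [hw, real_inner_smul_left, real_inner_self_eq_norm_sq]; field_simp
    have hslope : costSlope η i j P₀ = 2 * η i * ‖w₀‖ := by
      rw [costSlope, ← hne, Real.sqrt_mul_self (hη i).le, mul_assoc]
    -- Large enough for the ball of radius `M` about `0`, which contains the support of the weight,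
    -- to satisfy `‖q - m P₀‖ < T`.
    set T : ℝ := M + ‖m P₀‖ + 1 with hT
    have hηi := hη i
    have hwc : Continuous fun P : Fin n → Plane => (inner ℝ w (P i - P j) : ℝ) := by fun_prop
    have hwpos : ∀ᶠ P in 𝓝 P₀, ‖w₀‖ / 2 < inner ℝ w (P i - P j) := by
      refine (hwc.tendsto P₀).eventually_const_lt ?_
      rw [← hw₀, hww₀]
      have : 0 < ‖w₀‖ := (norm_nonneg _).lt_of_ne' hw₀0
      linarith
    have hw₀pos : 0 < ‖w₀‖ := (norm_nonneg _).lt_of_ne' hw₀0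
    have hin : ∀ t r : ℝ, inner ℝ (m P₀ + t • e + r • w - m P₀) w₀ = r * ‖w₀‖ := by
      intro t r
      rw [add_assoc, add_sub_cancel_left, inner_add_left, real_inner_smul_left,
        real_inner_smul_left, hew₀, hww₀]
      ring
    have hline : (fun t : ℝ => m P₀ + t • e + (0 : ℝ) • w) = lineCurve (m P₀) e := by
      ext1 t; rw [zero_smul, add_zero]; rfl
    -- Cartesian axes along and across the old bisector. The cost difference is affine in `r`, with
    -- slope `k`, and `ρ` is its root.
    refine hasFDerivAt_integral_costInd_of_chart hη hP₀ (I := Ioc (-T) T) measurableSet_Ioc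
      (Metric.isBounded_Ioc _ _) (Ψ := fun t r => m P₀ + t • e + r • w) ?_
      (J := fun _ => 1) continuous_const (R := 0) one_pos rfl ?_ ?_ (M := M) ?_ ?_ hBm hBC hBM ?_
      (ε := 1) (Or.inl rfl)
      (ρ := fun P t => (inner ℝ (m P - m P₀) (P i - P j) - t * inner ℝ e (P i - P j)) /
        inner ℝ w (P i - P j)) ?_ (k := fun P _ _ => 2 * η i * inner ℝ w (P i - P j))
      ?_ ?_ ?_ ?_ hlim
    · simp only [Function.uncurry_def]; fun_prop
    · rw [hline]; exact hasConstantSpeed_lineCurve (m P₀) he1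
    · rw [hline]; exact (injective_lineCurve (m P₀) he1).injOn
    · rintro _ ⟨t, -, rfl⟩
      rw [mem_ofPred_eq, costDiff_eq_line hne]
      change 2 * η i * inner ℝ (m P₀ + t • e + (0 : ℝ) • w - m P₀) w₀ = 0
      rw [hin, zero_mul, mul_zero]
    · rintro q ⟨hq, hqM⟩
      rw [mem_ofPred_eq, costDiff_eq_line hne] at hq
      rw [mem_closedBall_zero_iff] at hqM
      have h1 : inner ℝ (q - m P₀) w₀ = (0 : ℝ) := by
        rcases mul_eq_zero.1 hq with h | h
        · linarith
        · exact h
      have h2 : inner ℝ w (q - m P₀) = (0 : ℝ) := by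
        rw [real_inner_comm, hw, real_inner_smul_right, h1, mul_zero]
      have h3 := exists_eq_add_of_norm_eq_one hw1 (q - m P₀)
      rw [h2, zero_smul, add_zero] at h3
      refine ⟨inner ℝ e (q - m P₀), ?_, ?_⟩
      · have h4 : |inner ℝ e (q - m P₀)| ≤ ‖q - m P₀‖ := by
          refine (abs_real_inner_le_norm _ _).trans ?_
          rw [he1, one_mul]
        have h5 : ‖q - m P₀‖ < T := by
          refine (norm_sub_le _ _).trans_lt ?_
          rw [hT]; linarith
        have h6 := abs_lt.1 (h4.trans_lt h5)
        exact ⟨h6.1, h6.2.le⟩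
      · simp only [zero_smul, add_zero]
        rw [he, ← h3]; abel
    · filter_upwards [hBm, hBC, hBM] with P h1 h2 h3
      obtain ⟨-, hi⟩ := integrable_costInd_sub_mul (η := η) (i := i) (j := j) (P := P)
        (P₀ := P₀) h1 h2 h3
      rw [integral_eq_integral_cartesian (m P₀) he1 hw1 hew hi (T := T) fun q hq => ?_]
      · simp only [one_mul]
      · have h4 := h3 q (right_ne_zero_of_mul hq)
        refine (norm_sub_le _ _).trans_lt ?_
        rw [hT]; linarith
    · intro t
      simp only [sub_self, inner_zero_left, ← hw₀, hew₀, mul_zero, zero_div]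
    · filter_upwards [hwpos] with P hP t _ r _
      have hpos : 0 < inner ℝ w (P i - P j) := by linarith
      refine ⟨by positivity, ?_⟩
      rw [costDiff_eq_line hne]
      change 2 * η i * inner ℝ (m P₀ + t • e + r • w - m P) (P i - P j) = _
      have : m P₀ + t • e + r • w - m P = t • e + r • w - (m P - m P₀) := by abel
      rw [this, inner_sub_left, inner_add_left, real_inner_smul_left, real_inner_smul_left]
      field_simp
      ring
    · filter_upwards [hwpos] with P hP t _
      rw [hslope]
      nlinarith
    · exact fun t _ => (continuous_const.mul hwc).continuousAt
    · intro t _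
      simp only [← hw₀, hww₀, hslope]
  · set c := interfaceCenter η i j with hc
    set Rd := interfaceRadius η i j with hRd
    have hR₀ : 0 < Rd P₀ := interfaceRadius_pos hη hne hP₀
    have hα : η j - η i ≠ 0 := sub_ne_zero.2 (Ne.symm hne)
    have hα' : 0 < |η j - η i| := abs_pos.2 hα
    -- Polar coordinates about the old centre: the new circle meets the line in direction `t` at the
    -- roots `inner ± √X` of a quadratic in `r`. The larger root is `ρ`, and `k` is `|η j - η i|`
    -- times `r` minus the smaller root. As the old centre is inside the new circle, the smaller
    -- root is negative, so `k > 0` for `r > 0`.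
    set X : (Fin n → Plane) → ℝ → ℝ := fun P t =>
      Rd P ^ 2 - ‖c P - c P₀‖ ^ 2 + inner ℝ (dirVec t) (c P - c P₀) ^ 2 with hX
    have hX₀ : ∀ t, X P₀ t = Rd P₀ ^ 2 := fun t => by simp [hX]
    have hclose : ∀ᶠ P in 𝓝 P₀, ‖c P - c P₀‖ < Rd P := by
      have h1 : Continuous fun P => ‖c P - c P₀‖ := by fun_prop
      refine (h1.tendsto P₀).eventually_lt (continuous_interfaceRadius.tendsto P₀) ?_
      rw [sub_self, norm_zero]; exact hR₀
    have hsq : ∀ᶠ P in 𝓝 P₀, ∀ t, 0 ≤ X P t ∧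
        |inner ℝ (dirVec t) (c P - c P₀)| < √(X P t) := by
      filter_upwards [hclose] with P hP t
      have h1 : ‖c P - c P₀‖ ^ 2 < Rd P ^ 2 := by
        have := norm_nonneg (c P - c P₀)
        nlinarith
      have h2 : inner ℝ (dirVec t) (c P - c P₀) ^ 2 < X P t := by
        simp only [hX]; linarith
      refine ⟨(sq_nonneg _).trans h2.le, Real.lt_sqrt_of_sq_lt ?_⟩
      rwa [sq_abs]
    have habs : SignType.sign (η j - η i) * |η j - η i| = η j - η i := sign_mul_abs _
    have hslope := costSlope_eq_radius hne P₀
    refine hasFDerivAt_integral_costInd_of_chart hη hP₀ (I := Ioc (-Real.pi) Real.pi)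
      measurableSet_Ioc (Metric.isBounded_Ioc _ _) (Ψ := fun t r => c P₀ + r • dirVec t) ?_
      (J := fun r => max r 0) (by fun_prop) (R := Rd P₀) hR₀ (max_eq_left hR₀.le)
      (hasConstantSpeed_circleCurve (c P₀) hR₀) (injOn_circleCurve (c P₀) hR₀) (M := M)
      ?_ ?_ hBm hBC hBM ?_ (ε := SignType.sign (η j - η i)) ?_
      (ρ := fun P t => inner ℝ (dirVec t) (c P - c P₀) + √(X P t)) ?_
      (k := fun P t r => |η j - η i| * (r - inner ℝ (dirVec t) (c P - c P₀) + √(X P t)))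
      ?_ ?_ ?_ ?_ hlim
    · have := continuous_dirVec
      simp only [Function.uncurry_def]; fun_prop
    · rw [costDiff_eq_zero_iff_sphere hη hne hP₀, ← circleCurve_image _ hR₀]
      exact subset_rfl
    · rw [costDiff_eq_zero_iff_sphere hη hne hP₀, ← circleCurve_image _ hR₀]
      exact inter_subset_left
    · filter_upwards [hBm, hBC, hBM] with P h1 h2 h3
      obtain ⟨hm, hi⟩ := integrable_costInd_sub_mul (η := η) (i := i) (j := j) (P := P)
        (P₀ := P₀) h1 h2 h3
      rw [integral_eq_integral_polar (c P₀) hm hi]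
    · rcases lt_or_gt_of_ne hα with h | h
      · right; simp [sign_neg h]
      · left; simp [sign_pos h]
    · intro t
      simp only [hX₀, sub_self, inner_zero_right, zero_add]
      exact Real.sqrt_sq hR₀.le
    · filter_upwards [hsq] with P hP t _ r hr
      have hr0 : 0 < r := by
        by_contra h
        exact hr (max_eq_right (not_lt.1 h))
      obtain ⟨h1, h2⟩ := hP t
      have h3 := abs_lt.1 h2
      refine ⟨mul_pos hα' (by linarith), ?_⟩
      have h4 : c P₀ + r • dirVec t - c P = r • dirVec t - (c P - c P₀) := by abel
      rw [costDiff_eq_circle hη hne, ← hc, ← hRd, h4, norm_sub_sq_real, norm_smul, norm_dirVec,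
        real_inner_smul_left, Real.norm_eq_abs, mul_one, sq_abs]
      have h5 := Real.sq_sqrt h1
      simp only [hX] at h5 ⊢
      linear_combination (SignType.sign (η j - η i) * |η j - η i|) * h5 -
        (r ^ 2 - 2 * (r * inner ℝ (dirVec t) (c P - c P₀)) + ‖c P - c P₀‖ ^ 2 - Rd P ^ 2) * habs
    · filter_upwards [hsq] with P hP t _
      have h3 := abs_lt.1 (hP t).2
      rw [hslope, mul_div_cancel_left₀ _ two_ne_zero]
      exact mul_le_mul_of_nonneg_left (by linarith) hα'.le
    · intro t _
      have h1 : Continuous fun P => √(X P t) := by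
        have := continuous_interfaceRadius (η := η) (i := i) (j := j)
        simp only [hX]; fun_prop
      exact Continuous.continuousAt (by fun_prop)
    · intro t _
      simp only [hX₀, sub_self, inner_zero_right, sub_zero, Real.sqrt_sq hR₀.le, hslope]
      ring

end

/-! ### Continuity of interface integrals; size of the interfaces and of their intersections -/

noncomputable section

variable {n : ℕ} {η : Fin n → ℝ} {i j : Fin n}

/-- The interfaces between two sensors are parametrised with constant speed, continuously in the
deployment, and on a fixed interval as far as a given ball is concerned. -/
theorem exists_interface_parametrization (hη : ∀ k, 0 < η k) {P₀ : Fin n → Plane}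
    (hP₀ : P₀ i ≠ P₀ j) (M : ℝ) :
    ∃ (T : ℝ) (κ : (Fin n → Plane) → ℝ → Plane) (s : (Fin n → Plane) → ℝ),
      ContinuousAt s P₀ ∧ (∀ t, ContinuousAt (fun P => κ P t) P₀) ∧
      ∀ᶠ P in 𝓝 P₀, 0 < s P ∧ HasConstantSpeed (κ P) (s P) ∧ InjOn (κ P) (Ioc (-T) T) ∧
        κ P '' Ioc (-T) T ⊆ {q | costDiff η i j P q = 0} ∧
        {q | costDiff η i j P q = 0} ∩ Metric.closedBall 0 M ⊆ κ P '' Ioc (-T) T := by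
  have hev : ∀ᶠ P : Fin n → Plane in 𝓝 P₀, P i ≠ P j :=
    (isOpen_ne_fun (continuous_apply i) (continuous_apply j)).mem_nhds hP₀
  by_cases hne : η i = η j
  · set m : (Fin n → Plane) → Plane := fun P => (2⁻¹ : ℝ) • (P i + P j) with hm
    have hmc : Continuous m := by fun_prop
    set w : (Fin n → Plane) → Plane := fun P => ‖P i - P j‖⁻¹ • (P i - P j) with hw
    have hwc : ContinuousAt w P₀ := by
      have h : Continuous fun P : Fin n → Plane => P i - P j := by fun_prop
      exact (h.norm.continuousAt.inv₀ (norm_ne_zero_iff.2 (sub_ne_zero.2 hP₀))).smul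
        h.continuousAt
    have hmM : ∀ᶠ P in 𝓝 P₀, ‖m P‖ < ‖m P₀‖ + 1 :=
      (hmc.norm.tendsto P₀).eventually_lt_const (lt_add_one _)
    -- The extra `1` makes the same interval serve for all nearby deployments, whose midpoints
    -- satisfy `‖m P‖ < ‖m P₀‖ + 1`.
    set T : ℝ := M + (‖m P₀‖ + 1) with hT
    refine ⟨T, fun P => lineCurve (m P) (quarterTurn (w P)), fun _ => 1, continuousAt_const,
      fun t => ?_, ?_⟩
    · exact hmc.continuousAt.add ((continuous_quarterTurn.continuousAt.comp hwc).const_smul t)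
    filter_upwards [hev, hmM] with P hP hPM
    have hw0 : ‖P i - P j‖ ≠ 0 := norm_ne_zero_iff.2 (sub_ne_zero.2 hP)
    have hw1 : ‖w P‖ = 1 := by
      simp only [hw]; rw [norm_smul, norm_inv, norm_norm, inv_mul_cancel₀ hw0]
    have he1 : ‖quarterTurn (w P)‖ = 1 := by rw [norm_quarterTurn, hw1]
    have hww : P i - P j = ‖P i - P j‖ • w P := by
      simp only [hw]; rw [smul_smul, mul_inv_cancel₀ hw0, one_smul]
    have hZ : ∀ q, costDiff η i j P q = 0 ↔ inner ℝ (w P) (q - m P) = (0 : ℝ) := by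
      intro q
      rw [costDiff_eq_line hne, hww, real_inner_smul_right, real_inner_comm]
      have h1 := (hη i).ne'
      simp [h1, hw0, hm]
    refine ⟨one_pos, hasConstantSpeed_lineCurve _ he1, (injective_lineCurve _ he1).injOn, ?_, ?_⟩
    · rintro _ ⟨t, -, rfl⟩
      rw [mem_ofPred_eq, hZ, lineCurve, add_sub_cancel_left, real_inner_smul_right,
        real_inner_comm, inner_quarterTurn, mul_zero]
    · rintro q ⟨hq, hqM⟩
      rw [mem_closedBall_zero_iff] at hqM
      have h2 := (hZ q).1 hq
      have h3 := exists_eq_add_of_norm_eq_one hw1 (q - m P)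
      rw [h2, zero_smul, add_zero] at h3
      refine ⟨inner ℝ (quarterTurn (w P)) (q - m P), ?_, ?_⟩
      · have h4 : |inner ℝ (quarterTurn (w P)) (q - m P)| ≤ ‖q - m P‖ := by
          refine (abs_real_inner_le_norm _ _).trans ?_
          rw [he1, one_mul]
        have h5 : ‖q - m P‖ < T := by
          refine (norm_sub_le _ _).trans_lt ?_
          rw [hT]; linarith
        have h6 := abs_lt.1 (h4.trans_lt h5)
        exact ⟨h6.1, h6.2.le⟩
      · rw [lineCurve, ← h3]; abel
  · refine ⟨Real.pi, fun P => circleCurve (interfaceCenter η i j P) (interfaceRadius η i j P),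
      interfaceRadius η i j, continuous_interfaceRadius.continuousAt, fun t => ?_, ?_⟩
    · have := continuous_interfaceRadius (η := η) (i := i) (j := j)
      unfold circleCurve
      exact Continuous.continuousAt (by fun_prop)
    filter_upwards [hev] with P hP
    have hR := interfaceRadius_pos hη hne hP
    refine ⟨hR, hasConstantSpeed_circleCurve _ hR, injOn_circleCurve _ hR, ?_, ?_⟩
    · rw [costDiff_eq_zero_iff_sphere hη hne hP, circleCurve_image _ hR]
    · rw [costDiff_eq_zero_iff_sphere hη hne hP, circleCurve_image _ hR]
      exact inter_subset_left

/-- The interfaces vary, but their parametrisations live on one interval: pulled back to it, the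
claim is dominated convergence with a constant bound. -/
theorem continuousAt_integral_interface (hη : ∀ k, 0 < η k) {P₀ : Fin n → Plane}
    (hP₀ : P₀ i ≠ P₀ j) {V : Type*} [NormedAddCommGroup V] [NormedSpace ℝ V]
    {G : (Fin n → Plane) → Plane → V} {C M : ℝ}
    (hGm : ∀ᶠ P in 𝓝 P₀, StronglyMeasurable (G P)) (hGC : ∀ᶠ P in 𝓝 P₀, ∀ q, ‖G P q‖ ≤ C)
    (hGM : ∀ᶠ P in 𝓝 P₀, ∀ q, G P q ≠ 0 → ‖q‖ ≤ M)
    (hlim : ∀ᵐ x ∂(μH[1].restrict {q | costDiff η i j P₀ q = 0}),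
      Tendsto (fun z : (Fin n → Plane) × Plane => G z.1 z.2) (𝓝 (P₀, x)) (𝓝 (G P₀ x))) :
    ContinuousAt (fun P => ∫ x in {q | costDiff η i j P q = 0}, G P x ∂μH[1]) P₀ := by
  obtain ⟨T, κ, s, hs, hκ, hev⟩ := exists_interface_parametrization hη hP₀ M
  have heq : ∀ᶠ P in 𝓝 P₀, ∫ x in {q | costDiff η i j P q = 0}, G P x ∂μH[1] =
      s P • ∫ t in Ioc (-T) T, G P (κ P t) := by
    filter_upwards [hev, hGm, hGM] with P hP hm hM
    obtain ⟨h1, h2, h3, h4, h5⟩ := hP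
    exact h2.setIntegral_eq h1 measurableSet_Ioc h3 h4
      (isClosed_costDiff_eq_zero P).measurableSet h5 hm hM
  obtain ⟨h1, h2, h3, h4, h5⟩ := hev.self_of_nhds
  have hlim' := h2.ae_comp h1 measurableSet_Ioc h3 h4 hlim
  have hc : ContinuousAt (fun P => s P • ∫ t in Ioc (-T) T, G P (κ P t)) P₀ := by
    refine hs.smul ?_
    refine tendsto_integral_filter_of_dominated_convergence (fun _ => C) ?_ ?_ ?_ ?_
    · filter_upwards [hev, hGm] with P hP hm
      exact (hm.comp_measurable (hP.2.1.continuous hP.1).measurable).aestronglyMeasurable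
    · filter_upwards [hGC] with P hP
      exact ae_of_all _ fun t => hP _
    · exact integrable_const _
    · filter_upwards [hlim'] with t ht
      exact ht.comp (tendsto_id.prodMk_nhds (hκ t))
  exact hc.congr (heq.mono fun P hP => hP.symm)

theorem hausdorffMeasure_interface_inter_closedBall_lt_top (hη : ∀ k, 0 < η k)
    {P : Fin n → Plane} (hP : P i ≠ P j) (M : ℝ) :
    μH[1] ({q | costDiff η i j P q = 0} ∩ Metric.closedBall 0 M) < ⊤ := by
  obtain ⟨T, κ, s, -, -, hev⟩ := exists_interface_parametrization hη hP M
  obtain ⟨h1, h2, h3, -, h5⟩ := hev.self_of_nhds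
  refine (measure_mono h5).trans_lt ?_
  rw [h2.hausdorffMeasure_image h1 measurableSet_Ioc h3]
  exact ENNReal.mul_lt_top ENNReal.ofReal_lt_top (by simp)

theorem costGrad_ne_zero (hη : ∀ k, 0 < η k) {P : Fin n → Plane} (hP : P i ≠ P j) {q : Plane}
    (hq : costDiff η i j P q = 0) : costGrad η i j P q ≠ 0 := by
  rw [← norm_ne_zero_iff, norm_costGrad hη hq]
  exact (costSlope_pos hη hP).ne'

/-- A sphere is null. In the case of a line, the set is convex and closed with empty interior (the
gradient does not vanish on it), so it is its own frontier, and frontiers of convex sets are null.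
-/
theorem volume_interface_eq_zero (hη : ∀ k, 0 < η k) {P : Fin n → Plane} (hP : P i ≠ P j) :
    volume {q | costDiff η i j P q = 0} = 0 := by
  by_cases hne : η i = η j
  · have hconv : Convex ℝ {q | costDiff η i j P q = 0} := by
      intro x hx y hy a b _ _ hab
      have hi := (hη i).ne'
      rw [mem_ofPred_eq, costDiff_eq_line hne] at hx hy ⊢
      set m := (2⁻¹ : ℝ) • (P i + P j) with hm
      have hx' : inner ℝ (x - m) (P i - P j) = (0 : ℝ) := by simpa [hi] using hx
      have hy' : inner ℝ (y - m) (P i - P j) = (0 : ℝ) := by simpa [hi] using hy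
      have : a • x + b • y - m = a • (x - m) + b • (y - m) := by
        have hb : b = 1 - a := by linarith
        subst hb; module
      rw [this, inner_add_left, real_inner_smul_left, real_inner_smul_left, hx', hy']
      simp
    have hint : interior {q | costDiff η i j P q = 0} = ∅ := by
      refine eq_empty_iff_forall_notMem.2 fun x hx => ?_
      have h1 : costDiff η i j P =ᶠ[𝓝 x] fun _ => 0 :=
        mem_interior_iff_mem_nhds.1 hx
      have h2 := (hasFDerivAt_costDiff_right P x).unique
        ((hasFDerivAt_const (0 : ℝ) x).congr_of_eventuallyEq h1)
      have h3 : costGrad η i j P x = 0 := by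
        have h4 := congrArg (fun f : Plane →L[ℝ] ℝ => f (costGrad η i j P x)) h2
        simpa using h4
      exact costGrad_ne_zero hη hP (q := x) (interior_subset hx :) h3
    have := hconv.addHaar_frontier volume
    rwa [(isClosed_costDiff_eq_zero P).frontier_eq, hint, sdiff_empty] at this
  · rw [costDiff_eq_zero_iff_sphere hη hne hP]
    exact Measure.addHaar_sphere _ _ _

/-- The interfaces of sensor `i` with two other sensors have at most two points in common: the
inversion centred at the sensor `i` takes them to circles with different centres. -/
theorem finite_interface_inter_interface (hη : ∀ k, 0 < η k) {P : Fin n → Plane} {k : Fin n}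
    (hij : P i ≠ P j) (hik : P i ≠ P k) (hjk : P j ≠ P k) :
    ({q | costDiff η i j P q = 0} ∩ {q | costDiff η i k P q = 0}).Finite := by
  -- On the interface the distances to `P l` and `P i` have constant ratio `√(η i / η l)`. Inversion
  -- at `P i` divides the distance between `q` and `P l` by `dist q (P i) * dist (P l) (P i)`, so
  -- the image lies on a circle about the image of `P l`.
  have hdist : ∀ l, P i ≠ P l → ∀ q, costDiff η i l P q = 0 →
      dist (EuclideanGeometry.inversion (P i) 1 q) (EuclideanGeometry.inversion (P i) 1 (P l)) =
        √(η i / η l) / dist (P l) (P i) := by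
    intro l hl q hq
    have hi := hη i
    have hl' := hη l
    unfold costDiff at hq
    have hqi : q ≠ P i := by
      rintro rfl
      rw [sub_self, norm_zero] at hq
      have : ‖P i - P l‖ ^ 2 = 0 := by
        have : η l * ‖P i - P l‖ ^ 2 = 0 := by linarith
        simpa [hl'.ne'] using this
      exact hl (sub_eq_zero.1 (norm_eq_zero.1 (by simpa using this)))
    rw [EuclideanGeometry.dist_inversion_inversion hqi hl.symm]
    have h1 : dist q (P l) = √(η i / η l) * dist q (P i) := by
      rw [dist_eq_norm, dist_eq_norm, ← Real.sqrt_sq (norm_nonneg (q - P i)), ← Real.sqrt_mul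
        (by positivity), ← Real.sqrt_sq (norm_nonneg (q - P l))]
      congr 1
      field_simp
      linarith
    have h2 : dist q (P i) ≠ 0 := dist_ne_zero.2 hqi
    have h3 : dist (P l) (P i) ≠ 0 := dist_ne_zero.2 hl.symm
    rw [h1]
    field_simp
  have hinj := EuclideanGeometry.inversion_injective (P i) (one_ne_zero (α := ℝ))
  by_cases hsub : ({q | costDiff η i j P q = 0} ∩ {q | costDiff η i k P q = 0}).Subsingleton
  · exact hsub.finite
  · obtain ⟨q₁, h₁, q₂, h₂, hne⟩ := not_subsingleton_iff.1 hsub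
    refine (toFinite {q₁, q₂}).subset fun q hq => ?_
    -- In the plane, circles about different centres that share two points share no third one.
    have := EuclideanGeometry.eq_of_dist_eq_of_dist_eq_of_finrank_eq_two (V := Plane)
      (by simp) (hinj.ne hjk) (hinj.ne hne) (hdist j hij _ h₁.1)
      (hdist j hij _ h₂.1) (hdist j hij _ hq.1) (hdist k hik _ h₁.2) (hdist k hik _ h₂.2)
      (hdist k hik _ hq.2)
    exact this.imp (fun h => hinj h) (fun h => hinj h)

end

/-! ### Outward normals, tangential velocities and corners of convex sets -/

noncomputable section

theorem mem_closure_congr_nhds {S S' : Set Plane} {x : Plane}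
    (h : ∀ᶠ y in 𝓝 x, (y ∈ S ↔ y ∈ S')) : x ∈ closure S ↔ x ∈ closure S' := by
  rw [mem_closure_iff_frequently, mem_closure_iff_frequently]
  exact frequently_congr h

theorem mem_frontier_congr_nhds {S S' : Set Plane} {x : Plane}
    (h : ∀ᶠ y in 𝓝 x, (y ∈ S ↔ y ∈ S')) : x ∈ frontier S ↔ x ∈ frontier S' := by
  rw [frontier_eq_closure_inter_closure, frontier_eq_closure_inter_closure, mem_inter_iff,
    mem_inter_iff, mem_closure_congr_nhds h]
  refine and_congr_right fun _ => mem_closure_congr_nhds ?_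
  filter_upwards [h] with y hy
  rw [mem_compl_iff, mem_compl_iff, hy]

theorem IsOutwardNormal.congr_nhds {S S' : Set Plane} {x ν : Plane}
    (h : ∀ᶠ y in 𝓝 x, (y ∈ S ↔ y ∈ S')) (hν : IsOutwardNormal S x ν) :
    IsOutwardNormal S' x ν := by
  refine ⟨hν.1, fun ε hε => ?_⟩
  filter_upwards [h, hν.2 ε hε] with y hy hy'
  rwa [← hy]

theorem IsOutwardNormal.outwardNormal_eq {S : Set Plane} {x ν : Plane}
    (h : IsOutwardNormal S x ν) : outwardNormal S x = ν := by
  have hex : ∃ ν, IsOutwardNormal S x ν := ⟨ν, h⟩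
  rw [outwardNormal, dif_pos hex]
  exact hex.choose_spec.unique h

/-- The linear part of `h` decides its sign outside every double sector around the tangent line; the
set is where `h ≥ 0`, so the normal points against the gradient. -/
theorem isOutwardNormal_of_hasFDerivAt {S : Set Plane} {x g : Plane} {h : Plane → ℝ}
    (hd : HasFDerivAt h (innerSL ℝ g) x) (h0 : h x = 0) (hg : g ≠ 0)
    (hS : ∀ᶠ y in 𝓝 x, (y ∈ S ↔ 0 ≤ h y)) : IsOutwardNormal S x (-(‖g‖⁻¹ • g)) := by
  have hg' : 0 < ‖g‖ := norm_pos_iff.2 hg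
  refine ⟨by rw [norm_neg, norm_smul, norm_inv, norm_norm, inv_mul_cancel₀ hg'.ne'], ?_⟩
  intro ε hε
  filter_upwards [hS, hd.isLittleO.def (mul_pos hε hg')] with y hy hy'
  rw [h0, sub_zero, innerSL_apply_apply, Real.norm_eq_abs] at hy'
  have hin : inner ℝ (y - x) (-(‖g‖⁻¹ • g)) = -(‖g‖⁻¹ * inner ℝ g (y - x)) := by
    rw [inner_neg_right, real_inner_smul_right, real_inner_comm]
  have hab := abs_le.1 hy'
  rw [hin, hy]
  constructor
  · intro h1
    have h2 : ε * ‖y - x‖ * ‖g‖ < inner ℝ g (y - x) := by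
      have h3 : ε * ‖y - x‖ < ‖g‖⁻¹ * inner ℝ g (y - x) := by linarith
      rwa [inv_mul_eq_div, lt_div_iff₀ hg'] at h3
    linarith [hab.1]
  · intro h1 hc
    have h2 : inner ℝ g (y - x) < -(ε * ‖y - x‖ * ‖g‖) := by
      have h3 : ‖g‖⁻¹ * inner ℝ g (y - x) < -(ε * ‖y - x‖) := by linarith
      rw [inv_mul_eq_div, div_lt_iff₀ hg'] at h3
      linarith
    linarith [hab.2]

/-- The two open sectors away from the tangent line belong locally to the interior and to the
exterior, so the frontier is confined to the thin double sector between them. -/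
theorem IsOutwardNormal.abs_inner_le_of_mem_frontier {S : Set Plane} {x ν : Plane}
    (h : IsOutwardNormal S x ν) {ε : ℝ} (hε : 0 < ε) :
    ∀ᶠ y in 𝓝 x, y ∈ frontier S → |inner ℝ (y - x) ν| ≤ ε * ‖y - x‖ := by
  filter_upwards [(h.2 ε hε).eventually_nhds] with y hy hyS
  have hc : Continuous fun z : Plane => inner ℝ (z - x) ν := by fun_prop
  have hn : Continuous fun z : Plane => ε * ‖z - x‖ := by fun_prop
  rw [abs_le]
  constructor
  · by_contra! hlt
    have h1 := (hc.tendsto y).eventually_lt (hn.neg.tendsto y) hlt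
    have h2 : y ∈ interior S := by
      rw [mem_interior_iff_mem_nhds]
      filter_upwards [h1, hy] with z hz hz'
      exact hz'.1 hz
    exact hyS.2 h2
  · by_contra! hlt
    have h1 := (hn.tendsto y).eventually_lt (hc.tendsto y) hlt
    have h2 : ∃ᶠ z in 𝓝 y, z ∈ S := mem_closure_iff_frequently.1 hyS.1
    obtain ⟨z, hz, hz1, hz2⟩ := (h2.and_eventually (h1.and hy)).exists
    exact hz2.2 hz1 hz

/-- Along a curve in the boundary of a set, the velocity is orthogonal to the normal. -/
theorem IsOutwardNormal.innerSL_comp_eq_zero {S : Set Plane} {x ν p : Plane}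
    (h : IsOutwardNormal S x ν) {γ : Plane → Plane} {L : Plane →L[ℝ] Plane} (hx : γ p = x)
    (hγ : ∀ᶠ p' in 𝓝 p, γ p' ∈ frontier S) (hL : HasFDerivAt γ L p) :
    (innerSL ℝ ν).comp L = 0 := by
  have h1 : HasFDerivAt (fun p' => inner ℝ ν (γ p' - x)) ((innerSL ℝ ν).comp L) p :=
    (innerSL ℝ ν).hasFDerivAt.comp p (hL.sub_const x)
  have h2 : HasFDerivAt (fun p' => inner ℝ ν (γ p' - x)) (0 : Plane →L[ℝ] ℝ) p := by
    rw [hasFDerivAt_iff_isLittleO]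
    have h3 : (fun p' => inner ℝ ν (γ p' - x)) =o[𝓝 p] fun p' => γ p' - γ p := by
      refine Asymptotics.isLittleO_iff.2 fun ε hε => ?_
      have hc : Tendsto γ (𝓝 p) (𝓝 x) := hx ▸ hL.continuousAt
      filter_upwards [hc.eventually (h.abs_inner_le_of_mem_frontier hε), hγ] with p' h4 h5
      rw [hx, Real.norm_eq_abs, real_inner_comm]
      exact h4 h5
    have h4 := h3.trans_isBigO hL.isBigO_sub
    simpa [hx] using h4
  exact h1.unique h2

/-- The vectors that are normal to `K` at `x` in the sense of convex geometry. -/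
def outerNormals (K : Set Plane) (x : Plane) : Set Plane :=
  {ν | ∀ y ∈ K, inner ℝ (y - x) ν ≤ (0 : ℝ)}

theorem convex_outerNormals (K : Set Plane) (x : Plane) : Convex ℝ (outerNormals K x) := by
  intro ν hν μ hμ a b ha hb _ y hy
  rw [inner_add_right, real_inner_smul_right, real_inner_smul_right]
  have h1 := mul_nonpos_of_nonneg_of_nonpos ha (hν y hy)
  have h2 := mul_nonpos_of_nonneg_of_nonpos hb (hμ y hy)
  linarith

theorem outerNormals_closure {K : Set Plane} {x ν : Plane} (hν : ν ∈ outerNormals K x) :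
    ∀ y ∈ closure K, inner ℝ (y - x) ν ≤ (0 : ℝ) := fun y hy =>
  closure_minimal (s := K) (t := {y | inner ℝ (y - x) ν ≤ (0 : ℝ)}) hν
    (isClosed_le (by fun_prop) continuous_const) hy

theorem inner_lt_zero_of_mem_interior {K : Set Plane} {x ν y : Plane} (hν : ν ∈ outerNormals K x)
    (hν0 : ν ≠ 0) (hy : y ∈ interior K) : inner ℝ (y - x) ν < (0 : ℝ) := by
  have hc : Tendsto (fun t : ℝ => y + t • ν) (𝓝[>] 0) (𝓝 y) := by
    have : Tendsto (fun t : ℝ => y + t • ν) (𝓝 0) (𝓝 (y + (0 : ℝ) • ν)) :=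
      Continuous.tendsto (by fun_prop) 0
    rw [zero_smul, add_zero] at this
    exact this.mono_left nhdsWithin_le_nhds
  obtain ⟨t, ht, ht0⟩ := ((hc.eventually (mem_interior_iff_mem_nhds.1 hy)).and
    self_mem_nhdsWithin).exists
  have h1 := hν _ ht
  have h2 : y + t • ν - x = (y - x) + t • ν := by abel
  have h3 : 0 < ‖ν‖ := norm_pos_iff.2 hν0
  have ht0 : 0 < t := ht0
  rw [h2, inner_add_left, real_inner_smul_left, real_inner_self_eq_norm_sq] at h1
  have : 0 < t * ‖ν‖ ^ 2 := by positivity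
  linarith

/-- A convex set has corners in at most countably many points. -/
theorem countable_setOf_interior_outerNormals_nonempty (K : Set Plane) :
    {x ∈ closure K | (interior (outerNormals K x)).Nonempty}.Countable := by
  refine PairwiseDisjoint.countable_of_isOpen (s := fun x => interior (outerNormals K x))
    ?_ (fun _ _ => isOpen_interior) (fun x hx => hx.2)
  intro x hx y hy hxy
  rw [Function.onFun, disjoint_left]
  intro ν hνx hνy
  -- A vector normal at both `x` and `y` is orthogonal to `y - x`; if this holds on an open set of
  -- vectors, then `y = x`. So the interiors of the normal cones are disjoint open sets, and there
  -- are countably many non-empty ones.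
  have key : ∀ᶠ μ in 𝓝 ν, inner ℝ (y - x) μ = (0 : ℝ) := by
    filter_upwards [isOpen_interior.mem_nhds hνx, isOpen_interior.mem_nhds hνy] with μ h1 h2
    have h3 := outerNormals_closure (interior_subset h1) y hy.1
    have h4 := outerNormals_closure (interior_subset h2) x hx.1
    rw [← neg_sub y x, inner_neg_left] at h4
    linarith
  have hd : HasFDerivAt (fun μ => inner ℝ (y - x) μ) (innerSL ℝ (y - x)) ν :=
    (innerSL ℝ (y - x)).hasFDerivAt
  have h0 := hd.unique ((hasFDerivAt_const (0 : ℝ) ν).congr_of_eventuallyEq key)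
  have : y - x = 0 := by
    have h1 := congrArg (fun f : Plane →L[ℝ] ℝ => f (y - x)) h0
    rwa [innerSL_apply_apply, zero_apply, inner_self_eq_zero] at h1
  exact hxy (sub_eq_zero.1 this).symm

/-- Hahn–Banach gives a nonzero normal `ν`. Two independent normals would span, with `0`, a convex
set with interior, so all normals are multiples of `ν`. A direction of the open half-plane below `ν`
whose ray missed the interior would give another separating form, a multiple of `ν`, and a
contradiction. Compactness of the set of directions makes the statement uniform, as the definition
of an outward normal demands. -/
theorem exists_isOutwardNormal_of_not_corner {K : Set Plane} (hK : Convex ℝ K)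
    (hne : (interior K).Nonempty) {x : Plane} (hx : x ∈ frontier K)
    (hcorner : ¬(interior (outerNormals K x)).Nonempty) : ∃ ν, IsOutwardNormal K x ν := by
  obtain ⟨z, hz⟩ := hne
  have hzero : (0 : Plane) ∈ outerNormals K x := fun y _ => by rw [inner_zero_right]
  -- every nonzero linear form that separates gives a normal
  have hsep : ∀ f : Plane →L[ℝ] ℝ, (∀ y ∈ interior K, f y ≤ f x) →
      (InnerProductSpace.toDual ℝ Plane).symm f ∈ outerNormals K x := by
    intro f hf y hy
    rw [real_inner_comm, InnerProductSpace.toDual_symm_apply, map_sub, sub_nonpos]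
    have hcl : y ∈ closure (interior K) := by
      rw [hK.closure_interior_eq_closure_of_nonempty_interior ⟨z, hz⟩]
      exact subset_closure hy
    exact closure_minimal (s := interior K) (t := {y | f y ≤ f x}) hf
      (isClosed_le f.continuous continuous_const) hcl
  obtain ⟨μ, hμ, hμ0⟩ : ∃ μ ∈ outerNormals K x, μ ≠ 0 := by
    obtain ⟨f, hf⟩ := geometric_hahn_banach_open_point hK.interior isOpen_interior hx.2
    refine ⟨_, hsep f fun y hy => (hf y hy).le, fun h => ?_⟩
    have hf0 : f = 0 := by simpa using h
    have := hf z hz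
    simp [hf0] at this
  set ν : Plane := ‖μ‖⁻¹ • μ with hν
  have hμpos : 0 < ‖μ‖ := norm_pos_iff.2 hμ0
  have hν1 : ‖ν‖ = 1 := by rw [hν, norm_smul, norm_inv, norm_norm, inv_mul_cancel₀ hμpos.ne']
  have hνN : ν ∈ outerNormals K x := fun y hy => by
    rw [hν, real_inner_smul_right]
    exact mul_nonpos_of_nonneg_of_nonpos (by positivity) (hμ y hy)
  have hν0 : ν ≠ 0 := by rw [← norm_ne_zero_iff, hν1]; exact one_ne_zero
  -- all the normals are multiples of `ν`
  have hmul : ∀ ξ ∈ outerNormals K x, ∃ c : ℝ, ξ = c • ν := by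
    intro ξ hξ
    by_contra! hno
    have hli : LinearIndependent ℝ ![ν, ξ] := by
      rw [LinearIndependent.pair_iff' hν0]
      exact fun a h => hno a h.symm
    apply hcorner
    rw [(convex_outerNormals K x).interior_nonempty_iff_affineSpan_eq_top]
    rw [← AffineSubspace.coe_eq_univ_iff, eq_univ_iff_forall]
    have hspan : Submodule.span ℝ (range ![ν, ξ]) = ⊤ :=
      hli.span_eq_top_of_card_eq_finrank (by simp)
    have hdir : vectorSpan ℝ (outerNormals K x) = ⊤ := by
      rw [eq_top_iff, ← hspan, Submodule.span_le]
      rintro _ ⟨k, rfl⟩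
      have : ∀ v ∈ outerNormals K x, v ∈ vectorSpan ℝ (outerNormals K x) := fun v hv => by
        simpa using vsub_mem_vectorSpan ℝ hv hzero
      fin_cases k
      · exact this ν hνN
      · exact this ξ hξ
    intro v
    have h0 : (0 : Plane) ∈ affineSpan ℝ (outerNormals K x) := subset_affineSpan ℝ _ hzero
    have h1 : v ∈ (affineSpan ℝ (outerNormals K x)).direction := by
      rw [direction_affineSpan, hdir]; trivial
    simpa using AffineSubspace.vadd_mem_of_mem_direction h1 h0
  -- the rays into the half-plane meet the interior
  have hray : ∀ u : Plane, inner ℝ u ν < (0 : ℝ) → ∃ t > (0 : ℝ), x + t • u ∈ interior K := by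
    intro u hu
    by_contra! hno
    set ray : Set Plane := (fun t : ℝ => x + t • u) '' Ioi 0 with hrayd
    have hconv : Convex ℝ ray := by
      rintro _ ⟨s, hs, rfl⟩ _ ⟨t, ht, rfl⟩ a b ha hb hab
      refine ⟨a * s + b * t, ?_, ?_⟩
      · have hs : 0 < s := hs
        have ht : 0 < t := ht
        rcases ha.lt_or_eq with h | h
        · exact add_pos_of_pos_of_nonneg (mul_pos h hs) (mul_nonneg hb ht.le)
        · have : b = 1 := by linarith
          simp [← h, this, ht]
      · have hb' : b = 1 - a := by linarith
        subst hb'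
        simp only
        module
    obtain ⟨f, c, hf1, hf2⟩ := geometric_hahn_banach_open hK.interior isOpen_interior hconv
      (disjoint_right.2 (by rintro _ ⟨t, ht, rfl⟩; exact hno t ht))
    have hle : ∀ y ∈ interior K, ∀ t > (0 : ℝ), f y < f x + t * f u := by
      intro y hy t ht
      have := (hf1 y hy).trans_le (hf2 _ ⟨t, ht, rfl⟩)
      simpa using this
    have hxle : ∀ y ∈ interior K, f y ≤ f x := by
      intro y hy
      have ht : Tendsto (fun t : ℝ => f x + t * f u) (𝓝[>] 0) (𝓝 (f x + 0 * f u)) :=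
        (Continuous.tendsto (by fun_prop) 0).mono_left nhdsWithin_le_nhds
      rw [zero_mul, add_zero] at ht
      exact ge_of_tendsto ht (eventually_mem_nhdsWithin.mono fun t ht => (hle y hy t ht).le)
    obtain ⟨a, ha⟩ := hmul _ (hsep f hxle)
    have hfa : ∀ v, f v = a * inner ℝ v ν := by
      intro v
      rw [← InnerProductSpace.toDual_symm_apply (𝕜 := ℝ) (y := f), ha, real_inner_smul_left,
        real_inner_comm]
    have hzlt := inner_lt_zero_of_mem_interior hνN hν0 hz
    have ha0 : 0 ≤ a := by
      by_contra! hneg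
      have h1 := hxle z hz
      rw [← sub_nonpos, ← map_sub, hfa] at h1
      have := mul_pos_of_neg_of_neg hneg hzlt
      linarith
    rcases ha0.lt_or_eq with hpos | h0
    · have hfu : f u < 0 := by rw [hfa]; exact mul_neg_of_pos_of_neg hpos hu
      -- For this `t`, the right side `f x + t * f u` is `f z + f u`, which is less than `f z`.
      have h1 := hle z hz ((f z - f x) / f u + 1) (by
        have h2 : 0 ≤ (f z - f x) / f u :=
          div_nonneg_of_nonpos (by linarith [hxle z hz]) hfu.le
        linarith)
      rw [add_mul, div_mul_cancel₀ _ hfu.ne] at h1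
      linarith
    · have h1 := hle z hz 1 one_pos
      rw [hfa, hfa, hfa, ← h0] at h1
      linarith
  refine ⟨ν, hν1, fun ε hε => ?_⟩
  -- uniformly in the direction
  have hcpt : IsCompact (Metric.sphere (0 : Plane) 1 ∩ {u | inner ℝ u ν ≤ -ε}) :=
    (isCompact_sphere 0 1).inter_right (isClosed_le (by fun_prop) continuous_const)
  have hopen : ∀ᶠ s in 𝓝 (0 : ℝ), ∀ u ∈ Metric.sphere (0 : Plane) 1 ∩ {u | inner ℝ u ν ≤ -ε},
      0 < s → x + s • u ∈ interior K := by
    refine hcpt.eventually_forall_of_forall_eventually fun u hu => ?_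
    have hu' : inner ℝ u ν < (0 : ℝ) := lt_of_le_of_lt hu.2 (by linarith)
    obtain ⟨t, ht, hmem⟩ := hray u hu'
    have h1 : ∀ᶠ u' in 𝓝 u, x + t • u' ∈ interior K :=
      (Continuous.tendsto (f := fun u' : Plane => x + t • u') (by fun_prop) u).eventually
        (isOpen_interior.mem_nhds hmem)
    have h2 : ∀ᶠ s in 𝓝 (0 : ℝ), s < t := Iio_mem_nhds ht
    rw [nhds_prod_eq]
    -- One good length `t` gives all shorter ones: the open segment from a closure point to an
    -- interior point of a convex set is interior.
    filter_upwards [h2.prod_mk h1] with ⟨s, u'⟩ ⟨hst, hu'⟩ hs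
    have hseg := hK.openSegment_closure_interior_subset_interior hx.1 hu'
    apply hseg
    refine ⟨1 - s / t, s / t, ?_, div_pos hs ht, by ring, ?_⟩
    · rw [sub_pos, div_lt_one ht]; exact hst
    · simp only at hs ⊢
      rw [smul_add, smul_smul, div_mul_cancel₀ _ ht.ne']
      module
  obtain ⟨δ, hδ, hball⟩ := Metric.eventually_nhds_iff.1 hopen
  filter_upwards [Metric.ball_mem_nhds x hδ] with y hy
  constructor
  · intro hlt
    have hyx : y ≠ x := by
      rintro rfl
      simp at hlt
    have hpos : 0 < ‖y - x‖ := norm_pos_iff.2 (sub_ne_zero.2 hyx)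
    have h1 : dist ‖y - x‖ 0 < δ := by
      rw [dist_zero_right, norm_norm, ← dist_eq_norm]; exact hy
    have h2 := hball h1 (‖y - x‖⁻¹ • (y - x)) ⟨by
      rw [mem_sphere_zero_iff_norm, norm_smul, norm_inv, norm_norm, inv_mul_cancel₀ hpos.ne'], by
      rw [mem_ofPred_eq, real_inner_smul_left, inv_mul_eq_div, div_le_iff₀ hpos]; linarith⟩ hpos
    rw [smul_smul, mul_inv_cancel₀ hpos.ne', one_smul, add_sub_cancel] at h2
    exact interior_subset h2
  · intro hlt hyK
    have h1 := hνN y hyK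
    have h2 : 0 ≤ ε * ‖y - x‖ := by positivity
    linarith

/-- A convex set with non-empty interior has an outward normal at almost all boundary points. -/
theorem ae_exists_isOutwardNormal {K : Set Plane} (hK : Convex ℝ K)
    (hne : (interior K).Nonempty) :
    ∀ᵐ x ∂(μH[1] : Measure Plane), x ∈ frontier K → ∃ ν, IsOutwardNormal K x ν := by
  have := Measure.nullSingletonClass_hausdorff Plane (d := 1) one_pos
  have h := (countable_setOf_interior_outerNormals_nonempty K).ae_notMem
    (μH[1] : Measure Plane)
  filter_upwards [h] with x hx hxK
  exact exists_isOutwardNormal_of_not_corner hK hne hxK fun hc => hx ⟨hxK.1, hc⟩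

end

/-! ### Several interfaces: telescoping the product of indicators -/

noncomputable section

variable {n : ℕ} {η : Fin n → ℝ} {i : Fin n}

theorem isOpen_openSquare (a b : ℝ) : IsOpen (openSquare a b) := by
  have : openSquare a b = ⋂ k : Fin 2, (fun x : Plane => x k) ⁻¹' Ioo a b := by
    ext x; simp [openSquare]
  rw [this]
  exact isOpen_iInter_of_finite fun _ => isOpen_Ioo.preimage (by fun_prop)

theorem convex_openSquare (a b : ℝ) : Convex ℝ (openSquare a b) := by
  intro x hx y hy s t hs ht hst k
  exact convex_Ioo a b (hx k) (hy k) hs ht hst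

theorem costDiff_self (P : Fin n → Plane) (q : Plane) : costDiff η i i P q = 0 := sub_self _

theorem costInd_self (P : Fin n → Plane) (q : Plane) : costInd η i i P q = 1 :=
  costInd_of_nonneg (costDiff_self P q).ge

theorem prod_costInd_mem_Icc (s : Finset (Fin n)) (P : Fin n → Plane) (q : Plane) :
    ∏ k ∈ s, costInd η i k P q ∈ Icc (0 : ℝ) 1 :=
  ⟨Finset.prod_nonneg fun _ _ => (costInd_mem_Icc P q).1,
    Finset.prod_le_one (fun _ _ => (costInd_mem_Icc P q).1) fun _ _ => (costInd_mem_Icc P q).2⟩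

theorem measurable_prod_costInd (s : Finset (Fin n)) (P : Fin n → Plane) :
    Measurable fun q => ∏ k ∈ s, costInd η i k P q :=
  Finset.measurable_fun_prod s fun _ _ => measurable_costInd P

theorem prod_costInd_of_nonneg {s : Finset (Fin n)} {P : Fin n → Plane} {q : Plane}
    (h : ∀ k ∈ s, 0 ≤ costDiff η i k P q) : ∏ k ∈ s, costInd η i k P q = 1 :=
  Finset.prod_eq_one fun k hk => costInd_of_nonneg (h k hk)

theorem prod_costInd_of_neg {s : Finset (Fin n)} {P : Fin n → Plane} {q : Plane}
    (h : ∃ k ∈ s, costDiff η i k P q < 0) : ∏ k ∈ s, costInd η i k P q = 0 := by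
  obtain ⟨k, hk, hneg⟩ := h
  exact Finset.prod_eq_zero hk (costInd_of_neg hneg)

theorem eventually_costInd_eq' {k : Fin n} {P₀ : Fin n → Plane} {x : Plane}
    (h : k ≠ i → costDiff η i k P₀ x ≠ 0) :
    ∀ᶠ z : (Fin n → Plane) × Plane in 𝓝 (P₀, x), costInd η i k z.1 z.2 = costInd η i k P₀ x := by
  by_cases hk : k = i
  · subst hk
    exact Eventually.of_forall fun z => by rw [costInd_self, costInd_self]
  · exact eventually_costInd_eq (h hk)

theorem eventually_prod_costInd_eq {s : Finset (Fin n)} {P₀ : Fin n → Plane} {x : Plane}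
    (h : ∀ k ∈ s, k ≠ i → costDiff η i k P₀ x ≠ 0) :
    ∀ᶠ z : (Fin n → Plane) × Plane in 𝓝 (P₀, x),
      ∏ k ∈ s, costInd η i k z.1 z.2 = ∏ k ∈ s, costInd η i k P₀ x := by
  have h1 : ∀ᶠ z : (Fin n → Plane) × Plane in 𝓝 (P₀, x), ∀ k ∈ s,
      costInd η i k z.1 z.2 = costInd η i k P₀ x :=
    (Filter.eventually_all_finset s).2 fun k hk => eventually_costInd_eq' (h k hk)
  filter_upwards [h1] with z hz
  exact Finset.prod_congr rfl hz

theorem eventually_left_prod_costInd_eq {s : Finset (Fin n)} {P₀ : Fin n → Plane} {x : Plane}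
    (h : ∀ k ∈ s, k ≠ i → costDiff η i k P₀ x ≠ 0) :
    ∀ᶠ P in 𝓝 P₀, ∏ k ∈ s, costInd η i k P x = ∏ k ∈ s, costInd η i k P₀ x :=
  (tendsto_id.prodMk_nhds (tendsto_const_nhds (x := x))).eventually (eventually_prod_costInd_eq h)

theorem ae_costDiff_ne_zero (hη : ∀ k, 0 < η k) {P : Fin n → Plane} (hP : Function.Injective P) :
    ∀ᵐ q : Plane, ∀ k, k ≠ i → costDiff η i k P q ≠ 0 := by
  rw [ae_all_iff]
  intro k
  by_cases hk : k = i
  · exact ae_of_all _ fun q h => absurd hk h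
  · have := volume_interface_eq_zero (i := i) (j := k) hη (hP.ne (Ne.symm hk))
    rw [measure_eq_zero_iff_ae_notMem] at this
    filter_upwards [this] with q hq _
    exact hq

/-- The factors of the integrand on the interface with sensor `j` that come from the region `O`
and from the other sensors: those in `s` at the deployment `P`, those in `t` at `P₀`. -/
def interfaceWeight (η : Fin n → ℝ) (i : Fin n) (O : Set Plane) (s t : Finset (Fin n))
    (P₀ P : Fin n → Plane) (q : Plane) : ℝ :=
  O.indicator 1 q * ((∏ k ∈ s, costInd η i k P q) * ∏ k ∈ t, costInd η i k P₀ q)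

theorem interfaceWeight_mem_Icc (O : Set Plane) (s t : Finset (Fin n)) (P₀ P : Fin n → Plane)
    (q : Plane) : interfaceWeight η i O s t P₀ P q ∈ Icc (0 : ℝ) 1 := by
  have h1 := prod_costInd_mem_Icc (η := η) (i := i) s P q
  have h2 := prod_costInd_mem_Icc (η := η) (i := i) t P₀ q
  have h3 : O.indicator (1 : Plane → ℝ) q ∈ Icc (0 : ℝ) 1 := by
    by_cases h : q ∈ O <;> simp [h]
  exact ⟨mul_nonneg h3.1 (mul_nonneg h1.1 h2.1),
    mul_le_one₀ h3.2 (mul_nonneg h1.1 h2.1) (mul_le_one₀ h1.2 h2.1 h2.2)⟩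

theorem measurable_interfaceWeight {O : Set Plane} (hO : IsOpen O) (s t : Finset (Fin n))
    (P₀ P : Fin n → Plane) : Measurable (interfaceWeight η i O s t P₀ P) :=
  (measurable_one.indicator hO.measurableSet).mul
    ((measurable_prod_costInd s P).mul (measurable_prod_costInd t P₀))

/-- Either one factor is zero near the point, whatever the others do, or every factor is locally
constant. The first alternative is needed because regular deployments say nothing about points where
sensor `i` does not have least cost. -/
theorem eventually_interfaceWeight_eq {O : Set Plane} {s t : Finset (Fin n)}
    {P₀ : Fin n → Plane} {x : Plane}
    (h : (∃ k ∈ s ∪ t, costDiff η i k P₀ x < 0) ∨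
      (x ∉ frontier O ∧ ∀ k ∈ s ∪ t, k ≠ i → costDiff η i k P₀ x ≠ 0)) :
    ∀ᶠ z : (Fin n → Plane) × Plane in 𝓝 (P₀, x),
      interfaceWeight η i O s t P₀ z.1 z.2 = interfaceWeight η i O s t P₀ P₀ x := by
  rcases h with ⟨k, hk, hneg⟩ | ⟨hx, hne⟩
  · have h1 := eventually_costInd_eq (η := η) (i := i) hneg.ne
    have hs : Tendsto (fun z : (Fin n → Plane) × Plane => (P₀, z.2)) (𝓝 (P₀, x))
        (𝓝 (P₀, x)) := Continuous.tendsto (by fun_prop) (P₀, x)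
    filter_upwards [h1, hs.eventually h1] with z hz hz'
    rw [costInd_of_neg hneg] at hz hz'
    unfold interfaceWeight
    rcases Finset.mem_union.1 hk with hk | hk
    · rw [Finset.prod_eq_zero hk hz, Finset.prod_eq_zero hk (costInd_of_neg hneg)]
      simp
    · rw [Finset.prod_eq_zero (s := t) hk hz', Finset.prod_eq_zero (s := t) hk
        (costInd_of_neg hneg)]
      simp
  · have hs : Tendsto (fun z : (Fin n → Plane) × Plane => (P₀, z.2)) (𝓝 (P₀, x))
        (𝓝 (P₀, x)) := Continuous.tendsto (by fun_prop) (P₀, x)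
    have hO : ∀ᶠ z : (Fin n → Plane) × Plane in 𝓝 (P₀, x),
        O.indicator (1 : Plane → ℝ) z.2 = O.indicator 1 x := by
      have hsnd : Tendsto (Prod.snd : (Fin n → Plane) × Plane → Plane) (𝓝 (P₀, x)) (𝓝 x) :=
        continuous_snd.tendsto (P₀, x)
      refine hsnd.eventually (p := fun y => O.indicator (1 : Plane → ℝ) y = O.indicator 1 x) ?_
      by_cases hxO : x ∈ closure O
      · have hxi : x ∈ interior O := by_contra fun hc => hx ⟨hxO, hc⟩
        filter_upwards [mem_interior_iff_mem_nhds.1 hxi] with y hy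
        rw [indicator_of_mem hy, indicator_of_mem (interior_subset hxi)]; rfl
      · filter_upwards [isClosed_closure.isOpen_compl.mem_nhds hxO] with y hy
        rw [indicator_of_notMem fun h => hy (subset_closure h),
          indicator_of_notMem fun h => hxO (subset_closure h)]
    filter_upwards [hO, eventually_prod_costInd_eq (s := s) fun k hk =>
      hne k (Finset.mem_union_left _ hk), hs.eventually (eventually_prod_costInd_eq (s := t)
        fun k hk => hne k (Finset.mem_union_right _ hk))] with z h1 h2 h3
    unfold interfaceWeight
    rw [h1, h2, h3]

/-- A point of the interface with `j` where no sensor is strictly cheaper than `i` lies in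
`cellInterface`, so it avoids the frontier of `K` up to length zero. A third sensor ties at finitely
many points only, and points have length zero. -/
theorem ae_interface_regular (hη : ∀ k, 0 < η k) {K : Set Plane} {P : Fin n → Plane}
    (hP : Function.Injective P) (hreg : μH[1] (cellInterface η P i ∩ frontier K) = 0)
    {j : Fin n} (hj : j ≠ i) :
    ∀ᵐ x ∂(μH[1].restrict {q | costDiff η i j P q = 0}),
      (∃ k, costDiff η i k P x < 0) ∨
        (x ∉ frontier K ∧ ∀ k, k ≠ i → k ≠ j → costDiff η i k P x ≠ 0) := by
  have hna := Measure.nullSingletonClass_hausdorff Plane (d := 1) one_pos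
  have h1 : ∀ᵐ x ∂(μH[1] : Measure Plane), x ∉ cellInterface η P i ∩ frontier K :=
    measure_eq_zero_iff_ae_notMem.1 hreg
  have h2 : ∀ᵐ x ∂(μH[1] : Measure Plane), ∀ k, k ≠ i → k ≠ j →
      x ∉ {q | costDiff η i j P q = 0} ∩ {q | costDiff η i k P q = 0} := by
    rw [ae_all_iff]; intro k
    by_cases hki : k = i
    · exact ae_of_all _ fun x h => absurd hki h
    by_cases hkj : k = j
    · exact ae_of_all _ fun x _ h => absurd hkj h
    have := (finite_interface_inter_interface hη (hP.ne hj.symm) (hP.ne (Ne.symm hki))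
      (hP.ne (Ne.symm hkj))).countable.ae_notMem (μH[1] : Measure Plane)
    filter_upwards [this] with x hx _ _
    exact hx
  refine (ae_restrict_iff' (isClosed_costDiff_eq_zero P).measurableSet).2 ?_
  filter_upwards [h1, h2] with x hx1 hx2 hxj
  by_contra! hcon
  obtain ⟨hnn, hcon⟩ := hcon
  have hxj' : costDiff η i j P x = 0 := hxj
  have hxK : x ∉ frontier K := fun hf => by
    refine hx1 ⟨⟨fun k => sub_nonneg.1 (hnn k), j, hj, ?_⟩, hf⟩
    unfold costDiff at hxj'; linarith
  obtain ⟨k, hki, hkj, hk⟩ := hcon hxK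
  exact hx2 k hki hkj ⟨hxj, hk⟩

theorem tendsto_interfaceWeight_mul {O : Set Plane} {s t : Finset (Fin n)}
    {P₀ : Fin n → Plane} {x : Plane}
    (h : (∃ k ∈ s ∪ t, costDiff η i k P₀ x < 0) ∨
      (x ∉ frontier O ∧ ∀ k ∈ s ∪ t, k ≠ i → costDiff η i k P₀ x ≠ 0))
    {V : Type*} [NormedAddCommGroup V] [NormedSpace ℝ V]
    {ψ : (Fin n → Plane) × Plane → V} (hψ : ContinuousAt ψ (P₀, x)) :
    Tendsto (fun z : (Fin n → Plane) × Plane => interfaceWeight η i O s t P₀ z.1 z.2 • ψ z)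
      (𝓝 (P₀, x)) (𝓝 (interfaceWeight η i O s t P₀ P₀ x • ψ (P₀, x))) := by
  have h1 := hψ.tendsto.const_smul (interfaceWeight η i O s t P₀ P₀ x)
  refine h1.congr' ?_
  filter_upwards [eventually_interfaceWeight_eq h] with z hz
  rw [hz]

/-- The contribution of the interface with sensor `j` to the derivative of the integral of `f`
over the cell of sensor `i` in `O`. -/
def interfaceTerm (η : Fin n → ℝ) (i : Fin n) (O : Set Plane) (f : Plane → Plane → ℝ)
    (j : Fin n) (P : Fin n → Plane) : (Fin n → Plane) →L[ℝ] ℝ :=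
  (costSlope η i j P)⁻¹ • ∫ x in {q | costDiff η i j P q = 0},
    (interfaceWeight η i O {j}ᶜ ∅ P P x * f x (P i)) • costDeriv η i j P x ∂μH[1]

/-- The slope for `j = i` is `0` and so is its inverse; sums may therefore run over all sensors. -/
theorem interfaceTerm_self (O : Set Plane) (f : Plane → Plane → ℝ) (P : Fin n → Plane) :
    interfaceTerm η i O f i P = 0 := by
  simp [interfaceTerm, costSlope]

/-- At the base deployment the order of the sensors, an artefact of telescoping, disappears. -/
theorem interfaceWeight_split (O : Set Plane) (j : Fin n) (P : Fin n → Plane) :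
    interfaceWeight η i O {k | k < j} {k | j < k} P P = interfaceWeight η i O {j}ᶜ ∅ P P := by
  ext q
  unfold interfaceWeight
  rw [Finset.prod_empty, mul_one, ← Finset.prod_union]
  · congr 2
    ext k; simp [lt_or_lt_iff_ne]
  · rw [Finset.disjoint_left]
    intro k h1 h2
    simp only [Finset.mem_filter, Finset.mem_univ, true_and] at h1 h2
    exact lt_asymm h1 h2

/-- The derivative of an integral over the cell of sensor `i`, the integrand being fixed. -/
theorem hasFDerivAt_integral_cell_fixed (hη : ∀ k, 0 < η k) {K : Set Plane} {M C : ℝ}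
    (hK : ∀ q ∈ interior K, ‖q‖ ≤ M) {P₀ : Fin n → Plane} (hP₀ : Function.Injective P₀)
    (hreg : μH[1] (cellInterface η P₀ i ∩ frontier K) = 0) {f : Plane → Plane → ℝ}
    (hf : Continuous fun q => f q (P₀ i)) (hfC : ∀ q, ‖q‖ ≤ M → |f q (P₀ i)| ≤ C) :
    HasFDerivAt (fun P => ∫ q in interior K, (∏ k, costInd η i k P q) * f q (P₀ i))
      (∑ j, interfaceTerm η i (interior K) f j P₀) P₀ := by
  set O := interior K with hO
  have hOo : IsOpen O := isOpen_interior
  -- The weight of the `j`-th telescoping step: sensors before `j` have already been switched to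
  -- `P`, those after `j` are still at `P₀`.
  set B : Fin n → (Fin n → Plane) → Plane → ℝ := fun j P q =>
    interfaceWeight η i O {k | k < j} {k | j < k} P₀ P q * f q (P₀ i) with hB
  have hBm : ∀ j P, Measurable (B j P) := fun j P =>
    (measurable_interfaceWeight hOo _ _ P₀ P).mul hf.measurable
  have hBO : ∀ j P q, B j P q ≠ 0 → ‖q‖ ≤ M := by
    intro j P q hq
    refine hK q (by_contra fun hqO => hq ?_)
    simp [hB, interfaceWeight, hqO]
  have hC : ∀ j P q, |B j P q| ≤ max C 0 := by
    intro j P q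
    by_cases hq : B j P q = 0
    · rw [hq, abs_zero]; exact le_max_right _ _
    · have h1 := interfaceWeight_mem_Icc (η := η) (i := i) O {k | k < j} {k | j < k} P₀ P q
      have h2 := hfC q (hBO j P q hq)
      change |_ * _| ≤ _
      rw [abs_mul, abs_of_nonneg h1.1, ← one_mul (max C 0)]
      exact mul_le_mul h1.2 (h2.trans (le_max_left _ _)) (abs_nonneg _) zero_le_one
  have hterm : ∀ j, HasFDerivAt
      (fun P => ∫ q, (costInd η i j P q - costInd η i j P₀ q) * B j P q)
      (interfaceTerm η i O f j P₀) P₀ := by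
    intro j
    by_cases hj : j = i
    · subst hj
      rw [interfaceTerm_self]
      simpa only [costInd_self, sub_self, zero_mul, integral_zero] using
        hasFDerivAt_const (0 : ℝ) P₀
    · have hunion : ∀ k, k ∈ (Finset.univ.filter fun k => k < j) ∪
          (Finset.univ.filter fun k => j < k) ↔ k ≠ j := by
        intro k; simp [lt_or_lt_iff_ne]
      have h := hasFDerivAt_integral_costInd (η := η) (i := i) (j := j) hη
        (hP₀.ne (Ne.symm hj)) (B := B j) (C := max C 0) (M := M)
        (Eventually.of_forall (hBm j)) (Eventually.of_forall (hC j))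
        (Eventually.of_forall (hBO j)) ?_
      · refine h.congr_fderiv ?_
        rw [interfaceTerm, ← interfaceWeight_split]
      · filter_upwards [ae_interface_regular hη hP₀ hreg hj, ae_restrict_mem
          (isClosed_costDiff_eq_zero P₀).measurableSet] with x hx hxj
        have hxj' : costDiff η i j P₀ x = 0 := hxj
        refine tendsto_interfaceWeight_mul (ψ := fun z => f z.2 (P₀ i)) ?_
          (hf.comp continuous_snd).continuousAt
        rcases hx with ⟨k, hk⟩ | ⟨hxK, hne⟩
        · refine Or.inl ⟨k, (hunion k).2 ?_, hk⟩
          rintro rfl; linarith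
        · exact Or.inr ⟨fun h => hxK (frontier_interior_subset h), fun k hk hki =>
            hne k hki ((hunion k).1 hk)⟩
  have hsum := (HasFDerivAt.fun_sum fun j (_ : j ∈ Finset.univ) => hterm j).const_add
    (∫ q in O, (∏ k, costInd η i k P₀ q) * f q (P₀ i))
  refine hsum.congr_of_eventuallyEq (Eventually.of_forall fun P => ?_)
  have hi : ∀ j, Integrable (fun q => (costInd η i j P q - costInd η i j P₀ q) * B j P q) :=
    fun j => (integrable_costInd_sub_mul (hBm j P) (hC j P) (hBO j P)).2
  have hi₀ : Integrable (O.indicator fun q => (∏ k, costInd η i k P₀ q) * f q (P₀ i)) := by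
    refine integrable_of_bounded (C := max C 0) (M := M) (Measurable.indicator
      ((measurable_prod_costInd _ _).mul hf.measurable) hOo.measurableSet)
      (fun q => ?_) (fun q hq => hK q (mem_of_indicator_ne_zero hq))
    by_cases hq : q ∈ O
    · rw [indicator_of_mem hq, abs_mul]
      have h1 := prod_costInd_mem_Icc (η := η) (i := i) Finset.univ P₀ q
      rw [abs_of_nonneg h1.1, ← one_mul (max C 0)]
      exact mul_le_mul h1.2 ((hfC q (hK q hq)).trans (le_max_left _ _)) (abs_nonneg _)
        zero_le_one
    · rw [indicator_of_notMem hq, abs_zero]; exact le_max_right _ _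
  simp only
  rw [← integral_finsetSum _ fun j _ => hi j, ← integral_indicator hOo.measurableSet,
    ← integral_indicator hOo.measurableSet, ← integral_add hi₀ (integrable_finsetSum _
      fun j _ => hi j)]
  congr 1; ext1 q
  by_cases hq : q ∈ O
  · rw [indicator_of_mem hq, indicator_of_mem hq]
    -- The telescoping identity: each factor at `P` is the factor at `P₀` plus the difference.
    have h := Finset.prod_add_ordered Finset.univ (fun k => costInd η i k P₀ q)
      (fun k => costInd η i k P q - costInd η i k P₀ q)
    simp only [add_sub_cancel] at h
    rw [h, add_mul, Finset.sum_mul]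
    congr 1
    refine Finset.sum_congr rfl fun j _ => ?_
    simp only [hB, interfaceWeight, indicator_of_mem hq, Pi.one_apply]
    ring
  · rw [indicator_of_notMem hq, indicator_of_notMem hq, Finset.sum_eq_zero, add_zero]
    intro j _
    simp [hB, interfaceWeight, hq]

end

/-! ### The moving integrand; derivative of the cell integral and its continuity -/

noncomputable section

variable {n : ℕ} {η : Fin n → ℝ} {i : Fin n}

theorem continuous_of_continuousOn_openSquare {f : Plane → Plane → ℝ} {a b : ℝ}
    (hcont : ContinuousOn (fun z : Plane × Plane => f z.1 z.2) (univ ×ˢ openSquare a b))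
    {x : Plane} (hx : x ∈ openSquare a b) : Continuous fun q => f q x :=
  hcont.comp_continuous (by fun_prop : Continuous fun q : Plane => (q, x))
    fun q => ⟨mem_univ _, hx⟩

theorem eventually_apply_mem_openSquare {a b : ℝ} {P₀ : Fin n → Plane}
    (h : P₀ i ∈ openSquare a b) : ∀ᶠ P in 𝓝 P₀, P i ∈ openSquare a b :=
  ((continuous_apply i).tendsto P₀).eventually ((isOpen_openSquare a b).mem_nhds h)

theorem exists_eventually_bound {f : Plane → Plane → ℝ} {a b : ℝ}
    (hcont : ContinuousOn (fun z : Plane × Plane => f z.1 z.2) (univ ×ˢ openSquare a b))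
    {P₀ : Fin n → Plane} (h : P₀ i ∈ openSquare a b) (M : ℝ) :
    ∃ C, ∀ᶠ P in 𝓝 P₀, ∀ q, ‖q‖ ≤ M → |f q (P i)| ≤ C := by
  obtain ⟨r, hr, hball⟩ := Metric.nhds_basis_closedBall.mem_iff.1
    ((isOpen_openSquare a b).mem_nhds h)
  obtain ⟨C, hC⟩ := ((isCompact_closedBall (0 : Plane) M).prod
    (isCompact_closedBall (P₀ i) r)).exists_bound_of_continuousOn
    (hcont.mono (prod_mono (subset_univ _) hball))
  refine ⟨C, ?_⟩
  filter_upwards [((continuous_apply i).tendsto P₀).eventually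
    (Metric.closedBall_mem_nhds _ hr)] with P hP q hq
  exact hC (q, P i) ⟨by rwa [mem_closedBall_zero_iff], hP⟩

/-- The contribution of the interior of the cell of sensor `i` in `O` to the derivative of the
integral of `f` over it. -/
def interiorTerm (η : Fin n → ℝ) (i : Fin n) (O : Set Plane) (f : Plane → Plane → ℝ)
    (P : Fin n → Plane) : (Fin n → Plane) →L[ℝ] ℝ :=
  ∫ q in O, (∏ k, costInd η i k P q) •
    (fderiv ℝ (f q) (P i)).comp (ContinuousLinearMap.proj i)

/-- The derivative of an integral over the cell of sensor `i`, as far as it comes from the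
integrand. -/
theorem hasFDerivAt_integral_cell_moving_integrand (hη : ∀ k, 0 < η k) {K : Set Plane}
    {P₀ : Fin n → Plane} (hP₀ : Function.Injective P₀)
    {f : Plane → Plane → ℝ} {a b : ℝ} (hi : P₀ i ∈ openSquare a b)
    (hcont : ContinuousOn (fun z : Plane × Plane => f z.1 z.2) (univ ×ˢ openSquare a b))
    (hdiff : ∀ᵐ q : Plane, ContDiffOn ℝ 1 (f q) (openSquare a b))
    (hint' : Integrable (fun q => fderiv ℝ (f q) (P₀ i)))
    (hdom : ∃ ε > 0, ∃ g : Plane → ℝ, IntegrableOn g K ∧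
      ∀ᵐ q ∂(volume.restrict K), ∀ x ∈ openSquare a b ∩ Metric.ball (P₀ i) ε,
        ‖fderiv ℝ (f q) x‖ ≤ g q) :
    HasFDerivAt (fun P => ∫ q in interior K,
      (∏ k, costInd η i k P q) * (f q (P i) - f q (P₀ i)))
      (interiorTerm η i (interior K) f P₀) P₀ := by
  obtain ⟨ε, hε, g, hg, hbound⟩ := hdom
  refine (hasFDerivAt_integral_of_dominated_loc_of_lip' (𝕜 := ℝ)
    (μ := volume.restrict (interior K))
    (s := {P | P i ∈ openSquare a b ∧ ‖P - P₀‖ < ε}) (bound := g) ?_ ?_ ?_ ?_ ?_ ?_ ?_).2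
  · exact (eventually_apply_mem_openSquare hi).and
      (by filter_upwards [Metric.ball_mem_nhds P₀ hε] with P hP
          rwa [mem_ball_iff_norm] at hP)
  · rintro P ⟨hP, -⟩
    exact ((measurable_prod_costInd _ P).mul
      ((continuous_of_continuousOn_openSquare hcont hP).sub
        (continuous_of_continuousOn_openSquare hcont hi)).measurable).aestronglyMeasurable
  · simp
  · have h1 : AEStronglyMeasurable (fun q => (fderiv ℝ (f q) (P₀ i)).comp
        (ContinuousLinearMap.proj i : (Fin n → Plane) →L[ℝ] Plane)) volume :=
      ((ContinuousLinearMap.compL ℝ (Fin n → Plane) Plane ℝ).flip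
        (ContinuousLinearMap.proj i)).continuous.comp_aestronglyMeasurable
        hint'.aestronglyMeasurable
    exact ((measurable_prod_costInd _ P₀).aestronglyMeasurable.smul h1).restrict
  · have hd : ∀ᵐ q ∂(volume.restrict (interior K)), ContDiffOn ℝ 1 (f q) (openSquare a b) :=
      ae_restrict_of_ae hdiff
    filter_upwards [hd, ae_restrict_of_ae_restrict_of_subset interior_subset hbound]
      with q hq hb P hP
    have hball : ‖P i - P₀ i‖ ≤ ‖P - P₀‖ := norm_le_pi_norm (P - P₀) i
    have hPmem : P i ∈ openSquare a b ∩ Metric.ball (P₀ i) ε :=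
      ⟨hP.1, by rw [mem_ball_iff_norm]; exact hball.trans_lt hP.2⟩
    have hP₀mem : P₀ i ∈ openSquare a b ∩ Metric.ball (P₀ i) ε :=
      ⟨hi, Metric.mem_ball_self hε⟩
    -- The mean value inequality on the convex set square ∩ ball makes `g q` a Lipschitz constant,
    -- hence the dominating function.
    have hlip := Convex.norm_image_sub_le_of_norm_fderiv_le (𝕜 := ℝ)
      (fun x hx => (hq.differentiableOn one_ne_zero).differentiableAt
        ((isOpen_openSquare a b).mem_nhds hx.1)) hb
      ((convex_openSquare a b).inter (convex_ball _ _)) hP₀mem hPmem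
    have hg0 : 0 ≤ g q := (norm_nonneg _).trans (hb _ hP₀mem)
    have h1 := prod_costInd_mem_Icc (η := η) (i := i) Finset.univ P q
    rw [sub_self, mul_zero, sub_zero, norm_mul, Real.norm_of_nonneg h1.1]
    calc (∏ k, costInd η i k P q) * ‖f q (P i) - f q (P₀ i)‖
        ≤ 1 * (g q * ‖P i - P₀ i‖) := mul_le_mul h1.2 hlip (norm_nonneg _) zero_le_one
      _ ≤ g q * ‖P - P₀‖ := by
          rw [one_mul]; exact mul_le_mul_of_nonneg_left hball hg0
  · exact hg.mono_set interior_subset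
  · filter_upwards [ae_restrict_of_ae hdiff, ae_restrict_of_ae
      (ae_costDiff_ne_zero (i := i) hη hP₀)] with q hq hne
    have h1 : HasFDerivAt (fun P : Fin n → Plane => f q (P i) - f q (P₀ i))
        ((fderiv ℝ (f q) (P₀ i)).comp (ContinuousLinearMap.proj i)) P₀ := by
      have h2 : HasFDerivAt (f q) (fderiv ℝ (f q) (P₀ i)) (P₀ i) :=
        ((hq.differentiableOn one_ne_zero).differentiableAt
          ((isOpen_openSquare a b).mem_nhds hi)).hasFDerivAt
      have h3 : HasFDerivAt (fun P : Fin n → Plane => P i)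
          (ContinuousLinearMap.proj i : (Fin n → Plane) →L[ℝ] Plane) P₀ :=
        (ContinuousLinearMap.proj i : (Fin n → Plane) →L[ℝ] Plane).hasFDerivAt
      exact (HasFDerivAt.comp P₀ h2 h3).sub_const _
    -- Off the null union of the interfaces, the indicators at the fixed point `q` do not change for
    -- deployments near `P₀`.
    refine (h1.const_mul (∏ k, costInd η i k P₀ q)).congr_of_eventuallyEq ?_
    filter_upwards [eventually_left_prod_costInd_eq (s := Finset.univ)
      fun k _ hk => hne k hk] with P hP
    rw [hP]

theorem weightedVoronoi_inter_eq (Q W : Set Plane) (P : Fin n → Plane) :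
    weightedVoronoi Q η P i ∩ W = (Q ∩ W) ∩ {q | ∀ k, 0 ≤ costDiff η i k P q} := by
  ext q
  simp only [weightedVoronoi, costDiff, mem_inter_iff, mem_ofPred_eq, sub_nonneg]
  tauto

theorem isClosed_forall_costDiff_nonneg (P : Fin n → Plane) :
    IsClosed {q | ∀ k, 0 ≤ costDiff η i k P q} := by
  simp only [ofPred_forall]
  exact isClosed_iInter fun k => isClosed_le continuous_const (continuous_costDiff_right P)

/-- `Q ∩ W` need be neither open nor closed. Its frontier is null by convexity, so it may be
replaced by its interior. -/
theorem setIntegral_cell {V : Type*} [NormedAddCommGroup V] [NormedSpace ℝ V] {Q W : Set Plane}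
    (hK : Convex ℝ (Q ∩ W)) (P : Fin n → Plane) (f : Plane → V) :
    ∫ q in weightedVoronoi Q η P i ∩ W, f q =
      ∫ q in interior (Q ∩ W), (∏ k, costInd η i k P q) • f q := by
  have h1 : (Q ∩ W ∩ {q | ∀ k, 0 ≤ costDiff η i k P q} : Set Plane) =ᵐ[volume]
      (interior (Q ∩ W) ∩ {q | ∀ k, 0 ≤ costDiff η i k P q} : Set Plane) := by
    have h2 : ∀ᵐ q : Plane, q ∉ frontier (Q ∩ W) :=
      measure_eq_zero_iff_ae_notMem.1 (hK.addHaar_frontier volume)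
    rw [Filter.eventuallyEq_set]
    filter_upwards [h2] with q hq
    refine ⟨fun h => ⟨?_, h.2⟩, fun h => ⟨interior_subset h.1, h.2⟩⟩
    by_contra hc
    exact hq ⟨subset_closure h.1, hc⟩
  have hm : MeasurableSet {q | ∀ k, 0 ≤ costDiff η i k P q} :=
    (isClosed_forall_costDiff_nonneg P).measurableSet
  rw [weightedVoronoi_inter_eq, setIntegral_congr_set h1,
    ← setIntegral_indicator hm]
  congr 1; ext1 q
  by_cases hq : ∀ k, 0 ≤ costDiff η i k P q
  · rw [indicator_of_mem (by exact hq), prod_costInd_of_nonneg fun k _ => hq k, one_smul]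
  · rw [indicator_of_notMem (by exact hq), prod_costInd_of_neg, zero_smul]
    push Not at hq
    obtain ⟨k, hk⟩ := hq
    exact ⟨k, Finset.mem_univ k, hk⟩

/-- The derivative of the integral over the cell of sensor `i` with respect to the deployment. -/
theorem hasFDerivAt_cellIntegral (hη : ∀ k, 0 < η k) {Q W : Set Plane}
    (hK : Convex ℝ (Q ∩ W)) {M : ℝ} (hM : ∀ q ∈ interior (Q ∩ W), ‖q‖ ≤ M)
    {φ : Fin n → Plane → Plane → ℝ} {a b : ℝ} {P₀ : Fin n → Plane}
    (hP₀ : P₀ ∈ regularDeployments a b Q W η i)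
    (hcont : ContinuousOn (fun z : Plane × Plane => φ i z.1 z.2) (univ ×ˢ openSquare a b))
    (hdiff : ∀ᵐ q : Plane, ContDiffOn ℝ 1 (φ i q) (openSquare a b))
    (hint : ∀ x ∈ openSquare a b, Integrable (fun q => φ i q x))
    (hint' : Integrable (fun q => fderiv ℝ (φ i q) (P₀ i)))
    (hdom : ∃ ε > 0, ∃ g : Plane → ℝ, IntegrableOn g (Q ∩ W) ∧
      ∀ᵐ q ∂(volume.restrict (Q ∩ W)), ∀ x ∈ openSquare a b ∩ Metric.ball (P₀ i) ε,
        ‖fderiv ℝ (φ i q) x‖ ≤ g q) :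
    HasFDerivAt (cellIntegral Q W η φ i)
      (interiorTerm η i (interior (Q ∩ W)) (φ i) P₀ +
        ∑ j, interfaceTerm η i (interior (Q ∩ W)) (φ i) j P₀) P₀ := by
  obtain ⟨hsq, hinj, hreg⟩ := hP₀
  obtain ⟨C, hC⟩ := exists_eventually_bound hcont (hsq i) M
  have h1 := hasFDerivAt_integral_cell_moving_integrand hη (K := Q ∩ W) hinj (hsq i) hcont hdiff
    hint' hdom
  have h2 := hasFDerivAt_integral_cell_fixed hη hM hinj hreg
    (continuous_of_continuousOn_openSquare hcont (hsq i)) hC.self_of_nhds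
  -- The splitting `φ(q, P i) = (φ(q, P i) - φ(q, P₀ i)) + φ(q, P₀ i)`, with the moving indicators
  -- in front of both terms.
  refine (h1.fun_add h2).congr_of_eventuallyEq ?_
  filter_upwards [eventually_apply_mem_openSquare (hsq i)] with P hP
  have hprod : ∀ x ∈ openSquare a b, Integrable (fun q => (∏ k, costInd η i k P q) * φ i q x)
      (volume.restrict (interior (Q ∩ W))) := fun x hx =>
    (hint x hx).restrict.bdd_mul (c := 1) (measurable_prod_costInd _ P).aestronglyMeasurable
      (ae_of_all _ fun q => by
        have h := prod_costInd_mem_Icc (η := η) (i := i) Finset.univ P q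
        rw [Real.norm_of_nonneg h.1]; exact h.2)
  rw [cellIntegral, setIntegral_cell hK]
  simp only [mul_sub, smul_eq_mul]
  rw [integral_sub (hprod _ hP) (hprod _ (hsq i)), sub_add_cancel]

/-- Dominated convergence: at almost every `q` the indicators are locally constant in the deployment
and the derivative of `f q` is continuous. -/
theorem continuousAt_interiorTerm (hη : ∀ k, 0 < η k) {K : Set Plane}
    {P₀ : Fin n → Plane} (hP₀ : Function.Injective P₀)
    {f : Plane → Plane → ℝ} {a b : ℝ} (hi : P₀ i ∈ openSquare a b)
    (hdiff : ∀ᵐ q : Plane, ContDiffOn ℝ 1 (f q) (openSquare a b))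
    (hint' : ∀ x ∈ openSquare a b, Integrable (fun q => fderiv ℝ (f q) x))
    (hdom : ∃ ε > 0, ∃ g : Plane → ℝ, IntegrableOn g K ∧
      ∀ᵐ q ∂(volume.restrict K), ∀ x ∈ openSquare a b ∩ Metric.ball (P₀ i) ε,
        ‖fderiv ℝ (f q) x‖ ≤ g q) :
    ContinuousAt (interiorTerm η i (interior K) f) P₀ := by
  obtain ⟨ε, hε, g, hg, hbound⟩ := hdom
  have hproj : ‖(ContinuousLinearMap.proj i : (Fin n → Plane) →L[ℝ] Plane)‖ ≤ 1 :=
    ContinuousLinearMap.opNorm_le_bound _ zero_le_one fun v => by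
      rw [one_mul]; exact norm_le_pi_norm v i
  have hcomp : Continuous fun L : Plane →L[ℝ] ℝ =>
      L.comp (ContinuousLinearMap.proj i : (Fin n → Plane) →L[ℝ] Plane) :=
    ((ContinuousLinearMap.compL ℝ (Fin n → Plane) Plane ℝ).flip
      (ContinuousLinearMap.proj i)).continuous
  refine tendsto_integral_filter_of_dominated_convergence g ?_ ?_
    (hg.mono_set interior_subset) ?_
  · filter_upwards [eventually_apply_mem_openSquare hi] with P hP
    exact ((measurable_prod_costInd _ P).aestronglyMeasurable.smul
      (hcomp.comp_aestronglyMeasurable (hint' _ hP).aestronglyMeasurable)).restrict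
  · filter_upwards [eventually_apply_mem_openSquare hi,
      ((continuous_apply i).tendsto P₀).eventually (Metric.ball_mem_nhds _ hε)] with P hP hPε
    filter_upwards [ae_restrict_of_ae_restrict_of_subset interior_subset hbound] with q hb
    have h1 := prod_costInd_mem_Icc (η := η) (i := i) Finset.univ P q
    have h2 := hb (P i) ⟨hP, hPε⟩
    have h3 := ContinuousLinearMap.opNorm_comp_le (fderiv ℝ (f q) (P i))
      (ContinuousLinearMap.proj i : (Fin n → Plane) →L[ℝ] Plane)
    have h4 : ‖fderiv ℝ (f q) (P i)‖ *
        ‖(ContinuousLinearMap.proj i : (Fin n → Plane) →L[ℝ] Plane)‖ ≤ g q * 1 :=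
      mul_le_mul h2 hproj (norm_nonneg _) ((norm_nonneg _).trans h2)
    rw [norm_smul, Real.norm_of_nonneg h1.1]
    calc _ ≤ 1 * (g q * 1) := mul_le_mul h1.2 (h3.trans h4) (norm_nonneg _) zero_le_one
      _ = g q := by ring
  · filter_upwards [ae_restrict_of_ae hdiff, ae_restrict_of_ae
      (ae_costDiff_ne_zero (i := i) hη hP₀)] with q hq hne
    have h1 : ContinuousAt (fderiv ℝ (f q)) (P₀ i) :=
      (hq.continuousOn_fderiv_of_isOpen (isOpen_openSquare a b) le_rfl).continuousAt
        ((isOpen_openSquare a b).mem_nhds hi)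
    have h2 : ContinuousAt (fun P : Fin n → Plane => fderiv ℝ (f q) (P i)) P₀ :=
      ContinuousAt.comp (f := fun P : Fin n → Plane => P i) h1 (continuous_apply i).continuousAt
    have h3 := (hcomp.continuousAt.comp h2).tendsto.const_smul (∏ k, costInd η i k P₀ q)
    refine h3.congr' ?_
    filter_upwards [eventually_left_prod_costInd_eq (s := Finset.univ)
      fun k _ hk => hne k hk] with P hP
    rw [hP]; rfl

/-- The slope is continuous and nonzero, and the weight is locally constant at almost every point of
the interface at `P₀`. Regularity is used at `P₀` only, not at nearby deployments. -/
theorem continuousAt_interfaceTerm (hη : ∀ k, 0 < η k) {K : Set Plane} {M : ℝ}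
    (hK : ∀ q ∈ interior K, ‖q‖ ≤ M) {P₀ : Fin n → Plane} (hP₀ : Function.Injective P₀)
    (hreg : μH[1] (cellInterface η P₀ i ∩ frontier K) = 0) {f : Plane → Plane → ℝ} {a b : ℝ}
    (hi : P₀ i ∈ openSquare a b)
    (hcont : ContinuousOn (fun z : Plane × Plane => f z.1 z.2) (univ ×ˢ openSquare a b))
    (j : Fin n) : ContinuousAt (interfaceTerm η i (interior K) f j) P₀ := by
  by_cases hj : j = i
  · subst hj
    exact (continuousAt_const (y := 0)).congr (Eventually.of_forall fun P =>
      (interfaceTerm_self _ f P).symm)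
  set O := interior K with hO
  have hij : P₀ i ≠ P₀ j := hP₀.ne (Ne.symm hj)
  obtain ⟨C, hC⟩ := exists_eventually_bound hcont hi M
  have hsupp : ∀ (P : Fin n → Plane) (q : Plane), q ∉ O →
      interfaceWeight η i O {j}ᶜ ∅ P P q = 0 := fun P q hq => by
    simp [interfaceWeight, hq]
  -- the derivative of the cost difference is bounded on `O`
  obtain ⟨D, hD⟩ := ((isCompact_closedBall P₀ 1).prod
    (isCompact_closedBall (0 : Plane) M)).exists_bound_of_continuousOn
    (continuous_costDeriv (η := η) (i := i) (j := j)).continuousOn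
  have hφ : ∀ x, ContinuousAt (fun z : (Fin n → Plane) × Plane => f z.2 (z.1 i)) (P₀, x) := by
    intro x
    have h1 : ContinuousAt (fun z : Plane × Plane => f z.1 z.2) (x, P₀ i) :=
      hcont.continuousAt ((isOpen_univ.prod (isOpen_openSquare a b)).mem_nhds ⟨mem_univ _, hi⟩)
    exact ContinuousAt.comp (g := fun z : Plane × Plane => f z.1 z.2) (x := (P₀, x))
      (f := fun z : (Fin n → Plane) × Plane => (z.2, z.1 i)) h1
      (by fun_prop : Continuous fun z : (Fin n → Plane) × Plane => (z.2, z.1 i)).continuousAt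
  refine (continuous_costSlope.continuousAt.inv₀ (costSlope_pos hη hij).ne').smul ?_
  refine continuousAt_integral_interface hη hij (C := max (C * D) 0) (M := M) ?_ ?_ ?_ ?_
  · filter_upwards [eventually_apply_mem_openSquare hi] with P hP
    exact ((measurable_interfaceWeight isOpen_interior _ _ P P).mul
      (continuous_of_continuousOn_openSquare hcont hP).measurable).stronglyMeasurable.smul
      (continuous_costDeriv.comp ((continuous_const (y := P)).prodMk
        continuous_id)).stronglyMeasurable
  · filter_upwards [hC, Metric.closedBall_mem_nhds P₀ one_pos] with P hP hP1 q
    by_cases hq : q ∈ O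
    · have hqM := hK q hq
      have h1 := interfaceWeight_mem_Icc (η := η) (i := i) O {j}ᶜ ∅ P P q
      have h2 := hP q hqM
      have h3 := hD (P, q) ⟨hP1, by rwa [mem_closedBall_zero_iff]⟩
      refine le_max_of_le_left ?_
      rw [norm_smul, norm_mul, Real.norm_of_nonneg h1.1]
      refine mul_le_mul ?_ h3 (norm_nonneg _) ((abs_nonneg _).trans h2)
      rw [← one_mul C]
      exact mul_le_mul h1.2 h2 (norm_nonneg _) zero_le_one
    · rw [hsupp P q hq, zero_mul, zero_smul, norm_zero]
      exact le_max_right _ _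
  · refine Eventually.of_forall fun P q hq => hK q (by_contra fun hqO => hq ?_)
    rw [hsupp P q hqO, zero_mul, zero_smul]
  · filter_upwards [ae_interface_regular hη hP₀ hreg hj, ae_restrict_mem
      (isClosed_costDiff_eq_zero P₀).measurableSet] with x hx hxj
    have hxj' : costDiff η i j P₀ x = 0 := hxj
    -- the weight with both deployments moving is the one with an empty second family
    have hw : ∀ P q, interfaceWeight η i O {j}ᶜ ∅ P P q =
        interfaceWeight η i O {j}ᶜ ∅ P₀ P q := fun P q => by simp [interfaceWeight]
    simp only [hw, mul_smul]
    refine tendsto_interfaceWeight_mul (ψ := fun z : (Fin n → Plane) × Plane =>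
      f z.2 (z.1 i) • costDeriv η i j z.1 z.2) ?_
      ((hφ x).smul continuous_costDeriv.continuousAt)
    rcases hx with ⟨k, hk⟩ | ⟨hxK, hne⟩
    · refine Or.inl ⟨k, ?_, hk⟩
      simp only [Finset.union_empty, Finset.mem_compl, Finset.mem_singleton]
      rintro rfl; linarith
    · refine Or.inr ⟨fun h => hxK (frontier_interior_subset h), fun k hk hki => hne k hki ?_⟩
      simpa using hk

end

/-! ### Local form of the cell at its boundary, and velocities of boundary points -/

noncomputable section

variable {n : ℕ} {η : Fin n → ℝ} {i : Fin n}

/-- The region of `K` where sensor `i` has the least cost. -/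
def leastCostRegion (η : Fin n → ℝ) (i : Fin n) (K : Set Plane) (P : Fin n → Plane) :
    Set Plane := K ∩ {q | ∀ k, 0 ≤ costDiff η i k P q}

/-- The points in the interior of `K` where the sensor `i` has the least cost and shares it with
sensor `j` only. -/
def interfaceInterior (η : Fin n → ℝ) (i j : Fin n) (K : Set Plane) (P : Fin n → Plane) :
    Set Plane :=
  {x | x ∈ interior K ∧ costDiff η i j P x = 0 ∧
    ∀ k, k ≠ i → k ≠ j → 0 < costDiff η i k P x}

theorem measurableSet_interfaceInterior (j : Fin n) (K : Set Plane) (P : Fin n → Plane) :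
    MeasurableSet (interfaceInterior η i j K P) := by
  have : interfaceInterior η i j K P = interior K ∩ ({x | costDiff η i j P x = 0} ∩
      ⋂ k, ⋂ (_ : k ≠ i), ⋂ (_ : k ≠ j), {x | 0 < costDiff η i k P x}) := by
    ext x; simp [interfaceInterior]; tauto
  rw [this]
  exact isOpen_interior.measurableSet.inter ((isClosed_costDiff_eq_zero P).measurableSet.inter
    (MeasurableSet.iInter fun k => MeasurableSet.iInter fun _ => MeasurableSet.iInter fun _ =>
      (isOpen_lt continuous_const (continuous_costDiff_right P)).measurableSet))

theorem eventually_costDiff_pos {k : Fin n} {P : Fin n → Plane} {x : Plane}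
    (h : 0 < costDiff η i k P x) :
    ∀ᶠ z : (Fin n → Plane) × Plane in 𝓝 (P, x), 0 < costDiff η i k z.1 z.2 :=
  (continuous_costDiff.tendsto (P, x)).eventually_const_lt h

theorem eventually_mem_leastCostRegion_iff {K : Set Plane} {P : Fin n → Plane} {x : Plane}
    (h : ∀ k, k ≠ i → 0 < costDiff η i k P x) :
    ∀ᶠ z : (Fin n → Plane) × Plane in 𝓝 (P, x), (z.2 ∈ leastCostRegion η i K z.1 ↔ z.2 ∈ K) := by
  have h1 : ∀ᶠ z : (Fin n → Plane) × Plane in 𝓝 (P, x), ∀ k, k ≠ i →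
      0 < costDiff η i k z.1 z.2 := by
    rw [eventually_all]; intro k
    by_cases hk : k = i
    · exact Eventually.of_forall fun z h => absurd hk h
    · filter_upwards [eventually_costDiff_pos (h k hk)] with z hz _
      exact hz
  filter_upwards [h1] with z hz
  refine ⟨fun h => h.1, fun h => ⟨h, fun k => ?_⟩⟩
  by_cases hk : k = i
  · subst hk; exact (costDiff_self _ _).ge
  · exact (hz k hk).le

/-- Strict inequalities persist near `x` and near `P` together, so only the constraint from `j`
remains. The uniformity in the deployment is what makes moving boundary points tractable. -/
theorem eventually_mem_leastCostRegion_iff_costDiff {K : Set Plane} {P : Fin n → Plane}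
    {x : Plane} {j : Fin n} (h : x ∈ interfaceInterior η i j K P) :
    ∀ᶠ z : (Fin n → Plane) × Plane in 𝓝 (P, x),
      (z.2 ∈ leastCostRegion η i K z.1 ↔ 0 ≤ costDiff η i j z.1 z.2) := by
  have h1 : ∀ᶠ z : (Fin n → Plane) × Plane in 𝓝 (P, x), ∀ k, k ≠ i → k ≠ j →
      0 < costDiff η i k z.1 z.2 := by
    rw [eventually_all]; intro k
    by_cases hk : k = i
    · exact Eventually.of_forall fun z h => absurd hk h
    by_cases hkj : k = j
    · exact Eventually.of_forall fun z _ h => absurd hkj h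
    · filter_upwards [eventually_costDiff_pos (h.2.2 k hk hkj)] with z hz _ _
      exact hz
  have h2 : ∀ᶠ z : (Fin n → Plane) × Plane in 𝓝 (P, x), z.2 ∈ K :=
    (continuous_snd.tendsto (P, x)).eventually (mem_interior_iff_mem_nhds.1 h.1)
  filter_upwards [h1, h2] with z hz hzK
  refine ⟨fun h => h.2 j, fun h => ⟨hzK, fun k => ?_⟩⟩
  by_cases hk : k = i
  · subst hk; exact (costDiff_self _ _).ge
  by_cases hkj : k = j
  · subst hkj; exact h
  · exact (hz k hk hkj).le

theorem tendsto_deployment_point (P : Fin n → Plane) (x : Plane) :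
    Tendsto (fun y : Plane => (P, y)) (𝓝 x) (𝓝 (P, x)) :=
  Continuous.tendsto (by fun_prop) x

/-- The exceptions are triple points and points where an interface runs along the frontier of `K`;
both have length zero. -/
theorem ae_mem_frontier_leastCostRegion (hη : ∀ k, 0 < η k) {K : Set Plane}
    {P : Fin n → Plane} (hP : Function.Injective P)
    (hreg : μH[1] (cellInterface η P i ∩ frontier K) = 0) :
    ∀ᵐ x ∂(μH[1] : Measure Plane), x ∈ frontier (leastCostRegion η i K P) →
      (x ∈ frontier K ∧ ∀ k, k ≠ i → 0 < costDiff η i k P x) ∨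
        ∃ j, j ≠ i ∧ x ∈ interfaceInterior η i j K P := by
  have h1 : ∀ᵐ x ∂(μH[1] : Measure Plane), ∀ j, j ≠ i → costDiff η i j P x = 0 →
      (∃ k, costDiff η i k P x < 0) ∨
        (x ∉ frontier K ∧ ∀ k, k ≠ i → k ≠ j → costDiff η i k P x ≠ 0) := by
    rw [ae_all_iff]; intro j
    by_cases hj : j = i
    · exact ae_of_all _ fun x h => absurd hj h
    · filter_upwards [(ae_restrict_iff' (isClosed_costDiff_eq_zero P).measurableSet).1
        (ae_interface_regular hη hP hreg hj)] with x hx _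
      exact hx
  filter_upwards [h1] with x hx hxf
  have hnn : ∀ k, 0 ≤ costDiff η i k P x := fun k => by
    have h2 : x ∈ closure {q | ∀ k, 0 ≤ costDiff η i k P q} :=
      closure_mono inter_subset_right hxf.1
    rw [(isClosed_forall_costDiff_nonneg P).closure_eq] at h2
    exact h2 k
  have hxK : x ∈ closure K := closure_mono inter_subset_left hxf.1
  by_cases hall : ∀ k, k ≠ i → 0 < costDiff η i k P x
  · refine Or.inl ⟨?_, hall⟩
    have := (tendsto_deployment_point P x).eventually
      (eventually_mem_leastCostRegion_iff (K := K) hall)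
    exact (mem_frontier_congr_nhds this).1 hxf
  · push Not at hall
    obtain ⟨j, hj, hjx⟩ := hall
    have hj0 : costDiff η i j P x = 0 := le_antisymm hjx (hnn j)
    rcases hx j hj hj0 with ⟨k, hk⟩ | ⟨hK, hne⟩
    · exact absurd (hnn k) (not_le.2 hk)
    · exact Or.inr ⟨j, hj, by_contra fun hc => hK ⟨hxK, hc⟩, hj0,
        fun k hki hkj => (hnn k).lt_of_ne' (hne k hki hkj)⟩

/-- At an interior point of the set, `h` would have a local minimum, and its gradient would vanish.
-/
theorem mem_frontier_of_hasFDerivAt {h : Plane → ℝ} {g x : Plane}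
    (hd : HasFDerivAt h (innerSL ℝ g) x) (h0 : h x = 0) (hg : g ≠ 0) :
    x ∈ frontier {y | 0 ≤ h y} := by
  refine ⟨subset_closure h0.ge, fun hint => hg ?_⟩
  have hmin : IsLocalMin h x := by
    filter_upwards [mem_interior_iff_mem_nhds.1 hint] with y hy
    rw [h0]; exact hy
  have h1 := congrArg (fun f : Plane →L[ℝ] ℝ => f g) (hmin.hasFDerivAt_eq_zero hd)
  rwa [innerSL_apply_apply, zero_apply, inner_self_eq_zero] at h1

theorem interfaceInterior_subset_frontier (hη : ∀ k, 0 < η k) {K : Set Plane}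
    {P : Fin n → Plane} {j : Fin n} (hP : P i ≠ P j) :
    interfaceInterior η i j K P ⊆ frontier (leastCostRegion η i K P) := by
  intro x hx
  rw [mem_frontier_congr_nhds ((tendsto_deployment_point P x).eventually
    (eventually_mem_leastCostRegion_iff_costDiff hx))]
  exact mem_frontier_of_hasFDerivAt (h := costDiff η i j P) (hasFDerivAt_costDiff_right P x)
    hx.2.1 (costGrad_ne_zero hη hP hx.2.1)

theorem isOutwardNormal_of_mem_interfaceInterior (hη : ∀ k, 0 < η k) {K : Set Plane}
    {P : Fin n → Plane} {j : Fin n} (hP : P i ≠ P j) {x : Plane}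
    (hx : x ∈ interfaceInterior η i j K P) :
    IsOutwardNormal (leastCostRegion η i K P) x
      (-((costSlope η i j P)⁻¹ • costGrad η i j P x)) := by
  have := isOutwardNormal_of_hasFDerivAt (hasFDerivAt_costDiff_right P x) hx.2.1
    (costGrad_ne_zero hη hP hx.2.1) ((tendsto_deployment_point P x).eventually
    (eventually_mem_leastCostRegion_iff_costDiff hx))
  rwa [norm_costGrad hη hx.2.1] at this

/-- The inclusion of the positions of sensor `l` in the deployments. -/
def positionInclusion (n : ℕ) (l : Fin n) : Plane →L[ℝ] (Fin n → Plane) :=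
  ContinuousLinearMap.pi (Pi.single l (ContinuousLinearMap.id ℝ Plane))

theorem hasFDerivAt_update_position (P : Fin n → Plane) (l : Fin n) (p : Plane) :
    HasFDerivAt (Function.update P l) (positionInclusion n l) p :=
  hasFDerivAt_update P p

theorem tendsto_update_position (P : Fin n → Plane) (l : Fin n) :
    Tendsto (Function.update P l) (𝓝 (P l)) (𝓝 P) := by
  have := (hasFDerivAt_update_position P l (P l)).continuousAt.tendsto
  rwa [Function.update_eq_self] at this

/-- Near such a point the region is `K` for all nearby deployments, so the constant map stays on the
boundary. -/
theorem isBoundaryVelocity_zero {K : Set Plane} {P : Fin n → Plane} {x : Plane} (l : Fin n)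
    (hx : x ∈ frontier K) (h : ∀ k, k ≠ i → 0 < costDiff η i k P x) :
    IsBoundaryVelocity (fun p => leastCostRegion η i K (Function.update P l p)) (P l) x 0 := by
  refine ⟨fun _ => x, rfl, ?_, hasFDerivAt_const x _⟩
  have h1 := ((tendsto_update_position P l).prodMk_nhds (tendsto_const_nhds (x := x))).eventually
    (eventually_mem_leastCostRegion_iff (K := K) h).eventually_nhds
  filter_upwards [h1] with p' hp'
  exact (mem_frontier_congr_nhds ((tendsto_deployment_point _ x).eventually hp')).2 hx

/-- The boundary point is moved along the gradient `g` by an amount `ψ P'` which the implicit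
function theorem provides. -/
theorem exists_isBoundaryVelocity (hη : ∀ k, 0 < η k) {K : Set Plane}
    {P : Fin n → Plane} {j : Fin n} (hP : P i ≠ P j) {x : Plane}
    (hx : x ∈ interfaceInterior η i j K P) (l : Fin n) :
    ∃ L, IsBoundaryVelocity (fun p => leastCostRegion η i K (Function.update P l p))
      (P l) x L := by
  have hgx := costGrad_ne_zero hη hP hx.2.1
  set g := costGrad η i j P x with hg
  have hA : HasStrictFDerivAt (fun u : (Fin n → Plane) × ℝ => (u.1, x + u.2 • g))
      ((ContinuousLinearMap.fst ℝ (Fin n → Plane) ℝ).prod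
        ((ContinuousLinearMap.snd ℝ (Fin n → Plane) ℝ).smulRight g)) (P, 0) := by
    refine hasStrictFDerivAt_fst.prodMk ?_
    exact ((ContinuousLinearMap.snd ℝ (Fin n → Plane) ℝ).smulRight
      g).hasStrictFDerivAt.const_add x
  have hB : HasStrictFDerivAt (fun z : (Fin n → Plane) × Plane => costDiff η i j z.1 z.2)
      ((costDeriv η i j P x).comp (ContinuousLinearMap.fst ℝ _ _) +
        (innerSL ℝ g).comp (ContinuousLinearMap.snd ℝ _ _)) (P, x + (0 : ℝ) • g) := by
    rw [zero_smul, add_zero]; exact hasStrictFDerivAt_costDiff P x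
  have hf := HasStrictFDerivAt.comp (P, (0 : ℝ)) (f := fun u : (Fin n → Plane) × ℝ =>
    (u.1, x + u.2 • g)) hB hA
  have hg2 : ‖g‖ ^ 2 ≠ 0 := pow_ne_zero 2 (norm_ne_zero_iff.2 hgx)
  obtain ⟨ψ, hψ, hψ0, hψd⟩ : ∃ ψ : (Fin n → Plane) → ℝ,
      (∀ᶠ P' in 𝓝 P, costDiff η i j P' (x + ψ P' • g) = 0) ∧ ψ P = 0 ∧
      DifferentiableAt ℝ ψ P := by
    -- The derivative in the scalar variable is multiplication by `‖g‖²`.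
    have hinv : ((((costDeriv η i j P x).comp (ContinuousLinearMap.fst ℝ _ _) +
        (innerSL ℝ g).comp (ContinuousLinearMap.snd ℝ _ _)).comp
        ((ContinuousLinearMap.fst ℝ (Fin n → Plane) ℝ).prod
        ((ContinuousLinearMap.snd ℝ (Fin n → Plane) ℝ).smulRight g))).comp
        (ContinuousLinearMap.inr ℝ (Fin n → Plane) ℝ)).IsInvertible := by
      refine ⟨ContinuousLinearEquiv.unitsEquivAut ℝ (Units.mk0 _ hg2), ?_⟩
      ext
      simp
    refine ⟨hf.implicitFunctionOfProdDomain hinv, ?_, ?_, ?_⟩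
    · filter_upwards [hf.eventually_apply_implicitFunctionOfProdDomain hinv] with P' hP'
      have h0 : costDiff η i j P (x + (0 : ℝ) • g) = 0 := by
        rw [zero_smul, add_zero]; exact hx.2.1
      exact hP'.trans h0
    · exact (hf.eventually_apply_eq_iff_implicitFunctionOfProdDomain hinv).self_of_nhds.1 rfl
    · exact (hf.hasStrictFDerivAt_implicitFunctionOfProdDomain hinv).hasFDerivAt.differentiableAt
  have hup := tendsto_update_position P l
  have hγd : DifferentiableAt ℝ (fun p => x + ψ (Function.update P l p) • g) (P l) := by
    have h1 : DifferentiableAt ℝ (fun p => ψ (Function.update P l p)) (P l) :=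
      DifferentiableAt.comp (P l) (by rwa [Function.update_eq_self])
        (hasFDerivAt_update_position P l (P l)).differentiableAt
    exact (h1.smul_const g).const_add x
  have hγ0 : x + ψ (Function.update P l (P l)) • g = x := by
    rw [Function.update_eq_self, hψ0, zero_smul, add_zero]
  refine ⟨_, _, hγ0, ?_, hγd.hasFDerivAt⟩
  have hγt : Tendsto (fun p => x + ψ (Function.update P l p) • g) (𝓝 (P l)) (𝓝 x) := by
    have := hγd.continuousAt.tendsto
    rwa [hγ0] at this
  have hev1 := (hup.prodMk_nhds hγt).eventually
    (eventually_mem_leastCostRegion_iff_costDiff hx).eventually_nhds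
  have hev2 : ∀ᶠ P' : Fin n → Plane in 𝓝 P, P' i ≠ P' j :=
    (isOpen_ne_fun (continuous_apply i) (continuous_apply j)).mem_nhds hP
  filter_upwards [hev1, hup.eventually hψ, hup.eventually hev2] with p h1 h2 h3
  rw [mem_frontier_congr_nhds ((tendsto_deployment_point _ _).eventually h1)]
  exact mem_frontier_of_hasFDerivAt (h := costDiff η i j (Function.update P l p))
    (hasFDerivAt_costDiff_right _ _) h2 (costGrad_ne_zero hη h3 h2)

/-- Only `K` bounds the region near `x`, and `K` does not move, so `γ` runs in the frontier of `K`
and its velocity is tangential. -/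
theorem IsBoundaryVelocity.innerSL_comp_eq_zero {K : Set Plane} {P : Fin n → Plane}
    {x ν : Plane} {l : Fin n} {L : Plane →L[ℝ] Plane}
    (hL : IsBoundaryVelocity (fun p => leastCostRegion η i K (Function.update P l p)) (P l) x L)
    (h : ∀ k, k ≠ i → 0 < costDiff η i k P x)
    (hν : IsOutwardNormal (leastCostRegion η i K P) x ν) : (innerSL ℝ ν).comp L = 0 := by
  obtain ⟨γ, hγx, hγ, hγd⟩ := hL
  have hev := eventually_mem_leastCostRegion_iff (K := K) h
  have hνK := hν.congr_nhds ((tendsto_deployment_point P x).eventually hev)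
  refine hνK.innerSL_comp_eq_zero hγx ?_ hγd
  have hγt : Tendsto γ (𝓝 (P l)) (𝓝 x) := hγx ▸ hγd.continuousAt.tendsto
  filter_upwards [hγ, ((tendsto_update_position P l).prodMk_nhds hγt).eventually
    hev.eventually_nhds] with p h1 h2
  exact (mem_frontier_congr_nhds ((tendsto_deployment_point _ _).eventually h2)).1 h1

/-- Differentiating `costDiff (P', γ p') = 0` at `p' = P l` determines the normal component of the
velocity. This is why the formula does not depend on the choice of `γ`. -/
theorem IsBoundaryVelocity.innerSL_comp_eq {K : Set Plane} {P : Fin n → Plane}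
    {x : Plane} {j l : Fin n} {L : Plane →L[ℝ] Plane}
    (hL : IsBoundaryVelocity (fun p => leastCostRegion η i K (Function.update P l p)) (P l) x L)
    (hx : x ∈ interfaceInterior η i j K P) :
    (innerSL ℝ (-((costSlope η i j P)⁻¹ • costGrad η i j P x))).comp L =
      (costSlope η i j P)⁻¹ • (costDeriv η i j P x).comp (positionInclusion n l) := by
  obtain ⟨γ, hγx, hγ, hγd⟩ := hL
  have hev := eventually_mem_leastCostRegion_iff_costDiff hx
  have hγt : Tendsto γ (𝓝 (P l)) (𝓝 x) := hγx ▸ hγd.continuousAt.tendsto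
  have hzero : ∀ᶠ p in 𝓝 (P l), costDiff η i j (Function.update P l p) (γ p) = 0 := by
    filter_upwards [hγ, ((tendsto_update_position P l).prodMk_nhds hγt).eventually
      hev.eventually_nhds] with p h1 h2
    have h3 := (mem_frontier_congr_nhds (S' := {y | 0 ≤ costDiff η i j (Function.update P l p) y})
      ((tendsto_deployment_point _ _).eventually h2)).1 h1
    exact (frontier_le_subset_eq continuous_const (continuous_costDiff_right _) h3).symm
  have h1 : HasFDerivAt (fun p => (Function.update P l p, γ p))
      ((positionInclusion n l).prod L) (P l) :=
    (hasFDerivAt_update_position P l (P l)).prodMk hγd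
  have h2 : HasFDerivAt (fun z : (Fin n → Plane) × Plane => costDiff η i j z.1 z.2)
      ((costDeriv η i j P x).comp (ContinuousLinearMap.fst ℝ _ _) +
        (innerSL ℝ (costGrad η i j P x)).comp (ContinuousLinearMap.snd ℝ _ _))
      (Function.update P l (P l), γ (P l)) := by
    rw [Function.update_eq_self, hγx]; exact (hasStrictFDerivAt_costDiff P x).hasFDerivAt
  have h2' := HasFDerivAt.comp (P l)
    (g := fun z : (Fin n → Plane) × Plane => costDiff η i j z.1 z.2)
    (f := fun p => (Function.update P l p, γ p)) h2 h1
  have h3 := h2'.unique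
    ((hasFDerivAt_const (0 : ℝ) (P l)).congr_of_eventuallyEq hzero)
  ext v
  have h4 := congrArg (fun f : Plane →L[ℝ] ℝ => f v) h3
  simp only [ContinuousLinearMap.comp_apply, add_apply, ContinuousLinearMap.prod_apply,
    ContinuousLinearMap.coe_fst', ContinuousLinearMap.coe_snd', innerSL_apply_apply,
    zero_apply] at h4
  simp only [ContinuousLinearMap.comp_apply, innerSL_apply_apply, smul_apply, smul_eq_mul,
    inner_neg_left, real_inner_smul_left]
  linear_combination (-(costSlope η i j P)⁻¹) * h4

end

/-! ### The boundary integral and the conclusion -/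

noncomputable section

variable {n : ℕ} {η : Fin n → ℝ} {i : Fin n}

/-- The density on the interface with sensor `j` of the derivative of the integral of `f` over the
cell of sensor `i`. -/
def interfaceDensity (η : Fin n → ℝ) (i : Fin n) (f : Plane → Plane → ℝ) (j : Fin n)
    (P : Fin n → Plane) (x : Plane) : (Fin n → Plane) →L[ℝ] ℝ :=
  (costSlope η i j P)⁻¹ • f x (P i) • costDeriv η i j P x

theorem integrableOn_interfaceDensity (hη : ∀ k, 0 < η k) {K : Set Plane} {M : ℝ}
    (hK : ∀ q ∈ interior K, ‖q‖ ≤ M) {P : Fin n → Plane} {j : Fin n} (hP : P i ≠ P j)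
    {f : Plane → Plane → ℝ} (hf : Continuous fun q => f q (P i)) :
    IntegrableOn (interfaceDensity η i f j P) (interfaceInterior η i j K P) μH[1] := by
  have hc : Continuous (interfaceDensity η i f j P) :=
    (hf.smul (continuous_costDeriv.comp ((continuous_const (y := P)).prodMk
      continuous_id))).const_smul (costSlope η i j P)⁻¹
  have hsub : interfaceInterior η i j K P ⊆
      {q | costDiff η i j P q = 0} ∩ Metric.closedBall 0 M := fun x hx =>
    ⟨hx.2.1, mem_closedBall_zero_iff.2 (hK x hx.1)⟩
  obtain ⟨C, hC⟩ := (isCompact_closedBall (0 : Plane) M).exists_bound_of_continuousOn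
    hc.continuousOn
  refine Measure.integrableOn_of_bounded (M := C) ?_ hc.aestronglyMeasurable ?_
  · exact ((measure_mono hsub).trans_lt
      (hausdorffMeasure_interface_inter_closedBall_lt_top hη hP M)).ne
  · filter_upwards [ae_restrict_mem (measurableSet_interfaceInterior j K P)] with x hx
    exact hC x (hsub hx).2

/-- On the interface with `j`, the weight agrees almost everywhere with the indicator of
`interfaceInterior`. -/
theorem interfaceTerm_eq (hη : ∀ k, 0 < η k) {K : Set Plane}
    {P : Fin n → Plane} (hP : Function.Injective P)
    (hreg : μH[1] (cellInterface η P i ∩ frontier K) = 0) {f : Plane → Plane → ℝ}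
    {j : Fin n} (hj : j ≠ i) :
    interfaceTerm η i (interior K) f j P =
      ∫ x in interfaceInterior η i j K P, interfaceDensity η i f j P x ∂μH[1] := by
  have hsub : interfaceInterior η i j K P ⊆ {q | costDiff η i j P q = 0} := fun x hx => hx.2.1
  rw [interfaceTerm, ← integral_smul, ← inter_eq_self_of_subset_right hsub,
    ← setIntegral_indicator (measurableSet_interfaceInterior j K P)]
  refine integral_congr_ae ?_
  filter_upwards [ae_interface_regular hη hP hreg hj, ae_restrict_mem
    (isClosed_costDiff_eq_zero P).measurableSet] with x hx hxj
  have hxj' : costDiff η i j P x = 0 := hxj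
  by_cases hmem : x ∈ interfaceInterior η i j K P
  · have hw : interfaceWeight η i (interior K) {j}ᶜ ∅ P P x = 1 := by
      rw [interfaceWeight, indicator_of_mem hmem.1, prod_costInd_of_nonneg, Finset.prod_empty]
      · simp
      · intro k hk
        have hkj : k ≠ j := by simpa using hk
        by_cases hki : k = i
        · subst hki; exact (costDiff_self P x).ge
        · exact (hmem.2.2 k hki hkj).le
    rw [indicator_of_mem hmem, hw, one_mul, interfaceDensity]
  · have hw : interfaceWeight η i (interior K) {j}ᶜ ∅ P P x = 0 := by
      by_cases hneg : ∃ k, costDiff η i k P x < 0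
      · obtain ⟨k, hk⟩ := hneg
        rw [interfaceWeight, prod_costInd_of_neg (s := {j}ᶜ) ⟨k, ?_, hk⟩]
        · simp
        · rw [Finset.mem_compl, Finset.mem_singleton]
          rintro rfl; linarith
      · have hne := (hx.resolve_left hneg).2
        push Not at hneg
        have hxO : x ∉ interior K := fun h => hmem ⟨h, hxj', fun k hki hkj =>
          (hneg k).lt_of_ne' (hne k hki hkj)⟩
        simp [interfaceWeight, hxO]
    rw [indicator_of_notMem hmem, hw, zero_mul, zero_smul, smul_zero]

/-- Composition with the inclusion of the positions of sensor `l`. -/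
def compPositionInclusion (n : ℕ) (l : Fin n) :
    ((Fin n → Plane) →L[ℝ] ℝ) →L[ℝ] (Plane →L[ℝ] ℝ) :=
  (ContinuousLinearMap.compL ℝ Plane (Fin n → Plane) ℝ).flip (positionInclusion n l)

theorem compPositionInclusion_apply (l : Fin n) (D : (Fin n → Plane) →L[ℝ] ℝ) :
    compPositionInclusion n l D = D.comp (positionInclusion n l) := rfl

theorem compPositionInclusion_interiorTerm {Q W : Set Plane} (hK : Convex ℝ (Q ∩ W))
    {P : Fin n → Plane} {f : Plane → Plane → ℝ}
    (hint' : Integrable (fun q => fderiv ℝ (f q) (P i))) (l : Fin n) :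
    compPositionInclusion n l (interiorTerm η i (interior (Q ∩ W)) f P) =
      ∫ q in weightedVoronoi Q η P i ∩ W,
        fderiv ℝ (fun p => f q (Function.update P l p i)) (P l) := by
  have hcomp : Integrable (fun q => (fderiv ℝ (f q) (P i)).comp
      (ContinuousLinearMap.proj i : (Fin n → Plane) →L[ℝ] Plane)) :=
    ((ContinuousLinearMap.compL ℝ (Fin n → Plane) Plane ℝ).flip
      (ContinuousLinearMap.proj i)).integrable_comp hint'
  have hi : Integrable (fun q => (∏ k, costInd η i k P q) • (fderiv ℝ (f q) (P i)).comp
      (ContinuousLinearMap.proj i : (Fin n → Plane) →L[ℝ] Plane))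
      (volume.restrict (interior (Q ∩ W))) :=
    hcomp.restrict.bdd_smul (1 : ℝ) (measurable_prod_costInd _ P).aestronglyMeasurable
      (ae_of_all _ fun q => by
        have h := prod_costInd_mem_Icc (η := η) (i := i) Finset.univ P q
        rw [Real.norm_of_nonneg h.1]; exact h.2)
  rw [interiorTerm, ← ContinuousLinearMap.integral_comp_comm _ hi, setIntegral_cell hK]
  congr 1; ext1 q
  rw [map_smul, compPositionInclusion_apply]
  congr 1
  by_cases hl : l = i
  · subst hl
    simp only [Function.update_self]
    ext v; simp [positionInclusion]
  · simp only [Function.update_of_ne (Ne.symm hl), fderiv_fun_const, Pi.zero_apply]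
    ext v; simp [positionInclusion, Pi.single_apply, Ne.symm hl]

/-- Almost every boundary point lies on at most one interface, so at most one summand survives; on
the frontier of `K` both sides vanish. -/
theorem ae_boundary_integrand_eq (hη : ∀ k, 0 < η k) {K : Set Plane}
    {P : Fin n → Plane} (hP : Function.Injective P)
    (hreg : μH[1] (cellInterface η P i ∩ frontier K) = 0) (f : Plane → Plane → ℝ) (l : Fin n)
    {dγ : Plane → Plane →L[ℝ] Plane}
    (hdγ : ∀ᵐ x ∂(μH[1].restrict (frontier (leastCostRegion η i K P))),
      IsBoundaryVelocity (fun p => leastCostRegion η i K (Function.update P l p))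
        (P l) x (dγ x)) :
    ∀ᵐ x ∂(μH[1].restrict (frontier (leastCostRegion η i K P))),
      f x (P i) • (innerSL ℝ (outwardNormal (leastCostRegion η i K P) x)).comp (dγ x) =
        ∑ j ∈ Finset.univ.erase i, (interfaceInterior η i j K P).indicator
          (fun x => compPositionInclusion n l (interfaceDensity η i f j P x)) x := by
  filter_upwards [hdγ, ae_restrict_of_ae (ae_mem_frontier_leastCostRegion hη hP hreg),
    ae_restrict_mem isClosed_frontier.measurableSet] with x hL hcase hx
  rcases hcase hx with ⟨-, hpos⟩ | ⟨j, hj, hxj⟩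
  · rw [Finset.sum_eq_zero]
    · by_cases hex : ∃ ν, IsOutwardNormal (leastCostRegion η i K P) x ν
      · obtain ⟨ν, hν⟩ := hex
        rw [hν.outwardNormal_eq, hL.innerSL_comp_eq_zero hpos hν, smul_zero]
      -- The convention `0` for a missing normal enters here; it covers the case in which `K` has
      -- empty interior.
      · rw [outwardNormal, dif_neg hex, map_zero, ContinuousLinearMap.zero_comp, smul_zero]
    · intro j hj
      refine indicator_of_notMem (fun hmem => ?_) _
      exact (hpos j (Finset.ne_of_mem_erase hj)).ne' hmem.2.1
  · rw [Finset.sum_eq_single j]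
    · rw [indicator_of_mem hxj, (isOutwardNormal_of_mem_interfaceInterior hη (hP.ne hj.symm)
        hxj).outwardNormal_eq, hL.innerSL_comp_eq hxj, compPositionInclusion_apply,
        interfaceDensity]
      ext v
      simp only [smul_apply, ContinuousLinearMap.comp_apply, smul_eq_mul]
      ring
    · intro k hk hkj
      refine indicator_of_notMem (fun hmem => ?_) _
      exact (hxj.2.2 k (Finset.ne_of_mem_erase hk) hkj).ne' hmem.2.1
    · intro h
      exact absurd (Finset.mem_erase.2 ⟨hj, Finset.mem_univ j⟩) h

/-- No measurability of `dγ` is assumed: integrability comes from the almost everywhere equality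
with a sum in which `dγ` no longer occurs. -/
theorem integral_boundary_eq (hη : ∀ k, 0 < η k) {K : Set Plane} {M : ℝ}
    (hK : ∀ q ∈ interior K, ‖q‖ ≤ M) {P : Fin n → Plane} (hP : Function.Injective P)
    (hreg : μH[1] (cellInterface η P i ∩ frontier K) = 0) {f : Plane → Plane → ℝ}
    (hf : Continuous fun q => f q (P i)) (l : Fin n) {dγ : Plane → Plane →L[ℝ] Plane}
    (hdγ : ∀ᵐ x ∂(μH[1].restrict (frontier (leastCostRegion η i K P))),
      IsBoundaryVelocity (fun p => leastCostRegion η i K (Function.update P l p))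
        (P l) x (dγ x)) :
    IntegrableOn (fun x => f x (P i) •
        (innerSL ℝ (outwardNormal (leastCostRegion η i K P) x)).comp (dγ x))
      (frontier (leastCostRegion η i K P)) μH[1] ∧
    ∫ x in frontier (leastCostRegion η i K P), f x (P i) •
        (innerSL ℝ (outwardNormal (leastCostRegion η i K P) x)).comp (dγ x) ∂μH[1] =
      compPositionInclusion n l (∑ j, interfaceTerm η i (interior K) f j P) := by
  have hae := ae_boundary_integrand_eq hη hP hreg f l hdγ
  have hm : ∀ j, MeasurableSet (interfaceInterior η i j K P) := fun j =>
    measurableSet_interfaceInterior j K P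
  have hi : ∀ j ∈ Finset.univ.erase i, IntegrableOn (interfaceDensity η i f j P)
      (interfaceInterior η i j K P) μH[1] := fun j hj =>
    integrableOn_interfaceDensity hη hK (hP.ne (Finset.ne_of_mem_erase hj).symm) hf
  have hi' : ∀ j ∈ Finset.univ.erase i, Integrable ((interfaceInterior η i j K P).indicator
      fun x => compPositionInclusion n l (interfaceDensity η i f j P x))
      (μH[1].restrict (frontier (leastCostRegion η i K P))) := fun j hj =>
    (((integrable_indicator_iff (hm j)).2
      ((compPositionInclusion n l).integrable_comp (hi j hj)))).restrict
  have hterm : ∀ j ∈ Finset.univ.erase i,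
      ∫ x in frontier (leastCostRegion η i K P), (interfaceInterior η i j K P).indicator
        (fun x => compPositionInclusion n l (interfaceDensity η i f j P x)) x ∂μH[1] =
      compPositionInclusion n l (interfaceTerm η i (interior K) f j P) := by
    intro j hj
    have hji := Finset.ne_of_mem_erase hj
    rw [setIntegral_indicator (hm j), inter_eq_self_of_subset_right
      (interfaceInterior_subset_frontier hη (hP.ne hji.symm)), interfaceTerm_eq hη hP hreg hji]
    exact ContinuousLinearMap.integral_comp_comm (compPositionInclusion n l) (hi j hj)
  have hsum := integral_finsetSum (Finset.univ.erase i) hi'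
  have hint : Integrable (fun x => ∑ j ∈ Finset.univ.erase i,
      (interfaceInterior η i j K P).indicator
        (fun x => compPositionInclusion n l (interfaceDensity η i f j P x)) x)
      (μH[1].restrict (frontier (leastCostRegion η i K P))) :=
    integrable_finsetSum (ε' := Plane →L[ℝ] ℝ) _ hi'
  refine ⟨hint.congr (hae.mono fun x hx => hx.symm), ?_⟩
  refine (integral_congr_ae hae).trans (hsum.trans ((Finset.sum_congr rfl hterm).trans ?_))
  rw [← map_sum, ← Finset.add_sum_erase Finset.univ _ (Finset.mem_univ i), interfaceTerm_self,
    zero_add]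

theorem ae_exists_isOutwardNormal_leastCostRegion (hη : ∀ k, 0 < η k) {K : Set Plane}
    (hK : Convex ℝ K) (hne : (interior K).Nonempty) {P : Fin n → Plane}
    (hP : Function.Injective P) (hreg : μH[1] (cellInterface η P i ∩ frontier K) = 0) :
    ∀ᵐ x ∂(μH[1].restrict (frontier (leastCostRegion η i K P))),
      ∃ ν, IsOutwardNormal (leastCostRegion η i K P) x ν := by
  filter_upwards [ae_restrict_of_ae (ae_mem_frontier_leastCostRegion hη hP hreg),
    ae_restrict_of_ae (ae_exists_isOutwardNormal hK hne),
    ae_restrict_mem isClosed_frontier.measurableSet] with x hcase hn hx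
  rcases hcase hx with ⟨hxK, hpos⟩ | ⟨j, hj, hxj⟩
  · obtain ⟨ν, hν⟩ := hn hxK
    refine ⟨ν, hν.congr_nhds ?_⟩
    filter_upwards [(tendsto_deployment_point P x).eventually
      (eventually_mem_leastCostRegion_iff (K := K) hpos)] with y hy
    exact hy.symm
  · exact ⟨_, isOutwardNormal_of_mem_interfaceInterior hη (hP.ne hj.symm) hxj⟩

theorem ae_exists_isBoundaryVelocity (hη : ∀ k, 0 < η k) {K : Set Plane} {P : Fin n → Plane}
    (hP : Function.Injective P) (hreg : μH[1] (cellInterface η P i ∩ frontier K) = 0)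
    (l : Fin n) :
    ∀ᵐ x ∂(μH[1].restrict (frontier (leastCostRegion η i K P))), ∃ L,
      IsBoundaryVelocity (fun p => leastCostRegion η i K (Function.update P l p)) (P l) x L := by
  filter_upwards [ae_restrict_of_ae (ae_mem_frontier_leastCostRegion hη hP hreg),
    ae_restrict_mem isClosed_frontier.measurableSet] with x hcase hx
  rcases hcase hx with ⟨hxK, hpos⟩ | ⟨j, hj, hxj⟩
  · exact ⟨0, isBoundaryVelocity_zero l hxK hpos⟩
  · exact exists_isBoundaryVelocity hη (hP.ne hj.symm) hxj l

theorem IsConvexPolygon.convex {Q : Set Plane} (hQ : IsConvexPolygon Q) : Convex ℝ Q := by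
  obtain ⟨⟨S, rfl⟩, -⟩ := hQ
  exact convex_convexHull ℝ _

theorem IsConvexPolygon.exists_norm_le {Q : Set Plane} (hQ : IsConvexPolygon Q) :
    ∃ M, ∀ q ∈ Q, ‖q‖ ≤ M := by
  obtain ⟨⟨S, rfl⟩, -⟩ := hQ
  exact (isBounded_convexHull.2 S.finite_toSet.isBounded).exists_norm_le

end
theorem proposition2 {n : ℕ} (Q W : Set Plane) (hQ : IsConvexPolygon Q) (hW : Convex ℝ W)
    (η : Fin n → ℝ) (hη : ∀ i, 0 < η i) (a b : ℝ)
    (φ : Fin n → Plane → Plane → ℝ)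
    -- each `φ i` is continuous on `ℝ² × (a, b)²`
    (hcont : ∀ i, ContinuousOn (fun z : Plane × Plane => φ i z.1 z.2) (univ ×ˢ openSquare a b))
    -- for almost all `q` it is continuously differentiable in its second argument
    (hdiff : ∀ i, ∀ᵐ q : Plane, ContDiffOn ℝ 1 (φ i q) (openSquare a b))
    (hint : ∀ i, ∀ x ∈ openSquare a b, Integrable (fun q => φ i q x))
    (hint' : ∀ i, ∀ x ∈ openSquare a b, Integrable (fun q => fderiv ℝ (φ i q) x))
    -- on `Q ∩ W` the derivative is locally dominated by integrable functions
    (hdom : ∀ i, ∀ p ∈ openSquare a b, ∃ ε > 0, ∃ g : Plane → ℝ, IntegrableOn g (Q ∩ W) ∧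
      ∀ᵐ q ∂(volume.restrict (Q ∩ W)), ∀ x ∈ openSquare a b ∩ Metric.ball p ε,
        ‖fderiv ℝ (φ i q) x‖ ≤ g q)
    (i : Fin n) :
    -- continuous differentiability in the sensor positions
    (∀ P ∈ regularDeployments a b Q W η i, DifferentiableAt ℝ (cellIntegral Q W η φ i) P) ∧
    ContinuousOn (fderiv ℝ (cellIntegral Q W η φ i)) (regularDeployments a b Q W η i) ∧
    -- the formula for the partial derivatives
    ∀ P ∈ regularDeployments a b Q W η i,
      -- the unit outward normal exists almost everywhere on the boundary
      ((interior (Q ∩ W)).Nonempty →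
        ∀ᵐ x ∂(μH[1].restrict (frontier (weightedVoronoi Q η P i ∩ W))),
          ∃ ν, IsOutwardNormal (weightedVoronoi Q η P i ∩ W) x ν) ∧
      ∀ j : Fin n,
        -- so does a derivative of the moving boundary point with respect to `p_j`
        (∀ᵐ x ∂(μH[1].restrict (frontier (weightedVoronoi Q η P i ∩ W))), ∃ L,
          IsBoundaryVelocity (fun p => weightedVoronoi Q η (Function.update P j p) i ∩ W)
            (P j) x L) ∧
        -- and, for every choice of it, the formula holds
        ∀ dγ : Plane → Plane →L[ℝ] Plane,
          (∀ᵐ x ∂(μH[1].restrict (frontier (weightedVoronoi Q η P i ∩ W))),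
            IsBoundaryVelocity (fun p => weightedVoronoi Q η (Function.update P j p) i ∩ W)
              (P j) x (dγ x)) →
          IntegrableOn (fun x => φ i x (P i) •
              (innerSL ℝ (outwardNormal (weightedVoronoi Q η P i ∩ W) x)).comp (dγ x))
            (frontier (weightedVoronoi Q η P i ∩ W)) μH[1] ∧
          HasFDerivAt (fun p => cellIntegral Q W η φ i (Function.update P j p))
            ((∫ q in weightedVoronoi Q η P i ∩ W,
                fderiv ℝ (fun p => φ i q (Function.update P j p i)) (P j)) +
              ∫ x in frontier (weightedVoronoi Q η P i ∩ W), φ i x (P i) •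
                (innerSL ℝ (outwardNormal (weightedVoronoi Q η P i ∩ W) x)).comp (dγ x) ∂μH[1])
            (P j) := by
  obtain ⟨M, hM⟩ := hQ.exists_norm_le
  have hK : Convex ℝ (Q ∩ W) := hQ.convex.inter hW
  have hMO : ∀ q ∈ interior (Q ∩ W), ‖q‖ ≤ M := fun q hq => hM q (interior_subset hq).1
  have hcell : ∀ P, weightedVoronoi Q η P i ∩ W = leastCostRegion η i (Q ∩ W) P := fun P =>
    weightedVoronoi_inter_eq Q W P
  have hderiv : ∀ P ∈ regularDeployments a b Q W η i, HasFDerivAt (cellIntegral Q W η φ i)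
      (interiorTerm η i (interior (Q ∩ W)) (φ i) P +
        ∑ j, interfaceTerm η i (interior (Q ∩ W)) (φ i) j P) P := fun P hP =>
    hasFDerivAt_cellIntegral hη hK hMO hP (hcont i) (hdiff i) (hint i) (hint' i _ (hP.1 i))
      (hdom i _ (hP.1 i))
  refine ⟨fun P hP => (hderiv P hP).differentiableAt, ?_, fun P hP => ?_⟩
  · intro P hP
    -- The set of regular deployments is not shown to be open. The explicit expression is continuous
    -- at `P` among all deployments, and it is the derivative at the regular ones.
    have hc : ContinuousAt (fun P => interiorTerm η i (interior (Q ∩ W)) (φ i) P +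
        ∑ j, interfaceTerm η i (interior (Q ∩ W)) (φ i) j P) P :=
      (continuousAt_interiorTerm hη hP.2.1 (hP.1 i) (hdiff i) (hint' i)
        (hdom i _ (hP.1 i))).add (tendsto_finsetSum _ fun j _ =>
          continuousAt_interfaceTerm hη hMO hP.2.1 hP.2.2 (hP.1 i) (hcont i) j)
    exact hc.continuousWithinAt.congr (fun P' hP' => (hderiv P' hP').fderiv) (hderiv P hP).fderiv
  · obtain ⟨hsq, hinj, hreg⟩ := id hP
    simp only [hcell]
    refine ⟨fun hne => ae_exists_isOutwardNormal_leastCostRegion hη hK hne hinj hreg,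
      fun j => ⟨ae_exists_isBoundaryVelocity hη hinj hreg j, fun dγ hdγ => ?_⟩⟩
    obtain ⟨hi, hb⟩ := integral_boundary_eq hη hMO hinj hreg
      (continuous_of_continuousOn_openSquare (hcont i) (hsq i)) j hdγ
    refine ⟨hi, ?_⟩
    have hD : HasFDerivAt (cellIntegral Q W η φ i)
        (interiorTerm η i (interior (Q ∩ W)) (φ i) P +
          ∑ j, interfaceTerm η i (interior (Q ∩ W)) (φ i) j P)
        (Function.update P j (P j)) := by
      rw [Function.update_eq_self]; exact hderiv P hP
    -- The partial derivative is the total one composed with the inclusion of the `j`-th position.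
    refine (hD.comp (P j) (hasFDerivAt_update_position P j (P j))).congr_fderiv ?_
    rw [hb, ← hcell, ← compPositionInclusion_interiorTerm hK (hint' i _ (hsq i)) j, ← map_add]
    rfl
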